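/- Let $N\ge 5$ and $n\ge 2$ be integers, let $a_1,\dots,a_n\in\mathbb{R}^N$ be $n$ distinct points, and set $$V_n(x)=\sum_{1\le i<j\le n}\frac{|a_i-a_j|^2}{|x-a_i|^2|x-a_j|^2}\left(\sum_{1\le k<l\le n}\frac{\nu_{k,i,j}\,\nu_{l,i,j}\,|a_k-a_l|^2}{|x-a_k|^2|x-a_l|^2}\right),$$ where $\nu_{k,i,j}=\frac{N+2n-4}{N}$ if $k=i$ or $k=j$, and $\nu_{k,i,j}=\frac{N-4}{N}$ otherwise. Put $\lambda_n=\frac{N^2(N-4)^2}{n^4}$ and $H_n=\Delta^2-\lambda_n V_n$, with quadratic form $$\langle H_nu,u\rangle=\int_{\mathbb{R}^N}|\Delta u|^2\,dx-\lambda_n\int_{\mathbb{R}^N}V_n|u|^2\,dx ,\qquad u\in C_0^\infty(\mathbb{R}^N)$$ (functions are real-valued). Let $D^{2,2}(\mathbb{R}^N)$ be the completion of $C_0^\infty(\mathbb{R}^N)$ for the norm $\|\Delta u\|_{2}$, realized as a space of functions. Then $H_n$ is critical in $\mathbb{R}^N$ for every $n\ge2$: one has $\langle H_nu,u\rangle\ge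 0$ for all $u\in C_0^\infty(\mathbb{R}^N)$, and there is no nonnegative continuous function $W\not\equiv 0$ on $\mathbb{R}^N$ such that $$\langle H_nu,u\rangle\ge\int_{\mathbb{R}^N}W|u|^2\,dx\qquad\text{for all }u\in C_0^\infty(\mathbb{R}^N).$$ Moreover, $\lambda_n$ is the sharp constant, that is, $$\lambda_n=\inf_{u\in D^{2,2}(\mathbb{R}^N)\setminus\{0\}}\frac{\|\Delta u\|_2^2}{\int_{\mathbb{R}^N}V_n|u|^2\,dx},$$ and $H_n$ is positive-critical for $n\ge3$, i.e. this infimum is achieved by some $u\in D^{2,2}(\mathbb{R}^N)\setminus\{0\}$, and null-critical for $n=2$, i.e. this infimum is not achieved in $D^{2,2}(\mathbb{R}^N)\setminus\{0\}$. -/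

import Mathlib

open MeasureTheory Filter Topology
open scoped ContDiff Laplacian

noncomputable section

namespace MultipolarRellich

/-- The class `C_0^∞(ℝ^N)` of real smooth functions with compact support. -/
def IsTestFunction {N : ℕ} (u : EuclideanSpace ℝ (Fin N) → ℝ) : Prop :=
  ContDiff ℝ ∞ u ∧ HasCompactSupport u

/-- `u` belongs to `D^{2,2}(ℝ^N)`, the completion of `C_0^∞(ℝ^N)` for the norm `‖Δu‖_2`, and `g` is
its Laplacian, so that its norm is `‖g‖_2`: there are test functions `w k` whose Laplacians converge
to `g` in `L²` and which converge to `u` almost everywhere.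

For `N ≥ 5` this is the usual realization of the completion as a space of (classes of) functions:
by the Sobolev inequality `‖w‖_{2N/(N-4)} ≤ C ‖Δw‖_2` a Cauchy sequence for `‖Δ·‖_2` converges in
`L^{2N/(N-4)}`, hence almost everywhere along a subsequence, and its limit `u` determines `g`, which
is the distributional Laplacian of `u`. (Convergence of `w k` cannot be dropped: functions that
differ by a harmonic function have the same Laplacian.) -/
def MemD22 {N : ℕ} (u g : EuclideanSpace ℝ (Fin N) → ℝ) : Prop :=
  MemLp g 2 volume ∧
    ∃ w : ℕ → EuclideanSpace ℝ (Fin N) → ℝ,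
      (∀ k, IsTestFunction (w k)) ∧
      Tendsto (fun k => eLpNorm (fun x => Δ (w k) x - g x) 2 volume) atTop (𝓝 0) ∧
      ∀ᵐ x, Tendsto (fun k => w k x) atTop (𝓝 (u x))

/-- The quadratic form `⟨Hu, u⟩ = ∫ |Δu|² - c ∫ V |u|²` of the operator `H = Δ² - c V`. -/
def quadForm {N : ℕ} (c : ℝ) (V u : EuclideanSpace ℝ (Fin N) → ℝ) : ℝ :=
  (∫ x, (Δ u x) ^ 2) - c * ∫ x, V x * (u x) ^ 2

/-- `H = Δ² - c V ≥ 0`: the quadratic form is well defined and nonnegative on test functions. -/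
def IsNonnegative {N : ℕ} (c : ℝ) (V : EuclideanSpace ℝ (Fin N) → ℝ) : Prop :=
  ∀ u, IsTestFunction u → Integrable (fun x => V x * (u x) ^ 2) ∧ 0 ≤ quadForm c V u

/-- `H = Δ² - c V` is subcritical: `H ≥ 0`, and some nonzero nonnegative continuous function `W`
can be added on the right-hand side. -/
def IsSubcritical {N : ℕ} (c : ℝ) (V : EuclideanSpace ℝ (Fin N) → ℝ) : Prop :=
  IsNonnegative c V ∧
    ∃ W : EuclideanSpace ℝ (Fin N) → ℝ, Continuous W ∧ (∀ x, 0 ≤ W x) ∧ W ≠ 0 ∧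
      ∀ u, IsTestFunction u → ∫ x, W x * (u x) ^ 2 ≤ quadForm c V u

/-- `H = Δ² - c V` is critical: `H ≥ 0`, and `H` is not subcritical. -/
def IsCritical {N : ℕ} (c : ℝ) (V : EuclideanSpace ℝ (Fin N) → ℝ) : Prop :=
  IsNonnegative c V ∧ ¬ IsSubcritical c V

/-- The values `‖Δu‖_2² / ∫ V |u|²` for `u ∈ D^{2,2}(ℝ^N) \ {0}`. -/
def rayleighQuotients {N : ℕ} (V : EuclideanSpace ℝ (Fin N) → ℝ) : Set ℝ :=
  {q | ∃ u g, MemD22 u g ∧ ¬ u =ᵐ[volume] 0 ∧ q = (∫ x, (g x) ^ 2) / ∫ x, V x * (u x) ^ 2}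

/-- `c` is the sharp constant in `‖Δu‖_2² ≥ c ∫ V |u|²`: the infimum of the quotients over
`D^{2,2}(ℝ^N) \ {0}`. The first clause says that the denominators are finite and nonzero. -/
def IsSharpConstant {N : ℕ} (c : ℝ) (V : EuclideanSpace ℝ (Fin N) → ℝ) : Prop :=
  (∀ u g, MemD22 u g → ¬ u =ᵐ[volume] 0 →
      Integrable (fun x => V x * (u x) ^ 2) ∧ 0 < ∫ x, V x * (u x) ^ 2) ∧
    IsGLB (rayleighQuotients V) c

/-- `H = Δ² - c V` is positive-critical: it is critical, `c` is the sharp constant, and it is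
achieved in `D^{2,2}(ℝ^N)`. -/
def IsPositiveCritical {N : ℕ} (c : ℝ) (V : EuclideanSpace ℝ (Fin N) → ℝ) : Prop :=
  IsCritical c V ∧ IsSharpConstant c V ∧ c ∈ rayleighQuotients V

/-- `H = Δ² - c V` is null-critical: it is critical, `c` is the sharp constant, and it is
not achieved in `D^{2,2}(ℝ^N)`. -/
def IsNullCritical {N : ℕ} (c : ℝ) (V : EuclideanSpace ℝ (Fin N) → ℝ) : Prop :=
  IsCritical c V ∧ IsSharpConstant c V ∧ c ∉ rayleighQuotients V

/-- The weight `ν_{k,i,j}`. -/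
def nu (N : ℕ) {n : ℕ} (k i j : Fin n) : ℝ :=
  if k = i ∨ k = j then ((N : ℝ) + 2 * n - 4) / N else ((N : ℝ) - 4) / N

/-- The multipolar potential `V_n` with poles `a 0, …, a (n - 1)`. -/
def potential {N n : ℕ} (a : Fin n → EuclideanSpace ℝ (Fin N)) (x : EuclideanSpace ℝ (Fin N)) :
    ℝ :=
  ∑ i, ∑ j ∈ Finset.Ioi i, ‖a i - a j‖ ^ 2 / (‖x - a i‖ ^ 2 * ‖x - a j‖ ^ 2) *
    ∑ k, ∑ l ∈ Finset.Ioi k,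
      nu N k i j * nu N l i j * ‖a k - a l‖ ^ 2 / (‖x - a k‖ ^ 2 * ‖x - a l‖ ^ 2)

/-- The constant `N² (N - 4)² / n⁴`. -/
def rellichConst (N n : ℕ) : ℝ :=
  (N : ℝ) ^ 2 * ((N : ℝ) - 4) ^ 2 / (n : ℝ) ^ 4

end MultipolarRellich

end

/-! The operator comes from an explicit ground state. Put α = (N - 4)/n and φ = ∏ |x - a_i|^(-α).
Polarization expresses each scalar product (x - a_i)·(x - a_j) through squared distances, so -Δφ is
a nonnegative combination of products of the same kind with raised exponents. Applying Δ once more,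
the total exponent N - 4 of φ makes the unwanted terms cancel, and Δ²φ = λ_n V_n φ off the poles
(`laplacian_prodPow`, `sum_rate_eq_biRate`, `biRate_zero`).

Write -Δφ = ρφ with ρ ≥ 0 and substitute u = φv. Green's identity with the function u²/φ gives ∫
(Δu)² - λ_n ∫ V_n u² = ∫ (Δu + ρu)² + 2 ∫ ρ φ² |∇v|². To avoid the singularities, |x - a_i|² is
replaced by |x - a_i|² + s with s > 0: φ becomes smooth, the identity is exact
(`integral_laplacian_sq`), and its potential dominates λ_n times the regularized V_n
(`rellichConst_mul_regPotential_le`). Fatou's lemma, with s → 0 along the sequence that approximates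
u, gives the inequality on the whole energy space (`MemD22.rellich`).

For criticality and sharpness, test with ∏ |x - a_i|^(-β), β = α - δ. The remainder is at most δ²
times a density whose integral is O(1/δ), so the quadratic form is O(δ)
(`exists_almost_minimizers`), while the functions stay above a fixed positive minorant. Hence no
weight W can be added and no larger constant is possible. These products are limits of truncated
regularizations, controlled by `exists_approx_bound`.

For n ≥ 3, 2α < N - 4, so φ itself has finite energy; its remainder vanishes and it attains the
infimum. For n = 2, equality forces the remainders of the approximations to zero, so the gradients
of their quotients by the regularized φ tend to zero locally in L². The limit u/φ is then
translation invariant, hence constant (`exists_eq_const_mul_singPow`). But V_2 φ² behaves like |x -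
a_i|^(-N) at the poles and is not integrable. -/

namespace MultipolarRellich

/-! ### Coordinate calculus: Laplacian, product rules, integration by parts, scaling -/

section Calculus

variable {N : ℕ}

/-- The partial derivative of `f` in the `k`-th coordinate direction. -/
noncomputable def pd (k : Fin N) (f : EuclideanSpace ℝ (Fin N) → ℝ)
    (x : EuclideanSpace ℝ (Fin N)) : ℝ :=
  fderiv ℝ f x (EuclideanSpace.single k 1)

variable {f g : EuclideanSpace ℝ (Fin N) → ℝ}

lemma laplacian_eq_sum_pd (hf : ContDiff ℝ ∞ f) (x : EuclideanSpace ℝ (Fin N)) :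
    Δ f x = ∑ k, pd k (pd k f) x := by
  rw [InnerProductSpace.laplacian_eq_iteratedFDeriv_orthonormalBasis f
    (EuclideanSpace.basisFun (Fin N) ℝ)]
  refine Finset.sum_congr rfl fun k _ => ?_
  rw [iteratedFDeriv_two_apply]
  have h : DifferentiableAt ℝ (fderiv ℝ f) x :=
    ((hf.fderiv_right (m := 1) (by norm_cast)).differentiable (by norm_num)) x
  have h2 : fderiv ℝ (pd k f) x = fderiv ℝ
      (fun x => (fderiv ℝ f x) ((fun _ => EuclideanSpace.single k (1 : ℝ)) x)) x := rfl
  rw [show pd k (pd k f) x = fderiv ℝ (pd k f) x (EuclideanSpace.single k 1) from rfl, h2,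
    fderiv_clm_apply h (differentiableAt_const _)]
  simp

lemma contDiff_pd (k : Fin N) (hf : ContDiff ℝ ∞ f) : ContDiff ℝ ∞ (pd k f) :=
  (hf.fderiv_right (m := ∞) (by norm_cast)).clm_apply contDiff_const

lemma hasCompactSupport_pd (k : Fin N) (hf : HasCompactSupport f) : HasCompactSupport (pd k f) :=
  hf.fderiv_apply (𝕜 := ℝ) _

lemma contDiff_laplacian (hf : ContDiff ℝ ∞ f) : ContDiff ℝ ∞ (Δ f) := by
  rw [show Δ f = fun x => ∑ k, pd k (pd k f) x from funext (laplacian_eq_sum_pd hf)]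
  exact ContDiff.sum fun k _ => contDiff_pd k (contDiff_pd k hf)

lemma hasCompactSupport_laplacian (hc : HasCompactSupport f) :
    HasCompactSupport (Δ f) := by
  refine hc.mono' fun x hx => ?_
  by_contra hx'
  apply hx
  have : f =ᶠ[𝓝 x] 0 := notMem_tsupport_iff_eventuallyEq.mp hx'
  have h2 := InnerProductSpace.laplacian_congr_nhds this
  have h3 := h2.self_of_nhds
  rw [h3]
  exact congrFun (InnerProductSpace.laplacian_const (c := (0 : ℝ))) x

lemma pd_mul (k : Fin N) (hf : ContDiff ℝ ∞ f) (hg : ContDiff ℝ ∞ g)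
    (x : EuclideanSpace ℝ (Fin N)) :
    pd k (fun y => f y * g y) x = pd k f x * g x + f x * pd k g x := by
  simp only [pd]
  rw [fderiv_fun_mul (hf.differentiable (by norm_num) x) (hg.differentiable (by norm_num) x)]
  simp only [add_apply, smul_apply, smul_eq_mul]
  ring

lemma pd_add (k : Fin N) (hf : ContDiff ℝ ∞ f) (hg : ContDiff ℝ ∞ g)
    (x : EuclideanSpace ℝ (Fin N)) :
    pd k (fun y => f y + g y) x = pd k f x + pd k g x := by
  simp only [pd]
  rw [fderiv_fun_add (hf.differentiable (by norm_num) x) (hg.differentiable (by norm_num) x)]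
  rfl

lemma laplacian_fun_mul (hf : ContDiff ℝ ∞ f) (hg : ContDiff ℝ ∞ g)
    (x : EuclideanSpace ℝ (Fin N)) :
    Δ (fun y => f y * g y) x =
      f x * Δ g x + 2 * ∑ k, pd k f x * pd k g x + g x * Δ f x := by
  rw [laplacian_eq_sum_pd (hf.mul hg), laplacian_eq_sum_pd hf, laplacian_eq_sum_pd hg,
    Finset.mul_sum, Finset.mul_sum, Finset.mul_sum, ← Finset.sum_add_distrib,
    ← Finset.sum_add_distrib]
  refine Finset.sum_congr rfl fun k _ => ?_
  rw [show pd k (fun y => f y * g y) = fun y => pd k f y * g y + f y * pd k g y from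
    funext (pd_mul k hf hg), pd_add k ((contDiff_pd k hf).mul hg) (hf.mul (contDiff_pd k hg)),
    pd_mul k (contDiff_pd k hf) hg, pd_mul k hf (contDiff_pd k hg)]
  ring

lemma laplacian_const_mul (c : ℝ) (hf : ContDiff ℝ ∞ f) (x : EuclideanSpace ℝ (Fin N)) :
    Δ (fun y => c * f y) x = c * Δ f x :=
  InnerProductSpace.laplacian_smul c (hf.of_le (by norm_cast)).contDiffAt

lemma laplacian_fun_sum {ι : Type*} (s : Finset ι) {F : ι → EuclideanSpace ℝ (Fin N) → ℝ}
    (hF : ∀ i ∈ s, ContDiff ℝ ∞ (F i)) (x : EuclideanSpace ℝ (Fin N)) :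
    Δ (fun y => ∑ i ∈ s, F i y) x = ∑ i ∈ s, Δ (F i) x := by
  classical
  induction s using Finset.induction_on with
  | empty => exact congrFun (InnerProductSpace.laplacian_const (c := (0 : ℝ))) x
  | insert i s hi ih =>
    simp only [Finset.sum_insert hi]
    rw [← ih fun j hj => hF j (Finset.mem_insert_of_mem hj)]
    exact ContDiffAt.laplacian_add
      ((hF i (Finset.mem_insert_self _ _)).of_le (by norm_cast)).contDiffAt
      ((ContDiff.sum fun j hj => hF j (Finset.mem_insert_of_mem hj)).of_le
        (by norm_cast)).contDiffAt

lemma integral_mul_pd (k : Fin N) (hf : ContDiff ℝ ∞ f) (hg : ContDiff ℝ ∞ g)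
    (hc : HasCompactSupport f ∨ HasCompactSupport g) :
    ∫ x, f x * pd k g x = - ∫ x, pd k f x * g x := by
  have key : ∀ {p q : EuclideanSpace ℝ (Fin N) → ℝ}, Continuous p → Continuous q →
      (HasCompactSupport p ∨ HasCompactSupport q) → Integrable (fun x => p x * q x) := by
    intro p q hp hq h
    refine (hp.mul hq).integrable_of_hasCompactSupport ?_
    rcases h with h | h
    · exact h.mul_right
    · exact h.mul_left
  refine integral_mul_fderiv_eq_neg_fderiv_mul_of_integrable
    (key (contDiff_pd k hf).continuous hg.continuous (hc.imp_left (hasCompactSupport_pd k)))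
    (key hf.continuous (contDiff_pd k hg).continuous (hc.imp_right (hasCompactSupport_pd k)))
    (key hf.continuous hg.continuous hc)
    (fun x _ => hf.differentiable (by norm_num) x) (fun x _ => hg.differentiable (by norm_num) x)

/-- Green's identity for a smooth function and a compactly supported smooth function. -/
lemma integral_mul_laplacian (hf : ContDiff ℝ ∞ f) (hg : ContDiff ℝ ∞ g)
    (hc : HasCompactSupport g) : ∫ x, f x * Δ g x = ∫ x, Δ f x * g x := by
  have key : ∀ {p q : EuclideanSpace ℝ (Fin N) → ℝ}, ContDiff ℝ ∞ p → ContDiff ℝ ∞ q →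
      HasCompactSupport q → Integrable (fun x => p x * q x) := fun hp hq h =>
    (hp.continuous.mul hq.continuous).integrable_of_hasCompactSupport h.mul_left
  simp only [laplacian_eq_sum_pd hf, laplacian_eq_sum_pd hg, Finset.mul_sum, Finset.sum_mul]
  have hk := fun k : Fin N => hasCompactSupport_pd k hc
  rw [integral_finsetSum _ fun k _ => key hf (contDiff_pd k (contDiff_pd k hg))
      (hasCompactSupport_pd k (hk k)),
    integral_finsetSum _ fun k _ => key (contDiff_pd k (contDiff_pd k hf)) hg hc]
  refine Finset.sum_congr rfl fun k _ => ?_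
  rw [integral_mul_pd k hf (contDiff_pd k hg) (Or.inr (hk k)),
    integral_mul_pd k (contDiff_pd k hf) hg (Or.inr hc), neg_neg]

lemma pd_comp_const_smul (k : Fin N) (c : ℝ) (f : EuclideanSpace ℝ (Fin N) → ℝ)
    (x : EuclideanSpace ℝ (Fin N)) : pd k (fun y => f (c • y)) x = c * pd k f (c • x) := by
  simp only [pd]
  rw [fderiv_comp_smul]
  simp

lemma laplacian_comp_const_smul (c : ℝ) (hf : ContDiff ℝ ∞ f)
    (x : EuclideanSpace ℝ (Fin N)) : Δ (fun y => f (c • y)) x = c ^ 2 * Δ f (c • x) := by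
  rw [laplacian_eq_sum_pd (f := fun y => f (c • y)) (hf.comp (contDiff_const_smul c)),
    laplacian_eq_sum_pd hf, Finset.mul_sum]
  refine Finset.sum_congr rfl fun k _ => ?_
  rw [show pd k (fun y => f (c • y)) = fun y => c * pd k f (c • y) from
    funext (pd_comp_const_smul k c f)]
  have := pd_mul k (contDiff_const (c := c)) ((contDiff_pd k hf).comp (contDiff_const_smul c)) x
  simp only [Function.comp_def] at this
  rw [this, pd_comp_const_smul k c (pd k f)]
  simp [pd]
  ring

end Calculus

/-! ### Laplacians of regularized products of powers of distances -/

section Products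

variable {N n : ℕ} (a : Fin n → EuclideanSpace ℝ (Fin N)) (s : ℝ) (γ : Fin n → ℝ)

/-- The regularized inverse square distance `1 / (|x - a_i|² + s)`. -/
noncomputable def invSq (i : Fin n) (x : EuclideanSpace ℝ (Fin N)) : ℝ := (‖x - a i‖ ^ 2 + s)⁻¹

/-- The product `∏ (|x - a_i|² + s) ^ (-γ_i / 2)`. -/
noncomputable def prodPow (x : EuclideanSpace ℝ (Fin N)) : ℝ :=
  ∏ i, (‖x - a i‖ ^ 2 + s) ^ (-(γ i / 2))

/-- Minus the `k`-th component of the logarithmic gradient of `prodPow a s γ`. -/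
noncomputable def logGrad (k : Fin N) (x : EuclideanSpace ℝ (Fin N)) : ℝ :=
  ∑ i, γ i * (x k - a i k) * invSq a s i x

/-- The weights `|a_i - a_j|² / 2 + s`. -/
noncomputable def pairWeight (i j : Fin n) : ℝ := ‖a i - a j‖ ^ 2 / 2 + s

/-- The quadratic part of `-Δ ψ / ψ` for `ψ = prodPow a s γ`. -/
noncomputable def quadRate (x : EuclideanSpace ℝ (Fin N)) : ℝ :=
  ∑ i, ∑ j, γ i * γ j * pairWeight a s i j * invSq a s i x * invSq a s j x +
    2 * s * ∑ i, γ i * invSq a s i x ^ 2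

/-- The quotient `-Δ ψ / ψ` for `ψ = prodPow a s γ`. -/
noncomputable def rate (x : EuclideanSpace ℝ (Fin N)) : ℝ :=
  ((N : ℝ) - 2 - ∑ i, γ i) * ∑ i, γ i * invSq a s i x + quadRate a s γ x

variable {s}

lemma rho_pos (hs : 0 < s) (i : Fin n) (x : EuclideanSpace ℝ (Fin N)) : 0 < ‖x - a i‖ ^ 2 + s := by
  positivity

lemma invSq_nonneg (hs : 0 ≤ s) (i : Fin n) (x : EuclideanSpace ℝ (Fin N)) : 0 ≤ invSq a s i x := by
  unfold invSq; positivity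

lemma prodPow_pos (hs : 0 < s) (x : EuclideanSpace ℝ (Fin N)) : 0 < prodPow a s γ x :=
  Finset.prod_pos fun i _ => Real.rpow_pos_of_pos (rho_pos a hs i x) _

lemma contDiff_rho (i : Fin n) :
    ContDiff ℝ ∞ fun x : EuclideanSpace ℝ (Fin N) => ‖x - a i‖ ^ 2 + s :=
  ((contDiff_id.sub contDiff_const).norm_sq ℝ).add contDiff_const

lemma contDiff_invSq (hs : 0 < s) (i : Fin n) : ContDiff ℝ ∞ (invSq a s i) :=
  (contDiff_rho a i).inv fun x => (rho_pos a hs i x).ne'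

lemma contDiff_prodPow (hs : 0 < s) : ContDiff ℝ ∞ (prodPow a s γ) :=
  contDiff_prod fun i _ => (contDiff_rho a i).rpow_const_of_ne fun x => (rho_pos a hs i x).ne'

lemma contDiff_logGrad (hs : 0 < s) (k : Fin N) : ContDiff ℝ ∞ (logGrad a s γ k) := by
  refine ContDiff.sum fun i _ => (contDiff_const.mul ?_).mul (contDiff_invSq a hs i)
  exact (contDiff_piLp_apply (𝕜 := ℝ) 2 (i := k)).sub contDiff_const

lemma hasFDerivAt_rho (i : Fin n) (x : EuclideanSpace ℝ (Fin N)) :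
    HasFDerivAt (fun x : EuclideanSpace ℝ (Fin N) => ‖x - a i‖ ^ 2 + s)
      (2 • innerSL ℝ (x - a i)) x := by
  simpa using ((hasFDerivAt_id x).sub_const (a i)).norm_sq.add_const s

lemma pd_prodPow (hs : 0 < s) (k : Fin N) (x : EuclideanSpace ℝ (Fin N)) :
    pd k (prodPow a s γ) x = -(logGrad a s γ k x * prodPow a s γ x) := by
  -- As the exponential of a sum of logarithms, the product has its logarithmic gradient as a plain
  -- sum.
  have e : ∀ x, prodPow a s γ x = Real.exp (∑ i, Real.log (‖x - a i‖ ^ 2 + s) * (-(γ i / 2))) := by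
    intro x
    rw [Real.exp_sum]
    exact Finset.prod_congr rfl fun i _ => Real.rpow_def_of_pos (rho_pos a hs i x) _
  have h := (HasFDerivAt.fun_sum (u := Finset.univ) fun i _ =>
    ((hasFDerivAt_rho (s := s) a i x).log (rho_pos a hs i x).ne').mul_const (-(γ i / 2))).exp
  rw [← e x] at h
  rw [← show prodPow a s γ = fun x => _ from funext e] at h
  rw [pd, h.fderiv]
  simp only [logGrad, invSq, smul_apply, sum_apply, innerSL_apply_apply,
    EuclideanSpace.inner_single_right, smul_eq_mul, nsmul_eq_mul]
  simp only [PiLp.sub_apply]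
  rw [mul_comm (∑ i, _), ← mul_neg, ← Finset.sum_neg_distrib]
  congr 1
  refine Finset.sum_congr rfl fun i _ => ?_
  simp
  ring

lemma pd_logGrad (hs : 0 < s) (k : Fin N) (x : EuclideanSpace ℝ (Fin N)) :
    pd k (logGrad a s γ k) x =
      ∑ i, γ i * (invSq a s i x - 2 * (x k - a i k) ^ 2 * invSq a s i x ^ 2) := by
  have h0 : HasFDerivAt (fun x : EuclideanSpace ℝ (Fin N) => x k)
      (EuclideanSpace.proj k : EuclideanSpace ℝ (Fin N) →L[ℝ] ℝ) x :=
    (EuclideanSpace.proj k : EuclideanSpace ℝ (Fin N) →L[ℝ] ℝ).hasFDerivAt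
  have h := HasFDerivAt.fun_sum (u := Finset.univ) fun i _ =>
    ((h0.sub_const (a i k)).const_mul (γ i)).mul
      ((hasDerivAt_inv (rho_pos a hs i x).ne').comp_hasFDerivAt x (hasFDerivAt_rho (s := s) a i x))
  rw [pd, show logGrad a s γ k = fun x => _ from rfl]
  unfold invSq
  refine (congrArg (fun L => L (EuclideanSpace.single k 1)) h.fderiv).trans ?_
  simp only [sum_apply]
  refine Finset.sum_congr rfl fun i _ => ?_
  simp [EuclideanSpace.inner_single_right]
  ring

/-- Polarization. The same s is added and subtracted, so that the two distances appear in the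
regularized form that cancels against `invSq`; the compensation is the s in `pairWeight`. -/
lemma inner_sub_eq (x : EuclideanSpace ℝ (Fin N)) (i j : Fin n) :
    ∑ k, (x k - a i k) * (x k - a j k) =
      ((‖x - a i‖ ^ 2 + s) + (‖x - a j‖ ^ 2 + s)) / 2 - pairWeight a s i j := by
  simp only [pairWeight, EuclideanSpace.real_norm_sq_eq, PiLp.sub_apply]
  have : ∀ k, (x k - a i k) * (x k - a j k) =
      (x k - a i k) ^ 2 / 2 + (x k - a j k) ^ 2 / 2 - (a i k - a j k) ^ 2 / 2 := fun k => by ring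
  simp only [this, Finset.sum_add_distrib, Finset.sum_sub_distrib, Finset.sum_div]
  rw [← Finset.sum_div, ← Finset.sum_div, ← Finset.sum_div]
  ring

/-- Expand the square and polarize: each regularized distance cancels one inverse factor and
produces a linear term. Only nonvanishing denominators are needed, so that s = 0 is allowed off the
poles. -/
lemma sum_logGrad_sq {x : EuclideanSpace ℝ (Fin N)} (hx : ∀ i, ‖x - a i‖ ^ 2 + s ≠ 0) :
    ∑ k, logGrad a s γ k x ^ 2 = (∑ i, γ i) * ∑ i, γ i * invSq a s i x -
      ∑ i, ∑ j, γ i * γ j * pairWeight a s i j * invSq a s i x * invSq a s j x := by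
  have h1 : ∑ k, logGrad a s γ k x ^ 2 = ∑ i, ∑ j, (γ i * invSq a s i x) * (γ j * invSq a s j x) *
      ∑ k, (x k - a i k) * (x k - a j k) := by
    simp only [logGrad, sq, Finset.sum_mul_sum]
    rw [Finset.sum_comm]
    refine Finset.sum_congr rfl fun i _ => ?_
    rw [Finset.sum_comm]
    simp only [Finset.mul_sum]
    exact Finset.sum_congr rfl fun j _ => Finset.sum_congr rfl fun k _ => by ring
  have h2 : ∀ i j, (γ i * invSq a s i x) * (γ j * invSq a s j x) *
      ∑ k, (x k - a i k) * (x k - a j k) = γ i * (γ j * invSq a s j x) / 2 +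
        γ j * (γ i * invSq a s i x) / 2 -
        γ i * γ j * pairWeight a s i j * invSq a s i x * invSq a s j x := by
    intro i j
    rw [inner_sub_eq a (s := s)]
    have hi : invSq a s i x * (‖x - a i‖ ^ 2 + s) = 1 := inv_mul_cancel₀ (hx i)
    have hj : invSq a s j x * (‖x - a j‖ ^ 2 + s) = 1 := inv_mul_cancel₀ (hx j)
    linear_combination (γ i * γ j * invSq a s j x / 2) * hi + (γ i * γ j * invSq a s i x / 2) * hj
  rw [h1]
  simp only [h2, Finset.sum_sub_distrib, Finset.sum_add_distrib]
  have h3 : ∑ i, ∑ j, γ i * (γ j * invSq a s j x) / 2 =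
      (∑ i, γ i) * (∑ i, γ i * invSq a s i x) / 2 := by
    rw [Finset.sum_mul_sum, Finset.sum_div]
    exact Finset.sum_congr rfl fun i _ => by rw [Finset.sum_div]
  rw [Finset.sum_comm (f := fun i j => γ j * (γ i * invSq a s i x) / 2), h3]
  ring

/-- With ∇ψ = -Lψ one has Δψ = (|L|² - div L) ψ; the divergence contributes N - 2 to the linear
coefficient and |L|² contributes -∑ γ_i. -/
lemma laplacian_prodPow (hs : 0 < s) (x : EuclideanSpace ℝ (Fin N)) :
    Δ (prodPow a s γ) x = -(rate a s γ x * prodPow a s γ x) := by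
  rw [laplacian_eq_sum_pd (contDiff_prodPow a γ hs)]
  have h : ∀ k, pd k (pd k (prodPow a s γ)) x = logGrad a s γ k x ^ 2 * prodPow a s γ x -
      (∑ i, γ i * (invSq a s i x - 2 * (x k - a i k) ^ 2 * invSq a s i x ^ 2)) *
        prodPow a s γ x := by
    intro k
    rw [show pd k (prodPow a s γ) = fun x => (-1) * (logGrad a s γ k x * prodPow a s γ x) from
      funext fun x => by rw [pd_prodPow a γ hs]; ring,
      pd_mul k contDiff_const ((contDiff_logGrad a γ hs k).mul (contDiff_prodPow a γ hs)),
      pd_mul k (contDiff_logGrad a γ hs k) (contDiff_prodPow a γ hs), pd_logGrad a γ hs,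
      pd_prodPow a γ hs]
    simp [pd]
    ring
  simp only [h, Finset.sum_sub_distrib, ← Finset.sum_mul]
  rw [sum_logGrad_sq a γ fun i => (rho_pos a hs i x).ne',
    Finset.sum_comm (s := Finset.univ (α := Fin N))]
  have h2 : ∀ i, ∑ k, γ i * (invSq a s i x - 2 * (x k - a i k) ^ 2 * invSq a s i x ^ 2) =
      (N - 2) * (γ i * invSq a s i x) + 2 * s * (γ i * invSq a s i x ^ 2) := by
    intro i
    have h3 : ∑ k, (x k - a i k) ^ 2 = ‖x - a i‖ ^ 2 := by
      simp [EuclideanSpace.real_norm_sq_eq]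
    rw [← Finset.mul_sum, Finset.sum_sub_distrib, ← Finset.sum_mul, ← Finset.mul_sum, h3]
    have hi : invSq a s i x * (‖x - a i‖ ^ 2 + s) = 1 := inv_mul_cancel₀ (rho_pos a hs i x).ne'
    simp
    linear_combination (-2 * γ i * invSq a s i x) * hi
  simp only [h2, Finset.sum_add_distrib, ← Finset.mul_sum, rate, quadRate]
  ring

/-- Dividing by a regularized squared distance stays in the family of products, so
`laplacian_prodPow` can be applied to -Δφ term by term. -/
lemma prodPow_add_single (hs : 0 < s) (i : Fin n) (x : EuclideanSpace ℝ (Fin N)) :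
    prodPow a s (fun k => γ k + if k = i then 2 else 0) x = prodPow a s γ x * invSq a s i x := by
  have h : ∀ k, (‖x - a k‖ ^ 2 + s) ^ (-((γ k + if k = i then 2 else 0) / 2)) =
      (‖x - a k‖ ^ 2 + s) ^ (-(γ k / 2)) * if k = i then invSq a s i x else 1 := by
    intro k
    split_ifs with hk
    · subst hk
      rw [show -((γ k + 2) / 2) = -(γ k / 2) + -1 by ring, Real.rpow_add (rho_pos a hs k x),
        Real.rpow_neg_one]
      rfl
    · simp
  simp only [prodPow, h, Finset.prod_mul_distrib]
  simp

end Products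

/-! ### The bi-Laplacian of the regularized ground state and the Rellich identity -/

section GroundState

variable {N n : ℕ} (a : Fin n → EuclideanSpace ℝ (Fin N)) (s α : ℝ)

lemma pairWeight_comm (i j : Fin n) : pairWeight a s i j = pairWeight a s j i := by
  simp only [pairWeight, norm_sub_rev]

lemma pairWeight_self (i : Fin n) : pairWeight a s i i = s := by simp [pairWeight]

/-- The coefficients of the quadratic part of `-Δ φ / φ`, for `φ` the ground state. -/
noncomputable def coef (i j : Fin n) : ℝ :=
  α * α * pairWeight a s i j + if i = j then 2 * s * α else 0

/-- The exponents of `φ / (|x - a_i|² + s)`. -/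
noncomputable def expOne (i k : Fin n) : ℝ := α + if k = i then 2 else 0

/-- The exponents of `φ / ((|x - a_i|² + s) (|x - a_j|² + s))`. -/
noncomputable def expTwo (i j k : Fin n) : ℝ := expOne α i k + if k = j then 2 else 0

/-- The quotient `Δ² φ / φ` for the regularized ground state `φ`. -/
noncomputable def biRate (x : EuclideanSpace ℝ (Fin N)) : ℝ :=
  ∑ i, ∑ j, coef a s α i j * invSq a s i x * invSq a s j x * quadRate a s (expTwo α i j) x

lemma quadRate_const (x : EuclideanSpace ℝ (Fin N)) :
    quadRate a s (fun _ => α) x = ∑ i, ∑ j, coef a s α i j * invSq a s i x * invSq a s j x := by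
  simp only [quadRate, coef, add_mul, Finset.sum_add_distrib, ite_mul, zero_mul,
    Finset.sum_ite_eq, Finset.mem_univ, if_true, Finset.mul_sum]
  congr 1
  exact Finset.sum_congr rfl fun i _ => by ring

lemma quadRate_expOne (i : Fin n) (x : EuclideanSpace ℝ (Fin N)) :
    quadRate a s (expOne α i) x = quadRate a s (fun _ => α) x +
      4 * α * invSq a s i x * (∑ j, pairWeight a s i j * invSq a s j x) +
      8 * s * invSq a s i x ^ 2 := by
  simp only [quadRate, expOne, add_mul, mul_add, Finset.sum_add_distrib, ite_mul, zero_mul,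
    Finset.sum_ite_eq', Finset.mem_univ, if_true, mul_ite, mul_zero, Finset.sum_ite_irrel,
    Finset.sum_const_zero, pairWeight_self]
  have h1 : ∑ x_1, α * 2 * pairWeight a s x_1 i * invSq a s x_1 x * invSq a s i x =
      2 * α * invSq a s i x * ∑ j, pairWeight a s i j * invSq a s j x := by
    rw [Finset.mul_sum]
    exact Finset.sum_congr rfl fun j _ => by rw [pairWeight_comm]; ring
  have h2 : ∑ x_1, 2 * α * pairWeight a s i x_1 * invSq a s i x * invSq a s x_1 x =
      2 * α * invSq a s i x * ∑ j, pairWeight a s i j * invSq a s j x := by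
    rw [Finset.mul_sum]
    exact Finset.sum_congr rfl fun j _ => by ring
  rw [h1, h2]
  ring

lemma sum_expTwo (i j : Fin n) (x : EuclideanSpace ℝ (Fin N)) :
    ∑ k, expTwo α i j k * invSq a s k x =
      α * ∑ k, invSq a s k x + 2 * invSq a s i x + 2 * invSq a s j x := by
  simp [expTwo, expOne, add_mul, Finset.sum_add_distrib, Finset.mul_sum]

variable {α}

/-- The exponents of φ add up to N - 4, so the linear coefficient N - 2 - ∑ γ_i equals 2. -/
lemma rate_const (hα : n * α = (N : ℝ) - 4) (x : EuclideanSpace ℝ (Fin N)) :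
    rate a s (fun _ => α) x = 2 * α * ∑ i, invSq a s i x +
      ∑ i, ∑ j, coef a s α i j * invSq a s i x * invSq a s j x := by
  rw [rate, quadRate_const]
  simp only [Finset.sum_const, Finset.card_univ, Fintype.card_fin, nsmul_eq_mul, hα,
    ← Finset.mul_sum]
  ring

/-- The exponents now add up to N - 2, exactly where the linear part disappears. -/
lemma rate_expOne (hα : n * α = (N : ℝ) - 4) (i : Fin n) (x : EuclideanSpace ℝ (Fin N)) :
    rate a s (expOne α i) x = quadRate a s (expOne α i) x := by
  rw [rate]
  simp only [expOne, Finset.sum_add_distrib, Finset.sum_ite_eq', Finset.mem_univ, if_true,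
    Finset.sum_const, Finset.card_univ, Fintype.card_fin, nsmul_eq_mul, hα]
  ring

/-- The exponents add up to N, so the linear coefficient is -2. -/
lemma rate_expTwo (hα : n * α = (N : ℝ) - 4) (i j : Fin n) (x : EuclideanSpace ℝ (Fin N)) :
    rate a s (expTwo α i j) x = quadRate a s (expTwo α i j) x -
      2 * (α * ∑ k, invSq a s k x + 2 * invSq a s i x + 2 * invSq a s j x) := by
  rw [rate, sum_expTwo]
  simp only [expTwo, expOne, Finset.sum_add_distrib, Finset.sum_ite_eq', Finset.mem_univ, if_true,
    Finset.sum_const, Finset.card_univ, Fintype.card_fin, nsmul_eq_mul, hα]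
  ring

/-- The key cancellation. The first sum contributes 2α (∑ r_i) q plus cubic terms, where r_i is
`invSq` and q is the quadratic part of -Δφ/φ. The linear coefficient -2 in the second sum produces
the opposite of exactly these, thanks to the symmetry of `coef`. -/
lemma sum_rate_eq_biRate (hα : n * α = (N : ℝ) - 4) (x : EuclideanSpace ℝ (Fin N)) :
    2 * α * ∑ i, invSq a s i x * rate a s (expOne α i) x +
      ∑ i, ∑ j, coef a s α i j * invSq a s i x * invSq a s j x * rate a s (expTwo α i j) x =
      biRate a s α x := by
  set q := quadRate a s (fun _ => α) x with hq
  set S := ∑ i, invSq a s i x with hS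
  have h1 : ∑ i, invSq a s i x * rate a s (expOne α i) x = S * q +
      4 * α * (∑ i, invSq a s i x ^ 2 * ∑ j, pairWeight a s i j * invSq a s j x) +
      8 * s * ∑ i, invSq a s i x ^ 3 := by
    rw [hS, Finset.sum_mul, Finset.mul_sum, Finset.mul_sum, ← Finset.sum_add_distrib,
      ← Finset.sum_add_distrib]
    refine Finset.sum_congr rfl fun i _ => ?_
    rw [rate_expOne a s hα, quadRate_expOne]
    ring
  have h2 : ∑ i, ∑ j, coef a s α i j * invSq a s i x ^ 2 * invSq a s j x =
      α ^ 2 * (∑ i, invSq a s i x ^ 2 * ∑ j, pairWeight a s i j * invSq a s j x) +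
        2 * s * α * ∑ i, invSq a s i x ^ 3 := by
    rw [Finset.mul_sum, Finset.mul_sum, ← Finset.sum_add_distrib]
    refine Finset.sum_congr rfl fun i _ => ?_
    simp only [coef, add_mul, Finset.sum_add_distrib, ite_mul, zero_mul, Finset.sum_ite_eq,
      Finset.mem_univ, if_true, Finset.mul_sum]
    congr 1
    · exact Finset.sum_congr rfl fun j _ => by ring
    · ring
  have h3 : ∑ i, ∑ j, coef a s α i j * invSq a s i x * invSq a s j x ^ 2 =
      ∑ i, ∑ j, coef a s α i j * invSq a s i x ^ 2 * invSq a s j x := by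
    rw [Finset.sum_comm]
    refine Finset.sum_congr rfl fun i _ => Finset.sum_congr rfl fun j _ => ?_
    simp only [coef, pairWeight_comm a s j i, eq_comm (a := j) (b := i)]
    ring
  have h4 : ∑ i, ∑ j, coef a s α i j * invSq a s i x * invSq a s j x * rate a s (expTwo α i j) x =
      biRate a s α x - 2 * α * S * q -
        4 * ∑ i, ∑ j, coef a s α i j * invSq a s i x ^ 2 * invSq a s j x -
        4 * ∑ i, ∑ j, coef a s α i j * invSq a s i x * invSq a s j x ^ 2 := by
    rw [hq, quadRate_const, biRate]
    simp only [Finset.mul_sum, ← Finset.sum_sub_distrib]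
    refine Finset.sum_congr rfl fun i _ => Finset.sum_congr rfl fun j _ => ?_
    rw [rate_expTwo a s hα, ← hS]
    ring
  rw [h1, h4, h3, h2]
  ring

variable {s}

/-- The regularized ground state `φ` solves `Δ² φ = biRate * φ`. -/
lemma laplacian_rate_mul_prodPow (hs : 0 < s) (hα : n * α = (N : ℝ) - 4)
    (x : EuclideanSpace ℝ (Fin N)) :
    Δ (fun y => rate a s (fun _ => α) y * prodPow a s (fun _ => α) y) x =
      -(biRate a s α x * prodPow a s (fun _ => α) x) := by
  have p1 : ∀ i x, prodPow a s (expOne α i) x = prodPow a s (fun _ => α) x * invSq a s i x :=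
    fun i x => prodPow_add_single a (fun _ => α) hs i x
  have p2 : ∀ i j x, prodPow a s (expTwo α i j) x =
      prodPow a s (fun _ => α) x * invSq a s i x * invSq a s j x :=
    fun i j x => (prodPow_add_single a (expOne α i) hs j x).trans (by rw [p1])
  have e : (fun y => rate a s (fun _ => α) y * prodPow a s (fun _ => α) y) = fun y =>
      ∑ i, (2 * α) * prodPow a s (expOne α i) y +
        ∑ i, ∑ j, coef a s α i j * prodPow a s (expTwo α i j) y := by
    funext y
    simp only [rate_const a s hα, p1, p2, add_mul, Finset.mul_sum, Finset.sum_mul]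
    congr 1
    · exact Finset.sum_congr rfl fun i _ => by ring
    · exact Finset.sum_congr rfl fun i _ => Finset.sum_congr rfl fun j _ => by ring
  have c1 : ∀ i, ContDiff ℝ ∞ fun y => (2 * α) * prodPow a s (expOne α i) y :=
    fun i => contDiff_const.mul (contDiff_prodPow a _ hs)
  have c2 : ∀ i j, ContDiff ℝ ∞ fun y => coef a s α i j * prodPow a s (expTwo α i j) y :=
    fun i j => contDiff_const.mul (contDiff_prodPow a _ hs)
  have c3 : ∀ i, ContDiff ℝ ∞ fun y => ∑ j, coef a s α i j * prodPow a s (expTwo α i j) y :=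
    fun i => ContDiff.sum fun j _ => c2 i j
  have hadd : Δ (fun y => ∑ i, (2 * α) * prodPow a s (expOne α i) y +
      ∑ i, ∑ j, coef a s α i j * prodPow a s (expTwo α i j) y) x =
      Δ (fun y => ∑ i, (2 * α) * prodPow a s (expOne α i) y) x +
      Δ (fun y => ∑ i, ∑ j, coef a s α i j * prodPow a s (expTwo α i j) y) x :=
    ContDiffAt.laplacian_add
      ((ContDiff.sum fun i _ => c1 i).of_le (by norm_cast)).contDiffAt
      ((ContDiff.sum fun i _ => c3 i).of_le (by norm_cast)).contDiffAt
  rw [e, hadd, laplacian_fun_sum _ fun i _ => c1 i, laplacian_fun_sum _ fun i _ => c3 i]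
  simp only [fun i => laplacian_fun_sum Finset.univ (fun j _ => c2 i j) x,
    laplacian_const_mul _ (contDiff_prodPow a _ hs), laplacian_prodPow a _ hs]
  simp only [p1, p2]
  rw [← sum_rate_eq_biRate a s hα, add_mul, neg_add, Finset.mul_sum, Finset.sum_mul,
    Finset.sum_mul, ← Finset.sum_neg_distrib, ← Finset.sum_neg_distrib]
  congr 1
  · exact Finset.sum_congr rfl fun i _ => by ring
  · refine Finset.sum_congr rfl fun i _ => ?_
    rw [Finset.sum_mul, ← Finset.sum_neg_distrib]
    exact Finset.sum_congr rfl fun j _ => by ring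

lemma contDiff_rate (hs : 0 < s) (γ : Fin n → ℝ) : ContDiff ℝ ∞ (rate a s γ) := by
  have h := fun i => contDiff_invSq a hs i
  refine (contDiff_const.mul (ContDiff.sum fun i _ => contDiff_const.mul (h i))).add
    ((ContDiff.sum fun i _ => ContDiff.sum fun j _ => ?_).add
      (contDiff_const.mul (ContDiff.sum fun i _ => contDiff_const.mul ((h i).pow 2))))
  exact (contDiff_const.mul (h i)).mul (h j)

/-- The Rellich identity attached to the regularized ground state. -/
theorem integral_laplacian_sq (hs : 0 < s) (hα : n * α = (N : ℝ) - 4)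
    {u : EuclideanSpace ℝ (Fin N) → ℝ} (hu : IsTestFunction u) :
    ∫ x, (Δ u x) ^ 2 = ∫ x, (biRate a s α x * u x ^ 2 +
      (Δ u x + rate a s (fun _ => α) x * u x) ^ 2 +
      2 * rate a s (fun _ => α) x *
        ∑ k, (pd k u x + logGrad a s (fun _ => α) k x * u x) ^ 2) := by
  obtain ⟨hu, hc⟩ := hu
  set φ := prodPow a s (fun _ => α) with hφ
  have hφp : ∀ x, 0 < φ x := prodPow_pos a _ hs
  have hφc : ContDiff ℝ ∞ φ := contDiff_prodPow a _ hs
  set w := fun y => rate a s (fun _ => α) y * φ y with hw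
  have hwc : ContDiff ℝ ∞ w := (contDiff_rate a hs _).mul hφc
  set v := fun y => u y * (φ y)⁻¹ with hv
  have hvc : ContDiff ℝ ∞ v := hu.mul (hφc.inv fun x => (hφp x).ne')
  have huv : u = fun y => φ y * v y := by
    funext y; simp only [hv]; field_simp [(hφp y).ne']
  have hg : ContDiff ℝ ∞ fun y => u y * v y := hu.mul hvc
  have hgs : HasCompactSupport fun y => u y * v y := hc.mul_right
  -- Here w = -Δφ and uv = u²/φ, so Δw · uv = -(Δ²φ/φ) u² is the potential term.
  have green := integral_mul_laplacian hwc hg hgs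
  have hL : ∀ x, Δ u x = φ x * Δ v x + 2 * ∑ k, pd k φ x * pd k v x - v x * w x := by
    intro x
    conv_lhs => rw [huv]
    rw [laplacian_fun_mul hφc hvc, laplacian_prodPow a _ hs]
    ring
  have hp : ∀ k x, pd k u x = pd k φ x * v x + φ x * pd k v x := by
    intro k x
    conv_lhs => rw [huv]
    exact pd_mul k hφc hvc x
  have hgl : ∀ x, Δ (fun y => u y * v y) x =
      u x * Δ v x + 2 * ∑ k, pd k u x * pd k v x + v x * Δ u x := laplacian_fun_mul hu hvc
  -- Completing the square: after u = φv is inserted, the second derivatives of v assemble into the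
  -- square of Δu - uΔφ/φ, and only ρφ²|∇v|² remains.
  have hpt : ∀ x, (Δ u x) ^ 2 + w x * Δ (fun y => u y * v y) x =
      (Δ u x + rate a s (fun _ => α) x * u x) ^ 2 + 2 * rate a s (fun _ => α) x *
        ∑ k, (pd k u x + logGrad a s (fun _ => α) k x * u x) ^ 2 := by
    intro x
    have h1 : ∀ k, pd k u x + logGrad a s (fun _ => α) k x * u x = φ x * pd k v x := by
      intro k
      rw [hp, congrFun huv x, hφ, pd_prodPow a _ hs]
      ring
    have h2 : ∑ k, pd k u x * pd k v x =
        v x * ∑ k, pd k φ x * pd k v x + φ x * ∑ k, pd k v x ^ 2 := by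
      rw [Finset.mul_sum, Finset.mul_sum, ← Finset.sum_add_distrib]
      exact Finset.sum_congr rfl fun k _ => by rw [hp]; ring
    simp only [h1, mul_pow, ← Finset.mul_sum]
    have h3 : rate a s (fun _ => α) x * u x = v x * w x := by
      rw [congrFun huv x]; simp only [hw]; ring
    rw [h3, hgl, h2, hL, congrFun huv x]
    simp only [hw]
    ring
  have hgreen : ∫ x, w x * Δ (fun y => u y * v y) x = -∫ x, biRate a s α x * u x ^ 2 := by
    rw [green, ← integral_neg]
    refine integral_congr_ae (Eventually.of_forall fun x => ?_)
    simp only [hw, hφ]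
    rw [laplacian_rate_mul_prodPow a hs hα, ← hφ]
    simp only [hv]
    field_simp [(hφp x).ne']
  have hΔ := contDiff_laplacian hu
  have i1 : Integrable fun x => (Δ u x) ^ 2 := by
    simp only [sq]
    exact (hΔ.continuous.mul hΔ.continuous).integrable_of_hasCompactSupport
      (hasCompactSupport_laplacian hc).mul_right
  have i2 : Integrable fun x => w x * Δ (fun y => u y * v y) x :=
    (hwc.continuous.mul (contDiff_laplacian hg).continuous).integrable_of_hasCompactSupport
      (hasCompactSupport_laplacian hgs).mul_left
  have i3 : Integrable fun x => biRate a s α x * u x ^ 2 := by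
    have hb : Continuous (biRate a s α) := by
      have : biRate a s α = fun x => -(Δ w x) * (φ x)⁻¹ := by
        funext x
        simp only [hw, hφ]
        rw [laplacian_rate_mul_prodPow a hs hα, ← hφ]
        field_simp [(hφp x).ne']
      rw [this]
      exact (contDiff_laplacian hwc).continuous.neg.mul
        (hφc.inv fun x => (hφp x).ne').continuous
    refine (hb.mul (hu.continuous.pow 2)).integrable_of_hasCompactSupport ?_
    simp only [sq]
    exact (hc.mul_right (f' := u)).mul_left
  calc ∫ x, (Δ u x) ^ 2 = ∫ x, (biRate a s α x * u x ^ 2 +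
        ((Δ u x) ^ 2 + w x * Δ (fun y => u y * v y) x)) := by
        rw [integral_add (g := fun x => (Δ u x) ^ 2 + w x * Δ (fun y => u y * v y) x)
          i3 (i1.add i2), integral_add i1 i2, hgreen]
        ring
    _ = _ := integral_congr_ae (Eventually.of_forall fun x => by simp only [hpt]; ring)

end GroundState

/-! ### Comparison of the regularized potentials and nonnegativity of the remainder -/

section Positivity

variable {N n : ℕ} (a : Fin n → EuclideanSpace ℝ (Fin N)) {s α : ℝ}

/-- The potential `V_n` with `|x - a_i|²` replaced by `|x - a_i|² + s`. -/
noncomputable def regPotential (s : ℝ) (x : EuclideanSpace ℝ (Fin N)) : ℝ :=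
  ∑ i, ∑ j ∈ Finset.Ioi i, ‖a i - a j‖ ^ 2 * (invSq a s i x * invSq a s j x) *
    ∑ k, ∑ l ∈ Finset.Ioi k,
      nu N k i j * nu N l i j * ‖a k - a l‖ ^ 2 * (invSq a s k x * invSq a s l x)

lemma regPotential_zero (x : EuclideanSpace ℝ (Fin N)) : regPotential a 0 x = potential a x := by
  simp only [regPotential, potential, invSq, add_zero, div_eq_mul_inv, mul_inv]

lemma nu_nonneg (hN : 5 ≤ N) (k i j : Fin n) : 0 ≤ nu N k i j := by
  have : (5 : ℝ) ≤ N := by exact_mod_cast hN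
  unfold nu
  split_ifs
  · apply div_nonneg _ (by linarith)
    have : (0 : ℝ) ≤ n := by positivity
    linarith
  · exact div_nonneg (by linarith) (by linarith)

lemma regPotential_nonneg (hN : 5 ≤ N) (hs : 0 ≤ s) (x : EuclideanSpace ℝ (Fin N)) :
    0 ≤ regPotential a s x := by
  have h := fun i => invSq_nonneg a hs i x
  refine Finset.sum_nonneg fun i _ => Finset.sum_nonneg fun j _ => mul_nonneg
    (mul_nonneg (by positivity) (mul_nonneg (h i) (h j)))
    (Finset.sum_nonneg fun k _ => Finset.sum_nonneg fun l _ => mul_nonneg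
      (mul_nonneg (mul_nonneg (nu_nonneg hN _ _ _) (nu_nonneg hN _ _ _)) (by positivity))
      (mul_nonneg (h k) (h l)))

lemma sum_Ioi_eq_half_sum {f : Fin n → Fin n → ℝ} (hf : ∀ i j, f i j = f j i)
    (h0 : ∀ i, f i i = 0) : ∑ i, ∑ j ∈ Finset.Ioi i, f i j = (∑ i, ∑ j, f i j) / 2 := by
  have h := Finset.sum_sum_Ioi_add_eq_sum_sum_off_diag f
  have h2 : ∀ i, ∑ j ∈ {i}ᶜ, f j i = ∑ j, f i j := by
    intro i
    rw [← Finset.sum_compl_add_sum {i} (f i)]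
    simp only [Finset.sum_singleton, h0, add_zero]
    exact Finset.sum_congr rfl fun j _ => hf j i
  simp only [h2] at h
  rw [← h]
  simp only [fun i j => hf j i, Finset.sum_add_distrib]
  ring

/-- This is where the weights ν come from: up to the factor N/n they are the exponents of φ/(|x -
a_i|²|x - a_j|²). For i = j the exponent would be α + 4 instead. -/
lemma expTwo_eq_nu (hN : N ≠ 0) (hn : n ≠ 0) (hα : n * α = (N : ℝ) - 4) {i j : Fin n} (hij : i ≠ j)
    (k : Fin n) : expTwo α i j k = N / n * nu N k i j := by
  have hN' : (N : ℝ) ≠ 0 := by exact_mod_cast hN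
  have hn' : (n : ℝ) ≠ 0 := by exact_mod_cast hn
  have e : α = ((N : ℝ) - 4) / n := by rw [← hα]; field_simp
  unfold expTwo expOne nu
  rw [e]
  by_cases h1 : k = i
  · have h2 : k ≠ j := fun h => hij (h1.symm.trans h)
    simp [h1, hij]
    field_simp
    ring
  · by_cases h2 : k = j
    · simp [h2, hij.symm]
      field_simp
      ring
    · simp [h1, h2]
      field_simp

/-- The part of `biRate` which does not involve the regularization explicitly. -/
lemma rellichConst_mul_regPotential (hN : N ≠ 0) (hn : n ≠ 0) (hα : n * α = (N : ℝ) - 4)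
    (x : EuclideanSpace ℝ (Fin N)) : rellichConst N n * regPotential a s x =
      ∑ i, ∑ j, α * α * (‖a i - a j‖ ^ 2 / 2) * invSq a s i x * invSq a s j x *
        ∑ k, ∑ l, expTwo α i j k * expTwo α i j l * (‖a k - a l‖ ^ 2 / 2) * invSq a s k x *
          invSq a s l x := by
  have hn' : (n : ℝ) ≠ 0 := by exact_mod_cast hn
  have e : rellichConst N n = α * α * ((N : ℝ) / n) ^ 2 := by
    have e : α = ((N : ℝ) - 4) / n := by rw [← hα]; field_simp
    rw [rellichConst, e]
    field_simp
  have nuc : ∀ k i j : Fin n, nu N k i j = nu N k j i := by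
    intro k i j; simp only [nu, or_comm]
  have h1 : ∀ i j, ∑ k, ∑ l ∈ Finset.Ioi k,
      nu N k i j * nu N l i j * ‖a k - a l‖ ^ 2 * (invSq a s k x * invSq a s l x) =
      (∑ k, ∑ l, nu N k i j * nu N l i j * ‖a k - a l‖ ^ 2 * (invSq a s k x * invSq a s l x)) / 2 := by
    intro i j
    refine sum_Ioi_eq_half_sum (fun k l => ?_) (fun k => by simp)
    rw [norm_sub_rev]; ring
  have h2 : regPotential a s x = (∑ i, ∑ j, ‖a i - a j‖ ^ 2 * (invSq a s i x * invSq a s j x) *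
      ((∑ k, ∑ l, nu N k i j * nu N l i j * ‖a k - a l‖ ^ 2 *
        (invSq a s k x * invSq a s l x)) / 2)) / 2 := by
    rw [regPotential]
    simp only [h1]
    refine sum_Ioi_eq_half_sum (fun i j => ?_) (fun i => by simp)
    rw [norm_sub_rev]
    simp only [nuc _ j i]
    ring
  rw [h2, e, Finset.sum_div, Finset.mul_sum]
  refine Finset.sum_congr rfl fun i _ => ?_
  rw [Finset.sum_div, Finset.mul_sum]
  refine Finset.sum_congr rfl fun j _ => ?_
  -- The diagonal terms carry the factor |a_i - a_i|² = 0, so their different exponents do not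
  -- matter.
  by_cases hij : i = j
  · simp [hij]
  have h3 : ∑ k, ∑ l, expTwo α i j k * expTwo α i j l * (‖a k - a l‖ ^ 2 / 2) * invSq a s k x *
      invSq a s l x = ((N : ℝ) / n) ^ 2 / 2 * ∑ k, ∑ l, nu N k i j * nu N l i j * ‖a k - a l‖ ^ 2 *
        (invSq a s k x * invSq a s l x) := by
    rw [Finset.mul_sum]
    refine Finset.sum_congr rfl fun k _ => ?_
    rw [Finset.mul_sum]
    refine Finset.sum_congr rfl fun l _ => ?_
    rw [expTwo_eq_nu hN hn hα hij, expTwo_eq_nu hN hn hα hij]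
    ring
  rw [h3]
  ring

lemma expTwo_nonneg (hα : 0 ≤ α) (i j k : Fin n) : 0 ≤ expTwo α i j k := by
  unfold expTwo expOne
  split_ifs <;> positivity

lemma pairWeight_ge (hs : 0 ≤ s) (i j : Fin n) : ‖a i - a j‖ ^ 2 / 2 ≤ pairWeight a s i j := by
  unfold pairWeight; linarith

lemma pairWeight_nonneg (hs : 0 ≤ s) (i j : Fin n) : 0 ≤ pairWeight a s i j :=
  le_trans (by positivity) (pairWeight_ge a hs i j)

lemma coef_ge (hs : 0 ≤ s) (hα : 0 ≤ α) (i j : Fin n) :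
    α * α * (‖a i - a j‖ ^ 2 / 2) ≤ coef a s α i j := by
  have h := mul_le_mul_of_nonneg_left (pairWeight_ge a hs i j) (mul_nonneg hα hα)
  unfold coef
  split_ifs
  · have : 0 ≤ 2 * s * α := by positivity
    linarith
  · linarith

lemma coef_nonneg (hs : 0 ≤ s) (hα : 0 ≤ α) (i j : Fin n) : 0 ≤ coef a s α i j :=
  le_trans (by positivity) (coef_ge a hs hα i j)

lemma quadRate_ge (hs : 0 ≤ s) {γ : Fin n → ℝ} (hγ : ∀ k, 0 ≤ γ k)
    (x : EuclideanSpace ℝ (Fin N)) :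
    ∑ k, ∑ l, γ k * γ l * (‖a k - a l‖ ^ 2 / 2) * invSq a s k x * invSq a s l x ≤
      quadRate a s γ x := by
  have h := fun i => invSq_nonneg a hs i x
  have h2 : 0 ≤ 2 * s * ∑ i, γ i * invSq a s i x ^ 2 :=
    mul_nonneg (by positivity) (Finset.sum_nonneg fun i _ => mul_nonneg (hγ i) (sq_nonneg _))
  refine le_trans ?_ (le_add_of_nonneg_right h2)
  refine Finset.sum_le_sum fun i _ => Finset.sum_le_sum fun j _ => ?_
  have := mul_nonneg (hγ i) (hγ j)
  have := pairWeight_ge a hs i j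
  have := h i
  have := h j
  gcongr

/-- The difference consists of the terms in which s appears explicitly, in `pairWeight`, `coef` and
`quadRate`; all are nonnegative since α and s are. -/
lemma rellichConst_mul_regPotential_le (hN : N ≠ 0) (hn : n ≠ 0) (hα : n * α = (N : ℝ) - 4)
    (hα0 : 0 ≤ α) (hs : 0 ≤ s) (x : EuclideanSpace ℝ (Fin N)) :
    rellichConst N n * regPotential a s x ≤ biRate a s α x := by
  rw [rellichConst_mul_regPotential a hN hn hα]
  have h := fun i => invSq_nonneg a hs i x
  refine Finset.sum_le_sum fun i _ => Finset.sum_le_sum fun j _ => ?_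
  have h1 := coef_ge a hs hα0 i j
  have h2 := quadRate_ge a hs (expTwo_nonneg hα0 i j) x
  have h3 : 0 ≤ ∑ k, ∑ l, expTwo α i j k * expTwo α i j l * (‖a k - a l‖ ^ 2 / 2) *
      invSq a s k x * invSq a s l x := Finset.sum_nonneg fun k _ => Finset.sum_nonneg fun l _ => by
    have := h k
    have := h l
    have := mul_nonneg (expTwo_nonneg hα0 i j k) (expTwo_nonneg hα0 i j l)
    positivity
  have := h i
  have := h j
  have := coef_nonneg a hs hα0 i j
  gcongr

lemma biRate_zero (hN : N ≠ 0) (hn : n ≠ 0) (hα : n * α = (N : ℝ) - 4)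
    (x : EuclideanSpace ℝ (Fin N)) : biRate a 0 α x = rellichConst N n * potential a x := by
  rw [← regPotential_zero, rellichConst_mul_regPotential a hN hn hα]
  simp [biRate, coef, quadRate, pairWeight]

/-- Makes the weight of the gradient term strictly positive, which later forces extremals to be
multiples of the ground state. -/
lemma rate_ge (hα : n * α = (N : ℝ) - 4) (hα0 : 0 ≤ α) (hs : 0 ≤ s)
    (x : EuclideanSpace ℝ (Fin N)) : 2 * α * ∑ i, invSq a s i x ≤ rate a s (fun _ => α) x := by
  rw [rate_const a s hα]
  have h := fun i => invSq_nonneg a hs i x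
  refine le_add_of_nonneg_right (Finset.sum_nonneg fun i _ => Finset.sum_nonneg fun j _ => ?_)
  exact mul_nonneg (mul_nonneg (coef_nonneg a hs hα0 i j) (h i)) (h j)

lemma rate_nonneg (hα : n * α = (N : ℝ) - 4) (hα0 : 0 ≤ α) (hs : 0 ≤ s)
    (x : EuclideanSpace ℝ (Fin N)) : 0 ≤ rate a s (fun _ => α) x :=
  le_trans (mul_nonneg (by positivity) (Finset.sum_nonneg fun i _ => invSq_nonneg a hs i x))
    (rate_ge a hα hα0 hs x)

lemma continuous_regPotential (hs : 0 < s) : Continuous (regPotential a s) := by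
  have h := fun i => (contDiff_invSq a hs i).continuous
  unfold regPotential
  fun_prop

lemma continuous_biRate (hs : 0 < s) : Continuous (biRate a s α) := by
  have h := fun i => (contDiff_invSq a hs i).continuous
  unfold biRate quadRate
  fun_prop

/-- The remainder density of the Rellich inequality for the regularized ground state. -/
noncomputable def remainder (s α : ℝ) (u : EuclideanSpace ℝ (Fin N) → ℝ)
    (x : EuclideanSpace ℝ (Fin N)) : ℝ :=
  (Δ u x + rate a s (fun _ => α) x * u x) ^ 2 + 2 * rate a s (fun _ => α) x *
    ∑ k, (pd k u x + logGrad a s (fun _ => α) k x * u x) ^ 2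

lemma remainder_nonneg (hα : n * α = (N : ℝ) - 4) (hα0 : 0 ≤ α) (hs : 0 ≤ s)
    (u : EuclideanSpace ℝ (Fin N) → ℝ) (x : EuclideanSpace ℝ (Fin N)) :
    0 ≤ remainder a s α u x := by
  have := rate_nonneg a hα hα0 hs x
  unfold remainder
  positivity

lemma continuous_remainder (hs : 0 < s) {u : EuclideanSpace ℝ (Fin N) → ℝ}
    (hu : IsTestFunction u) : Continuous (remainder a s α u) := by
  have h1 := (contDiff_laplacian hu.1).continuous
  have h2 := fun k => (contDiff_pd k hu.1).continuous
  have h3 := (contDiff_rate a hs (fun _ => α)).continuous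
  have h4 := fun k => (contDiff_logGrad a (fun _ => α) hs k).continuous
  have h5 := hu.1.continuous
  unfold remainder
  fun_prop

lemma hasCompactSupport_remainder {u : EuclideanSpace ℝ (Fin N) → ℝ}
    (hu : IsTestFunction u) : HasCompactSupport (remainder a s α u) := by
  refine hu.2.mono' fun x hx => ?_
  by_contra hx'
  apply hx
  have h : u =ᶠ[𝓝 x] fun _ => 0 := notMem_tsupport_iff_eventuallyEq.mp hx'
  have e1 : Δ u x = 0 := (InnerProductSpace.laplacian_congr_nhds h).self_of_nhds.trans
    (congrFun (InnerProductSpace.laplacian_const (c := (0 : ℝ))) x)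
  have e2 : ∀ k, pd k u x = 0 := fun k => by simp [pd, h.fderiv_eq]
  simp [remainder, e1, e2, h.self_of_nhds]

lemma IsTestFunction.integrable_mul_sq {u V : EuclideanSpace ℝ (Fin N) → ℝ}
    (hu : IsTestFunction u) (hV : Continuous V) : Integrable fun x => V x * u x ^ 2 := by
  refine (hV.mul (hu.1.continuous.pow 2)).integrable_of_hasCompactSupport ?_
  simp only [sq]
  exact (hu.2.mul_right (f' := u)).mul_left

lemma integrable_remainder (hs : 0 < s) {u : EuclideanSpace ℝ (Fin N) → ℝ}
    (hu : IsTestFunction u) : Integrable (remainder a s α u) :=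
  (continuous_remainder a hs hu).integrable_of_hasCompactSupport (hasCompactSupport_remainder a hu)

lemma integral_laplacian_sq_eq (hs : 0 < s) (hα : n * α = (N : ℝ) - 4)
    {u : EuclideanSpace ℝ (Fin N) → ℝ} (hu : IsTestFunction u) :
    ∫ x, (Δ u x) ^ 2 = (∫ x, biRate a s α x * u x ^ 2) + ∫ x, remainder a s α u x := by
  rw [← integral_add (hu.integrable_mul_sq (continuous_biRate a hs)) (integrable_remainder a hs hu),
    integral_laplacian_sq a hs hα hu]
  simp only [remainder, add_assoc]

lemma integral_regPotential_add_remainder_le (hs : 0 < s) (hN : N ≠ 0) (hn : n ≠ 0)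
    (hα : n * α = (N : ℝ) - 4) (hα0 : 0 ≤ α)
    {u : EuclideanSpace ℝ (Fin N) → ℝ} (hu : IsTestFunction u) :
    (rellichConst N n * ∫ x, regPotential a s x * u x ^ 2) + ∫ x, remainder a s α u x ≤
      ∫ x, (Δ u x) ^ 2 := by
  rw [integral_laplacian_sq_eq a hs hα hu, ← integral_const_mul]
  refine add_le_add_left (integral_mono
    ((hu.integrable_mul_sq (continuous_regPotential a hs)).const_mul _)
    (hu.integrable_mul_sq (continuous_biRate a hs)) fun x => ?_) _
  have := rellichConst_mul_regPotential_le a hN hn hα hα0 hs.le x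
  calc _ = (rellichConst N n * regPotential a s x) * u x ^ 2 := by ring
    _ ≤ _ := by gcongr

end Positivity

/-! ### Removing the regularization: the inequality on the energy space -/

section Limits

variable {N n : ℕ} (a : Fin n → EuclideanSpace ℝ (Fin N)) {s α : ℝ}

lemma integral_sq_eq_norm_sq {f : EuclideanSpace ℝ (Fin N) → ℝ} (hf : MemLp f 2 volume) :
    ∫ x, f x ^ 2 = ‖hf.toLp f‖ ^ 2 := by
  rw [← real_inner_self_eq_norm_sq, L2.inner_def]
  refine integral_congr_ae ?_
  filter_upwards [hf.coeFn_toLp] with x hx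
  simp [hx, sq]

lemma tendsto_integral_sq {f : ℕ → EuclideanSpace ℝ (Fin N) → ℝ}
    {g : EuclideanSpace ℝ (Fin N) → ℝ} (hf : ∀ k, MemLp (f k) 2 volume) (hg : MemLp g 2 volume)
    (h : Tendsto (fun k => eLpNorm (fun x => f k x - g x) 2 volume) atTop (𝓝 0)) :
    Tendsto (fun k => ∫ x, f k x ^ 2) atTop (𝓝 (∫ x, g x ^ 2)) := by
  simp only [integral_sq_eq_norm_sq hg, fun k => integral_sq_eq_norm_sq (hf k)]
  exact ((Lp.tendsto_Lp_iff_tendsto_eLpNorm'' f hf g hg).2 h).norm.pow 2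

lemma IsTestFunction.memLp_laplacian {u : EuclideanSpace ℝ (Fin N) → ℝ} (hu : IsTestFunction u) :
    MemLp (Δ u) 2 volume :=
  (contDiff_laplacian hu.1).continuous.memLp_of_hasCompactSupport (hasCompactSupport_laplacian hu.2)

lemma IsTestFunction.memD22 {u : EuclideanSpace ℝ (Fin N) → ℝ} (hu : IsTestFunction u) :
    MemD22 u (Δ u) :=
  ⟨hu.memLp_laplacian, fun _ => u, fun _ => hu, by simp, by simp⟩

lemma ae_ne_poles (hN : N ≠ 0) : ∀ᵐ x : EuclideanSpace ℝ (Fin N), ∀ i, x ≠ a i := by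
  have : Nonempty (Fin N) := ⟨⟨0, Nat.pos_of_ne_zero hN⟩⟩
  rw [eventually_all]
  exact fun i => Measure.ae_ne volume (a i)

lemma continuousAt_invSq {x : EuclideanSpace ℝ (Fin N)} {i : Fin n} (hx : x ≠ a i) :
    ContinuousAt (fun s => invSq a s i x) 0 := by
  unfold invSq
  refine ContinuousAt.inv₀ (by fun_prop) ?_
  have := norm_pos_iff.2 (sub_ne_zero.2 hx)
  positivity

lemma continuousAt_regPotential {x : EuclideanSpace ℝ (Fin N)} (hx : ∀ i, x ≠ a i) :
    ContinuousAt (fun s => regPotential a s x) 0 := by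
  have h := fun i => continuousAt_invSq a (hx i)
  unfold regPotential
  fun_prop

lemma continuousAt_rate {x : EuclideanSpace ℝ (Fin N)} (hx : ∀ i, x ≠ a i) (γ : Fin n → ℝ) :
    ContinuousAt (fun s => rate a s γ x) 0 := by
  have h := fun i => continuousAt_invSq a (hx i)
  unfold rate quadRate pairWeight
  fun_prop

lemma continuousAt_biRate {x : EuclideanSpace ℝ (Fin N)} (hx : ∀ i, x ≠ a i) :
    ContinuousAt (fun s => biRate a s α x) 0 := by
  have h := fun i => continuousAt_invSq a (hx i)
  unfold biRate coef quadRate pairWeight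
  have h2 : ∀ i j : Fin n, ContinuousAt (fun s : ℝ => if i = j then 2 * s * α else 0) 0 := by
    intro i j
    split_ifs <;> fun_prop
  fun_prop

lemma continuousAt_logGrad {x : EuclideanSpace ℝ (Fin N)} (hx : ∀ i, x ≠ a i) (γ : Fin n → ℝ)
    (k : Fin N) : ContinuousAt (fun s => logGrad a s γ k x) 0 := by
  have h := fun i => continuousAt_invSq a (hx i)
  unfold logGrad
  fun_prop

lemma potential_nonneg (hN : 5 ≤ N) (x : EuclideanSpace ℝ (Fin N)) : 0 ≤ potential a x :=
  regPotential_zero a x ▸ regPotential_nonneg a hN le_rfl x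

lemma rellichConst_pos (hN : 5 ≤ N) (hn : n ≠ 0) : 0 < rellichConst N n := by
  have h1 : (5 : ℝ) ≤ N := by exact_mod_cast hN
  have h2 : (0 : ℝ) < N - 4 := by linarith
  have h3 : (0 : ℝ) < N := by linarith
  have h4 : (0 : ℝ) < n := by exact_mod_cast Nat.pos_of_ne_zero hn
  unfold rellichConst
  positivity

lemma measurable_potential : Measurable (potential a) := by
  unfold potential
  fun_prop

/-- A positive null sequence of regularization parameters. -/
noncomputable def scale (k : ℕ) : ℝ := 1 / ((k : ℝ) + 1)

lemma scale_pos (k : ℕ) : 0 < scale k := by unfold scale; positivity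

lemma tendsto_scale : Tendsto scale atTop (𝓝 0) := tendsto_one_div_add_atTop_nhds_zero_nat

/-- Fatou's lemma for the regularized potentials. -/
lemma lintegral_potential_le_liminf (hN : 5 ≤ N) {u : EuclideanSpace ℝ (Fin N) → ℝ}
    {w : ℕ → EuclideanSpace ℝ (Fin N) → ℝ} (hw : ∀ k, IsTestFunction (w k))
    (hwu : ∀ᵐ x, Tendsto (fun k => w k x) atTop (𝓝 (u x))) :
    ∫⁻ x, ENNReal.ofReal (rellichConst N n * (potential a x * u x ^ 2)) ≤
      liminf (fun k => ENNReal.ofReal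
        (rellichConst N n * ∫ x, regPotential a (scale k) x * w k x ^ 2)) atTop := by
  have hint : ∀ k, Integrable fun x =>
      rellichConst N n * (regPotential a (scale k) x * w k x ^ 2) := fun k =>
    ((hw k).integrable_mul_sq (continuous_regPotential a (scale_pos k))).const_mul _
  have hc : 0 ≤ rellichConst N n := by unfold rellichConst; positivity
  have h1 : ∀ k, ENNReal.ofReal (rellichConst N n * ∫ x, regPotential a (scale k) x * w k x ^ 2) =
      ∫⁻ x, ENNReal.ofReal (rellichConst N n * (regPotential a (scale k) x * w k x ^ 2)) := by
    intro k
    rw [← integral_const_mul]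
    exact ofReal_integral_eq_lintegral_ofReal (hint k) (Eventually.of_forall fun x =>
      mul_nonneg hc (mul_nonneg (regPotential_nonneg a hN (scale_pos k).le x) (sq_nonneg _)))
  simp only [h1]
  refine le_trans (le_of_eq (lintegral_congr_ae ?_)) (lintegral_liminf_le' fun k =>
    (hint k).aestronglyMeasurable.aemeasurable.ennreal_ofReal)
  filter_upwards [hwu, ae_ne_poles a (by omega : N ≠ 0)] with x hx hp
  have h2 : Tendsto (fun k => regPotential a (scale k) x) atTop (𝓝 (potential a x)) := by
    rw [← regPotential_zero]
    exact (continuousAt_regPotential a hp).tendsto.comp tendsto_scale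
  exact ((ENNReal.continuous_ofReal.tendsto _).comp
    ((h2.mul (hx.pow 2)).const_mul _)).liminf_eq.symm

lemma aestronglyMeasurable_of_tendsto_test {u : EuclideanSpace ℝ (Fin N) → ℝ}
    {w : ℕ → EuclideanSpace ℝ (Fin N) → ℝ} (hw : ∀ k, IsTestFunction (w k))
    (hwu : ∀ᵐ x, Tendsto (fun k => w k x) atTop (𝓝 (u x))) : AEStronglyMeasurable u volume :=
  aestronglyMeasurable_of_tendsto_ae atTop (fun k => (hw k).1.continuous.aestronglyMeasurable) hwu

variable {u g : EuclideanSpace ℝ (Fin N) → ℝ} {w : ℕ → EuclideanSpace ℝ (Fin N) → ℝ}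

/-- The regularization and the approximation of u pass to the limit along one index: the nonnegative
remainder is dropped, Fatou handles the potential term, and the L² convergence of the Laplacians
handles the other side. -/
lemma lintegral_potential_le (hN : 5 ≤ N) (hn : n ≠ 0) (hg : MemLp g 2 volume)
    (hw : ∀ k, IsTestFunction (w k))
    (hwg : Tendsto (fun k => eLpNorm (fun x => Δ (w k) x - g x) 2 volume) atTop (𝓝 0))
    (hwu : ∀ᵐ x, Tendsto (fun k => w k x) atTop (𝓝 (u x))) :
    ∫⁻ x, ENNReal.ofReal (rellichConst N n * (potential a x * u x ^ 2)) ≤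
      ENNReal.ofReal (∫ x, g x ^ 2) := by
  have hN5 : (5 : ℝ) ≤ N := by exact_mod_cast hN
  have hα : n * (((N : ℝ) - 4) / n) = (N : ℝ) - 4 := by field_simp
  have hα0 : 0 ≤ ((N : ℝ) - 4) / n := div_nonneg (by linarith) (by positivity)
  refine (lintegral_potential_le_liminf a hN hw hwu).trans ?_
  have hlim := (ENNReal.continuous_ofReal.tendsto _).comp
    (tendsto_integral_sq (fun k => (hw k).memLp_laplacian) hg hwg)
  rw [← hlim.liminf_eq]
  refine liminf_le_liminf (Eventually.of_forall fun k => ENNReal.ofReal_le_ofReal ?_)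
  have h := integral_regPotential_add_remainder_le a (scale_pos k) (by omega) hn hα hα0 (hw k)
  have h2 : 0 ≤ ∫ x, remainder a (scale k) (((N : ℝ) - 4) / n) (w k) x := integral_nonneg
    fun x => remainder_nonneg a hα hα0 (scale_pos k).le (w k) x
  linarith

lemma MemD22.integrable (hN : 5 ≤ N) (hn : n ≠ 0) (h : MemD22 u g) :
    Integrable fun x => potential a x * u x ^ 2 := by
  obtain ⟨hg, w, hw, hwg, hwu⟩ := h
  have h := lintegral_potential_le a hN hn hg hw hwg hwu
  have hc := rellichConst_pos hN hn
  have hi : Integrable fun x => rellichConst N n * (potential a x * u x ^ 2) := by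
    refine ⟨(((measurable_potential a).aestronglyMeasurable).mul
      ((aestronglyMeasurable_of_tendsto_test hw hwu).pow 2)).const_mul _, ?_⟩
    rw [hasFiniteIntegral_iff_ofReal (Eventually.of_forall fun x =>
      mul_nonneg hc.le (mul_nonneg (potential_nonneg a hN x) (sq_nonneg _)))]
    exact h.trans_lt ENNReal.ofReal_lt_top
  exact (integrable_const_mul_iff (IsUnit.mk0 _ hc.ne') _).1 hi

lemma MemD22.rellich (hN : 5 ≤ N) (hn : n ≠ 0) (h : MemD22 u g) :
    rellichConst N n * ∫ x, potential a x * u x ^ 2 ≤ ∫ x, g x ^ 2 := by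
  have hi := h.integrable a hN hn
  obtain ⟨hg, w, hw, hwg, hwu⟩ := h
  have h := lintegral_potential_le a hN hn hg hw hwg hwu
  have hc := rellichConst_pos hN hn
  rw [← ofReal_integral_eq_lintegral_ofReal (hi.const_mul _) (Eventually.of_forall fun x =>
      mul_nonneg hc.le (mul_nonneg (potential_nonneg a hN x) (sq_nonneg _))),
    ENNReal.ofReal_le_ofReal_iff (integral_nonneg fun x => sq_nonneg _), integral_const_mul] at h
  exact h

theorem isNonnegative_potential (hN : 5 ≤ N) (hn : n ≠ 0) :
    IsNonnegative (rellichConst N n) (potential a) := fun _ hu =>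
  ⟨hu.memD22.integrable a hN hn, sub_nonneg.2 (hu.memD22.rellich a hN hn)⟩

/-- If `u` attains equality in the Rellich inequality, the remainders of the approximations of `u`
tend to zero. -/
lemma tendsto_remainder (hN : 5 ≤ N) (hn : n ≠ 0) (hα : n * α = (N : ℝ) - 4) (hα0 : 0 ≤ α)
    (hg : MemLp g 2 volume) (hw : ∀ k, IsTestFunction (w k))
    (hwg : Tendsto (fun k => eLpNorm (fun x => Δ (w k) x - g x) 2 volume) atTop (𝓝 0))
    (hwu : ∀ᵐ x, Tendsto (fun k => w k x) atTop (𝓝 (u x)))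
    (heq : ∫ x, g x ^ 2 ≤ rellichConst N n * ∫ x, potential a x * u x ^ 2) :
    Tendsto (fun k => ∫ x, remainder a (scale k) α (w k) x) atTop (𝓝 0) := by
  have hi := MemD22.integrable a hN hn ⟨hg, w, hw, hwg, hwu⟩
  have hc := rellichConst_pos hN hn
  have hD := tendsto_integral_sq (fun k => (hw k).memLp_laplacian) hg hwg
  have hF := lintegral_potential_le_liminf a hN hw hwu
  rw [← ofReal_integral_eq_lintegral_ofReal (hi.const_mul _) (Eventually.of_forall fun x =>
      mul_nonneg hc.le (mul_nonneg (potential_nonneg a hN x) (sq_nonneg _))),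
    integral_const_mul] at hF
  have hR : ∀ k, 0 ≤ ∫ x, remainder a (scale k) α (w k) x := fun k => integral_nonneg
    fun x => remainder_nonneg a hα hα0 (scale_pos k).le (w k) x
  have hX : ∀ k, 0 ≤ rellichConst N n * ∫ x, regPotential a (scale k) x * w k x ^ 2 := fun k =>
    mul_nonneg hc.le (integral_nonneg fun x =>
      mul_nonneg (regPotential_nonneg a hN (scale_pos k).le x) (sq_nonneg _))
  have hle := fun k =>
    integral_regPotential_add_remainder_le a (scale_pos k) (by omega) hn hα hα0 (hw k)
  refine tendsto_order.2 ⟨fun b hb => Eventually.of_forall fun k => hb.trans_le (hR k),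
    fun ε hε => ?_⟩
  -- Fatou bounds the lower limit of the potential energies below by the energy of u, so they cannot
  -- eventually leave room for a remainder of size ε.
  have hev : ∀ᶠ k in atTop, (∫ x, g x ^ 2) - ε / 2 <
      rellichConst N n * ∫ x, regPotential a (scale k) x * w k x ^ 2 := by
    -- A negative level is handled separately because `ENNReal.ofReal` collapses it to zero.
    rcases lt_or_ge ((∫ x, g x ^ 2) - ε / 2) 0 with hd | hd
    · exact Eventually.of_forall fun k => hd.trans_le (hX k)
    have h1 : ENNReal.ofReal ((∫ x, g x ^ 2) - ε / 2) <
        ENNReal.ofReal (rellichConst N n * ∫ x, potential a x * u x ^ 2) :=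
      (ENNReal.ofReal_lt_ofReal_iff (by linarith)).2 (by linarith)
    filter_upwards [eventually_lt_of_lt_liminf (h1.trans_le hF)] with k hk
    exact (ENNReal.ofReal_lt_ofReal_iff_of_nonneg hd).1 hk
  filter_upwards [hev, hD.eventually_lt_const (show ∫ x, g x ^ 2 < (∫ x, g x ^ 2) + ε / 2 by linarith)]
    with k h1 h2
  linarith [hle k]

end Limits

/-! ### Integrability of singular products, uniformly in the exponent -/

section Integrability

variable {N n : ℕ} (a : Fin n → EuclideanSpace ℝ (Fin N)) {s α β : ℝ}

/-- Polar coordinates. The exact value is kept because its growth like 1/(N - p) as p tends to N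
decides the size of the almost minimizers. -/
lemma integrable_indicator_rpow (hN : N ≠ 0) {p : ℝ} (hp : p < N) :
    Integrable (fun x : EuclideanSpace ℝ (Fin N) =>
      (Set.Iio (1 : ℝ)).indicator (fun t => t ^ (-p)) ‖x‖) ∧
    ∫ x : EuclideanSpace ℝ (Fin N), (Set.Iio (1 : ℝ)).indicator (fun t => t ^ (-p)) ‖x‖ =
      N * volume.real (Metric.ball (0 : EuclideanSpace ℝ (Fin N)) 1) / (N - p) := by
  have : Nonempty (Fin N) := ⟨⟨0, Nat.pos_of_ne_zero hN⟩⟩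
  have hN1 : ((N - 1 : ℕ) : ℝ) = N - 1 := by
    rw [Nat.cast_sub (Nat.pos_of_ne_zero hN)]; simp
  have hexp : -1 < (N : ℝ) - 1 - p := by linarith
  have hind : ∀ y ∈ Set.Ioi (0 : ℝ), y ^ (N - 1) • (Set.Iio (1 : ℝ)).indicator (fun t => t ^ (-p)) y =
      (Set.Ioo (0 : ℝ) 1).indicator (fun t => t ^ ((N : ℝ) - 1 - p)) y := by
    intro y hy
    have hy : 0 < y := hy
    by_cases h1 : y < 1
    · rw [Set.indicator_of_mem (show y ∈ Set.Iio (1 : ℝ) from h1),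
        Set.indicator_of_mem (show y ∈ Set.Ioo (0 : ℝ) 1 from ⟨hy, h1⟩), smul_eq_mul,
        ← Real.rpow_natCast, ← Real.rpow_add hy, hN1]
      congr 1
    · rw [Set.indicator_of_notMem (show y ∉ Set.Iio (1 : ℝ) from h1),
        Set.indicator_of_notMem (show y ∉ Set.Ioo (0 : ℝ) 1 from fun h => h1 h.2), smul_zero]
  have hii : IntervalIntegrable (fun t : ℝ => t ^ ((N : ℝ) - 1 - p)) volume 0 1 :=
    intervalIntegral.intervalIntegrable_rpow' hexp
  have hIoo : IntegrableOn (fun t : ℝ => t ^ ((N : ℝ) - 1 - p)) (Set.Ioo 0 1) :=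
    ((intervalIntegrable_iff_integrableOn_Ioc_of_le zero_le_one).1 hii).mono_set
      Set.Ioo_subset_Ioc_self
  constructor
  · rw [integrable_fun_norm_addHaar volume, finrank_euclideanSpace_fin,
      integrableOn_congr_fun hind measurableSet_Ioi]
    exact ((integrable_indicator_iff measurableSet_Ioo).2 hIoo).integrableOn
  · rw [integral_fun_norm_addHaar volume, finrank_euclideanSpace_fin,
      setIntegral_congr_fun measurableSet_Ioi hind,
      setIntegral_indicator measurableSet_Ioo,
      Set.inter_eq_right.2 Set.Ioo_subset_Ioi_self, ← integral_Ioc_eq_integral_Ioo,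
      ← intervalIntegral.integral_of_le zero_le_one, integral_rpow (Or.inl hexp)]
    have : (N : ℝ) - 1 - p + 1 = N - p := by ring
    rw [this, Real.one_rpow, Real.zero_rpow (by linarith)]
    simp
    ring

/-- The sum of the inverse square distances to the poles. -/
noncomputable def invSqSum (x : EuclideanSpace ℝ (Fin N)) : ℝ := ∑ i, invSq a 0 i x

lemma invSqSum_nonneg (x : EuclideanSpace ℝ (Fin N)) : 0 ≤ invSqSum a x :=
  Finset.sum_nonneg fun i _ => invSq_nonneg a le_rfl i x

/-- The singular power product `∏ |x - a_i| ^ (-β)`. -/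
noncomputable def singPow (β : ℝ) (x : EuclideanSpace ℝ (Fin N)) : ℝ := prodPow a 0 (fun _ => β) x

lemma singPow_nonneg (β : ℝ) (x : EuclideanSpace ℝ (Fin N)) : 0 ≤ singPow a β x := by
  unfold singPow prodPow
  exact Finset.prod_nonneg fun i _ => by positivity

lemma singPow_eq (β : ℝ) (x : EuclideanSpace ℝ (Fin N)) :
    singPow a β x = ∏ i, ‖x - a i‖ ^ (-β) := by
  unfold singPow prodPow
  refine Finset.prod_congr rfl fun i _ => ?_
  rw [add_zero, ← Real.rpow_natCast, ← Real.rpow_mul (norm_nonneg _)]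
  congr 1
  push_cast
  ring

lemma exists_separation (ha : Function.Injective a) :
    ∃ η : ℝ, 0 < η ∧ η ≤ 1 ∧ ∀ i j, i ≠ j → 2 * η ≤ ‖a i - a j‖ := by
  classical
  let t : Finset (Fin n × Fin n) := Finset.univ.filter fun p => p.1 ≠ p.2
  obtain ⟨m, hm, hmt⟩ : ∃ m : ℝ, 0 < m ∧ ∀ p ∈ t, m ≤ ‖a p.1 - a p.2‖ := by
    rcases t.eq_empty_or_nonempty with h | h
    · exact ⟨1, one_pos, by simp [h]⟩
    · obtain ⟨p, hp, hpm⟩ := t.exists_min_image (fun p => ‖a p.1 - a p.2‖) h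
      refine ⟨_, norm_pos_iff.2 (sub_ne_zero.2 fun h => ?_), hpm⟩
      exact (Finset.mem_filter.1 hp).2 (ha h)
  refine ⟨min 1 (m / 2), by positivity, min_le_left _ _, fun i j hij => ?_⟩
  have h1 := hmt (i, j) (Finset.mem_filter.2 ⟨Finset.mem_univ _, hij⟩)
  have h2 := min_le_right 1 (m / 2)
  simp only at h1
  linarith

/-- Pointwise bound for the function dominating all the integrands. -/
lemma exists_dominating_bound (ha : Function.Injective a) (hN : 5 ≤ N) : ∃ C : ℝ, 0 ≤ C ∧ ∀ β, 0 ≤ β → β ≤ α →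
      3 * ((N : ℝ) - 4) ≤ 4 * (n * β) → ∀ x, (∀ i, x ≠ a i) →
      (singPow a β x) ^ 2 * invSqSum a x ^ 2 ≤
        C * ((∑ i, (Set.Iio (1 : ℝ)).indicator (fun t => t ^ (-(2 * β + 4))) ‖x - a i‖) +
          (1 + ‖x‖) ^ (-((N : ℝ) + 1 / 2))) := by
  obtain ⟨η, hη, hη1, hsep⟩ := exists_separation a ha
  have hN5 : (5 : ℝ) ≤ N := by exact_mod_cast hN
  set M := ∑ i, ‖a i‖ with hM
  have hM0 : 0 ≤ M := Finset.sum_nonneg fun i _ => norm_nonneg _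
  -- Chosen so that |x - a_i| ≥ η implies 1 + |x| ≤ (1 + M) + |x - a_i| ≤ K |x - a_i|.
  set K := (1 + M) / η + 1 with hK
  have hK1 : 1 ≤ K := by rw [hK]; have : 0 ≤ (1 + M) / η := by positivity
                         linarith
  refine ⟨max ((η ^ (-(2 * (n * α)))) * n ^ 2) (K ^ (2 * (n * α) + 4) * n ^ 2), by positivity, ?_⟩
  intro β hβ hβα hβl x hx
  have hd : ∀ i, 0 < ‖x - a i‖ := fun i => norm_pos_iff.2 (sub_ne_zero.2 (hx i))
  have hnβ : n * β ≤ n * α := mul_le_mul_of_nonneg_left hβα (by positivity)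
  have hnβ0 : 0 ≤ n * β := by positivity
  have hsq : (singPow a β x) ^ 2 = ∏ i, ‖x - a i‖ ^ (-(2 * β)) := by
    rw [singPow_eq, ← Finset.prod_pow]
    refine Finset.prod_congr rfl fun i _ => ?_
    rw [← Real.rpow_natCast, ← Real.rpow_mul (norm_nonneg _)]
    congr 1
    push_cast
    ring
  have hinv : ∀ i, invSq a 0 i x = ‖x - a i‖ ^ (-2 : ℝ) := by
    intro i
    rw [invSq, add_zero, Real.rpow_neg (norm_nonneg _)]
    norm_cast
  have hI : ∀ i, 0 ≤ (Set.Iio (1 : ℝ)).indicator (fun t => t ^ (-(2 * β + 4))) ‖x - a i‖ :=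
    fun i => Set.indicator_apply_nonneg fun _ => by positivity
  have hJ : 0 ≤ (1 + ‖x‖) ^ (-((N : ℝ) + 1 / 2)) := by positivity
  -- Within η of one pole, the separation 2η keeps all others at distance at least η, so a single
  -- factor is singular. Elsewhere every distance is comparable to 1 + |x|.
  by_cases hcase : ∃ i, ‖x - a i‖ < η
  · obtain ⟨i, hi⟩ := hcase
    have hj : ∀ j, j ≠ i → η ≤ ‖x - a j‖ := by
      intro j hji
      have h1 := hsep i j hji.symm
      have h2 := norm_sub_le (x - a j) (x - a i)
      rw [show x - a j - (x - a i) = a i - a j by abel] at h2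
      linarith
    have hr : ∀ j, ‖x - a j‖ ^ (-2 : ℝ) ≤ ‖x - a i‖ ^ (-2 : ℝ) := by
      intro j
      by_cases hji : j = i
      · rw [hji]
      · exact Real.rpow_le_rpow_of_nonpos (hd i) (hi.le.trans (hj j hji)) (by norm_num)
    have hS : invSqSum a x ≤ n * ‖x - a i‖ ^ (-2 : ℝ) := by
      unfold invSqSum
      simp only [hinv]
      refine (Finset.sum_le_sum fun j _ => hr j).trans (le_of_eq ?_)
      simp
    have hP : (singPow a β x) ^ 2 ≤ ‖x - a i‖ ^ (-(2 * β)) * η ^ (-(2 * (n * α))) := by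
      rw [hsq, ← Finset.mul_prod_erase _ _ (Finset.mem_univ i)]
      refine mul_le_mul_of_nonneg_left ?_ (by positivity)
      calc ∏ j ∈ Finset.univ.erase i, ‖x - a j‖ ^ (-(2 * β))
          ≤ ∏ j ∈ Finset.univ.erase i, η ^ (-(2 * β)) := Finset.prod_le_prod
            (fun j _ => by positivity) fun j hji => Real.rpow_le_rpow_of_nonpos hη
              (hj j (Finset.ne_of_mem_erase hji)) (by linarith)
        _ ≤ ∏ j : Fin n, η ^ (-(2 * β)) := by
            rw [Finset.prod_const, Finset.prod_const]
            exact pow_le_pow_right₀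
              (Real.one_le_rpow_of_pos_of_le_one_of_nonpos hη hη1 (by linarith))
              (Finset.card_le_card (Finset.erase_subset _ _))
        _ = η ^ (-(2 * (n * β))) := by
            rw [Finset.prod_const, Finset.card_univ, Fintype.card_fin, ← Real.rpow_natCast,
              ← Real.rpow_mul hη.le]
            congr 1
            ring
        _ ≤ _ := Real.rpow_le_rpow_of_exponent_ge hη hη1 (by linarith)
    calc (singPow a β x) ^ 2 * invSqSum a x ^ 2
        ≤ (‖x - a i‖ ^ (-(2 * β)) * η ^ (-(2 * (n * α)))) * (n * ‖x - a i‖ ^ (-2 : ℝ)) ^ 2 := by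
          have := invSqSum_nonneg a x
          gcongr
      _ = (η ^ (-(2 * (n * α)))) * n ^ 2 * ‖x - a i‖ ^ (-(2 * β + 4)) := by
          rw [show -(2 * β + 4) = -(2 * β) + -2 + -2 by ring, Real.rpow_add (hd i),
            Real.rpow_add (hd i)]
          ring
      _ ≤ max ((η ^ (-(2 * (n * α)))) * n ^ 2) (K ^ (2 * (n * α) + 4) * n ^ 2) *
          ‖x - a i‖ ^ (-(2 * β + 4)) := by
          gcongr
          exact le_max_left _ _
      _ ≤ _ := by
          have h1 : ‖x - a i‖ ^ (-(2 * β + 4)) =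
              (Set.Iio (1 : ℝ)).indicator (fun t => t ^ (-(2 * β + 4))) ‖x - a i‖ := by
            rw [Set.indicator_of_mem]
            exact lt_of_lt_of_le hi hη1
          have h2 := Finset.single_le_sum (fun j _ => hI j) (Finset.mem_univ i)
          rw [h1]
          gcongr
          linarith
  · push Not at hcase
    have hx1 : 0 < 1 + ‖x‖ := by positivity
    have hK0 : 0 < K := by linarith
    have hlow : ∀ i, (1 + ‖x‖) / K ≤ ‖x - a i‖ := by
      intro i
      rw [div_le_iff₀ hK0]
      have h1 : ‖a i‖ ≤ M := Finset.single_le_sum (f := fun i => ‖a i‖)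
        (fun j _ => norm_nonneg _) (Finset.mem_univ i)
      have h2 := norm_sub_norm_le x (a i)
      have h3 : 1 + M ≤ ‖x - a i‖ * ((1 + M) / η) := by
        rw [mul_div_assoc', le_div_iff₀ hη]
        nlinarith [hcase i]
      rw [hK]
      linarith
    have hq : 0 < (1 + ‖x‖) / K := by positivity
    have hS : invSqSum a x ≤ n * ((1 + ‖x‖) / K) ^ (-2 : ℝ) := by
      unfold invSqSum
      simp only [hinv]
      refine (Finset.sum_le_sum fun j _ =>
        Real.rpow_le_rpow_of_nonpos hq (hlow j) (by norm_num)).trans (le_of_eq ?_)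
      simp
    have hP : (singPow a β x) ^ 2 ≤ ((1 + ‖x‖) / K) ^ (-(2 * (n * β))) := by
      rw [hsq]
      refine (Finset.prod_le_prod (fun j _ => by positivity) fun j _ =>
        Real.rpow_le_rpow_of_nonpos hq (hlow j) (by linarith)).trans (le_of_eq ?_)
      rw [Finset.prod_const, Finset.card_univ, Fintype.card_fin, ← Real.rpow_natCast,
              ← Real.rpow_mul hq.le]
      congr 1
      ring
    calc (singPow a β x) ^ 2 * invSqSum a x ^ 2
        ≤ ((1 + ‖x‖) / K) ^ (-(2 * (n * β))) * (n * ((1 + ‖x‖) / K) ^ (-2 : ℝ)) ^ 2 := by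
          have := invSqSum_nonneg a x
          gcongr
      _ = n ^ 2 * ((1 + ‖x‖) / K) ^ (-(2 * (n * β) + 4)) := by
          rw [show -(2 * (n * β) + 4) = -(2 * (n * β)) + -2 + -2 by ring, Real.rpow_add hq,
            Real.rpow_add hq]
          ring
      _ = n ^ 2 * (K ^ (2 * (n * β) + 4) * (1 + ‖x‖) ^ (-(2 * (n * β) + 4))) := by
          rw [Real.div_rpow hx1.le hK0.le, Real.rpow_neg hK0.le, div_inv_eq_mul, mul_comm (K ^ _)]
      _ ≤ n ^ 2 * (K ^ (2 * (n * α) + 4) * (1 + ‖x‖) ^ (-((N : ℝ) + 1 / 2))) := by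
          have h1 : K ^ (2 * (n * β) + 4) ≤ K ^ (2 * (n * α) + 4) :=
            Real.rpow_le_rpow_of_exponent_le hK1 (by linarith)
          -- From 3(N - 4) ≤ 4nβ one gets 2nβ + 4 ≥ 3N/2 - 2, and this is at least N + 1/2 because N
          -- ≥ 5.
          have h2 : (1 + ‖x‖) ^ (-(2 * (n * β) + 4)) ≤ (1 + ‖x‖) ^ (-((N : ℝ) + 1 / 2)) :=
            Real.rpow_le_rpow_of_exponent_le (by linarith [norm_nonneg x]) (by linarith)
          exact mul_le_mul_of_nonneg_left
            (mul_le_mul h1 h2 (by positivity) (by positivity)) (by positivity)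
      _ = (K ^ (2 * (n * α) + 4) * n ^ 2) * (1 + ‖x‖) ^ (-((N : ℝ) + 1 / 2)) := by ring
      _ ≤ max ((η ^ (-(2 * (n * α)))) * n ^ 2) (K ^ (2 * (n * α) + 4) * n ^ 2) *
          (1 + ‖x‖) ^ (-((N : ℝ) + 1 / 2)) := by
          gcongr
          exact le_max_right _ _
      _ ≤ _ := by
          gcongr
          exact le_add_of_nonneg_left (Finset.sum_nonneg fun i _ => hI i)

lemma measurable_invSqSum : Measurable (invSqSum a) := by
  unfold invSqSum invSq
  fun_prop

lemma measurable_singPow (β : ℝ) : Measurable (singPow a β) := by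
  unfold singPow prodPow
  fun_prop

/-- Integrability of the dominating function, with a bound uniform in the exponent. -/
lemma exists_integral_bound (ha : Function.Injective a) (hN : 5 ≤ N) : ∃ C : ℝ, 0 ≤ C ∧ ∀ β, 0 ≤ β → β ≤ α →
      3 * ((N : ℝ) - 4) ≤ 4 * (n * β) → 2 * β < (N : ℝ) - 4 →
      Integrable (fun x => (singPow a β x) ^ 2 * invSqSum a x ^ 2) ∧
      ∫ x, (singPow a β x) ^ 2 * invSqSum a x ^ 2 ≤ C * (1 / ((N : ℝ) - 4 - 2 * β) + 1) := by
  obtain ⟨C, hC, hb⟩ := exists_dominating_bound (α := α) a ha hN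
  have hN0 : N ≠ 0 := by omega
  set c1 := N * volume.real (Metric.ball (0 : EuclideanSpace ℝ (Fin N)) 1) with hc1
  set c2 := ∫ x : EuclideanSpace ℝ (Fin N), (1 + ‖x‖) ^ (-((N : ℝ) + 1 / 2)) with hc2
  have hc10 : 0 ≤ c1 := by positivity
  have hc20 : 0 ≤ c2 := integral_nonneg fun x => by positivity
  have i2 : Integrable fun x : EuclideanSpace ℝ (Fin N) => (1 + ‖x‖) ^ (-((N : ℝ) + 1 / 2)) :=
    integrable_one_add_norm (by rw [finrank_euclideanSpace_fin]; linarith)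
  refine ⟨C * (n * c1 + c2), by positivity, fun β hβ hβα hβl hβu => ?_⟩
  obtain ⟨h1, h2⟩ := integrable_indicator_rpow hN0 (show 2 * β + 4 < N by linarith)
  have i1 : ∀ i, Integrable fun x =>
      (Set.Iio (1 : ℝ)).indicator (fun t => t ^ (-(2 * β + 4))) ‖x - a i‖ :=
    fun i => h1.comp_sub_right (a i)
  have e1 : ∀ i, ∫ x, (Set.Iio (1 : ℝ)).indicator (fun t => t ^ (-(2 * β + 4))) ‖x - a i‖ =
      c1 / (N - 4 - 2 * β) := by
    intro i
    rw [integral_sub_right_eq_self (fun x : EuclideanSpace ℝ (Fin N) =>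
      (Set.Iio (1 : ℝ)).indicator (fun t => t ^ (-(2 * β + 4))) ‖x‖), h2, ← hc1]
    congr 1
    ring
  have i3 := ((integrable_finsetSum Finset.univ fun i _ => i1 i).add i2).const_mul C
  have hle : ∀ᵐ x, (singPow a β x) ^ 2 * invSqSum a x ^ 2 ≤
      C * ((∑ i, (Set.Iio (1 : ℝ)).indicator (fun t => t ^ (-(2 * β + 4))) ‖x - a i‖) +
          (1 + ‖x‖) ^ (-((N : ℝ) + 1 / 2))) := by
    filter_upwards [ae_ne_poles a hN0] with x hx
    exact hb β hβ hβα hβl x hx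
  have i4 : Integrable (fun x => (singPow a β x) ^ 2 * invSqSum a x ^ 2) := by
    refine i3.mono' (((measurable_singPow a β).pow_const 2).mul
      ((measurable_invSqSum a).pow_const 2)).aestronglyMeasurable ?_
    filter_upwards [hle] with x hx
    rw [Real.norm_of_nonneg (by positivity)]
    exact hx
  refine ⟨i4, (integral_mono_ae i4 i3 hle).trans ?_⟩
  rw [integral_const_mul]
  simp only [Pi.add_apply]
  rw [integral_add (integrable_finsetSum Finset.univ fun i _ => i1 i) i2,
    integral_finsetSum _ fun i _ => i1 i]
  simp only [e1, ← hc2, Finset.sum_const, Finset.card_univ, Fintype.card_fin, nsmul_eq_mul]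
  rw [mul_assoc C]
  refine mul_le_mul_of_nonneg_left ?_ hC
  have hpos : 0 < (N : ℝ) - 4 - 2 * β := by linarith
  have : 0 ≤ n * c1 := by positivity
  have : 0 ≤ c2 * (1 / ((N : ℝ) - 4 - 2 * β)) := by positivity
  calc n * (c1 / ((N : ℝ) - 4 - 2 * β)) + c2 = n * c1 * (1 / ((N : ℝ) - 4 - 2 * β)) + c2 := by ring
    _ ≤ _ := by linarith

end Integrability

/-! ### Cut-off approximations and bounds uniform in the regularization -/

section Approximation

variable {N n : ℕ} (a : Fin n → EuclideanSpace ℝ (Fin N)) {s α β : ℝ}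

/-- A smooth cutoff function, equal to one near the origin. -/
noncomputable def cutoff (x : EuclideanSpace ℝ (Fin N)) : ℝ :=
  (⟨1, 2, one_pos, one_lt_two⟩ : ContDiffBump (0 : EuclideanSpace ℝ (Fin N))) x

lemma contDiff_cutoff : ContDiff ℝ ∞ (cutoff (N := N)) := ContDiffBump.contDiff _

lemma hasCompactSupport_cutoff : HasCompactSupport (cutoff (N := N)) :=
  ContDiffBump.hasCompactSupport _

lemma cutoff_zero : cutoff (0 : EuclideanSpace ℝ (Fin N)) = 1 :=
  ContDiffBump.one_of_mem_closedBall _ (by simp)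

lemma abs_cutoff_le (x : EuclideanSpace ℝ (Fin N)) : |cutoff x| ≤ 1 := by
  rw [cutoff, abs_of_nonneg (ContDiffBump.nonneg _)]
  exact ContDiffBump.le_one _

/-- Smooth compactly supported approximations of the singular power product. -/
noncomputable def approx (β s : ℝ) (x : EuclideanSpace ℝ (Fin N)) : ℝ :=
  cutoff (s • x) * prodPow a s (fun _ => β) x

lemma isTestFunction_approx (hs : 0 < s) : IsTestFunction (approx a β s) := by
  refine ⟨(contDiff_cutoff.comp (contDiff_const_smul s)).mul (contDiff_prodPow a _ hs), ?_⟩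
  exact (hasCompactSupport_cutoff.comp_homeomorph (Homeomorph.smulOfNeZero s hs.ne')).mul_right

lemma pd_approx (hs : 0 < s) (k : Fin N) (x : EuclideanSpace ℝ (Fin N)) :
    pd k (approx a β s) x = prodPow a s (fun _ => β) x *
      (s * pd k cutoff (s • x) - cutoff (s • x) * logGrad a s (fun _ => β) k x) := by
  have h := pd_mul k (contDiff_cutoff.comp (contDiff_const_smul s))
    (contDiff_prodPow a (fun _ => β) hs) x
  simp only [Function.comp_def] at h
  unfold approx
  rw [h, pd_comp_const_smul, pd_prodPow a _ hs]
  ring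

lemma laplacian_approx (hs : 0 < s) (x : EuclideanSpace ℝ (Fin N)) :
    Δ (approx a β s) x = prodPow a s (fun _ => β) x *
      (s ^ 2 * Δ cutoff (s • x) -
        2 * ∑ k, s * pd k cutoff (s • x) * logGrad a s (fun _ => β) k x -
        cutoff (s • x) * rate a s (fun _ => β) x) := by
  have h := laplacian_fun_mul (contDiff_cutoff.comp (contDiff_const_smul s))
    (contDiff_prodPow a (fun _ => β) hs) x
  simp only [Function.comp_def] at h
  unfold approx
  rw [h, laplacian_comp_const_smul s contDiff_cutoff, laplacian_prodPow a _ hs]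
  simp only [pd_comp_const_smul, pd_prodPow a _ hs]
  have : ∑ k, s * pd k cutoff (s • x) * -(logGrad a s (fun _ => β) k x *
      prodPow a s (fun _ => β) x) = -(prodPow a s (fun _ => β) x *
        ∑ k, s * pd k cutoff (s • x) * logGrad a s (fun _ => β) k x) := by
    rw [Finset.mul_sum, ← Finset.sum_neg_distrib]
    exact Finset.sum_congr rfl fun k _ => by ring
  rw [this]
  ring

variable {x : EuclideanSpace ℝ (Fin N)}

lemma rho_pos_of_ne (hs : 0 ≤ s) (hx : ∀ i, x ≠ a i) (i : Fin n) : 0 < ‖x - a i‖ ^ 2 + s := by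
  have := norm_pos_iff.2 (sub_ne_zero.2 (hx i))
  positivity

lemma invSq_le_invSq_zero (hs : 0 ≤ s) (hx : ∀ i, x ≠ a i) (i : Fin n) :
    invSq a s i x ≤ invSq a 0 i x := by
  have := rho_pos_of_ne a le_rfl hx i
  exact inv_anti₀ this (by linarith)

lemma sum_invSq_le (hs : 0 ≤ s) (hx : ∀ i, x ≠ a i) : ∑ i, invSq a s i x ≤ invSqSum a x :=
  Finset.sum_le_sum fun i _ => invSq_le_invSq_zero a hs hx i

lemma prodPow_le_singPow (hs : 0 ≤ s) (hβ : 0 ≤ β) (hx : ∀ i, x ≠ a i) :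
    prodPow a s (fun _ => β) x ≤ singPow a β x := by
  refine Finset.prod_le_prod (fun i _ => by positivity) fun i _ => ?_
  exact Real.rpow_le_rpow_of_nonpos (rho_pos_of_ne a le_rfl hx i) (by linarith) (by linarith)

/-- By the triangle inequality, |a_i - a_j|²/2 is at most the sum of the two squared distances from
x, so the weight cancels one of the two inverse factors. Thus `quadRate`, formally quadratic in the
inverse squared distances, is controlled linearly by `invSqSum`. -/
lemma pairWeight_mul_le (hs : 0 ≤ s) (hx : ∀ i, x ≠ a i) (i j : Fin n) :
    pairWeight a s i j * invSq a s i x * invSq a s j x ≤ invSq a s i x + invSq a s j x := by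
  have h := fun i => invSq_nonneg a hs i x
  have hi : invSq a s i x * (‖x - a i‖ ^ 2 + s) = 1 :=
    inv_mul_cancel₀ (rho_pos_of_ne a hs hx i).ne'
  have hj : invSq a s j x * (‖x - a j‖ ^ 2 + s) = 1 :=
    inv_mul_cancel₀ (rho_pos_of_ne a hs hx j).ne'
  have hp : pairWeight a s i j ≤ (‖x - a i‖ ^ 2 + s) + (‖x - a j‖ ^ 2 + s) := by
    have h1 : ‖a i - a j‖ ≤ ‖x - a j‖ + ‖x - a i‖ := by
      have := norm_sub_le (x - a j) (x - a i)
      rwa [show x - a j - (x - a i) = a i - a j by abel] at this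
    unfold pairWeight
    nlinarith [norm_nonneg (a i - a j), sq_nonneg (‖x - a j‖ - ‖x - a i‖)]
  calc _ ≤ ((‖x - a i‖ ^ 2 + s) + (‖x - a j‖ ^ 2 + s)) * invSq a s i x * invSq a s j x := by
        have := h i
        have := h j
        gcongr
    _ = _ := by linear_combination (invSq a s j x) * hi + (invSq a s i x) * hj

lemma sum_pairWeight_le (hs : 0 ≤ s) (hx : ∀ i, x ≠ a i) :
    ∑ i, ∑ j, pairWeight a s i j * invSq a s i x * invSq a s j x ≤ 2 * n * invSqSum a x := by
  calc _ ≤ ∑ i, ∑ j, (invSq a s i x + invSq a s j x) :=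
        Finset.sum_le_sum fun i _ => Finset.sum_le_sum fun j _ => pairWeight_mul_le a hs hx i j
    _ = 2 * n * ∑ i, invSq a s i x := by
        simp [Finset.sum_add_distrib, ← Finset.mul_sum]
        ring
    _ ≤ _ := by
        gcongr
        exact sum_invSq_le a hs hx

lemma quadRate_nonneg (hs : 0 ≤ s) {γ : Fin n → ℝ} (hγ : ∀ k, 0 ≤ γ k) :
    0 ≤ quadRate a s γ x :=
  le_trans (Finset.sum_nonneg fun k _ => Finset.sum_nonneg fun l _ => by
    have := invSq_nonneg a hs k x
    have := invSq_nonneg a hs l x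
    have := hγ k
    have := hγ l
    positivity) (quadRate_ge a hs hγ x)

lemma quadRate_le (hs : 0 ≤ s) (hx : ∀ i, x ≠ a i) {γ : Fin n → ℝ} {G : ℝ} (hγ : ∀ k, 0 ≤ γ k)
    (hG : ∀ k, γ k ≤ G) (hG0 : 0 ≤ G) :
    quadRate a s γ x ≤ (2 * n * G ^ 2 + 2 * G) * invSqSum a x := by
  have h := fun i => invSq_nonneg a hs i x
  have h1 : ∑ i, ∑ j, γ i * γ j * pairWeight a s i j * invSq a s i x * invSq a s j x ≤
      G ^ 2 * (2 * n * invSqSum a x) := by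
    refine le_trans ?_ (mul_le_mul_of_nonneg_left (sum_pairWeight_le a hs hx) (sq_nonneg G))
    rw [Finset.mul_sum]
    refine Finset.sum_le_sum fun i _ => ?_
    rw [Finset.mul_sum]
    refine Finset.sum_le_sum fun j _ => ?_
    have h2 : γ i * γ j ≤ G ^ 2 := by
      rw [sq]; exact mul_le_mul (hG i) (hG j) (hγ j) hG0
    have h3 : 0 ≤ pairWeight a s i j * invSq a s i x * invSq a s j x :=
      mul_nonneg (mul_nonneg (pairWeight_nonneg a hs i j) (h i)) (h j)
    calc _ = γ i * γ j * (pairWeight a s i j * invSq a s i x * invSq a s j x) := by ring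
      _ ≤ _ := by gcongr
  have h2 : 2 * s * ∑ i, γ i * invSq a s i x ^ 2 ≤ 2 * G * invSqSum a x := by
    refine le_trans ?_ (mul_le_mul_of_nonneg_left (sum_invSq_le a hs hx) (by positivity))
    rw [Finset.mul_sum, Finset.mul_sum]
    refine Finset.sum_le_sum fun i _ => ?_
    have hsr : s * invSq a s i x ≤ 1 := by
      have hi : invSq a s i x * (‖x - a i‖ ^ 2 + s) = 1 :=
        inv_mul_cancel₀ (rho_pos_of_ne a hs hx i).ne'
      have := h i
      nlinarith [mul_nonneg (h i) (sq_nonneg ‖x - a i‖)]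
    calc 2 * s * (γ i * invSq a s i x ^ 2) = 2 * γ i * invSq a s i x * (s * invSq a s i x) := by
          ring
      _ ≤ 2 * G * invSq a s i x * 1 := by
          have := h i
          have := hγ i
          have := hG i
          gcongr
      _ = _ := by ring
  unfold quadRate
  linarith

lemma rate_const_eq (β : ℝ) : rate a s (fun _ => β) x =
    ((N : ℝ) - 2 - n * β) * β * ∑ i, invSq a s i x + quadRate a s (fun _ => β) x := by
  simp [rate, ← Finset.mul_sum]
  ring

lemma abs_rate_le (hs : 0 ≤ s) (hβ : 0 ≤ β) (hx : ∀ i, x ≠ a i) : |rate a s (fun _ => β) x| ≤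
    (|(N : ℝ) - 2 - n * β| * β + (2 * n * β ^ 2 + 2 * β)) * invSqSum a x := by
  have h1 : 0 ≤ ∑ i, invSq a s i x := Finset.sum_nonneg fun i _ => invSq_nonneg a hs i x
  have h2 := sum_invSq_le a hs hx
  have h3 := quadRate_le a hs hx (γ := fun _ => β) (fun _ => hβ) (fun _ => le_rfl) hβ
  have h4 := quadRate_nonneg a hs (γ := fun _ => β) (x := x) (fun _ => hβ)
  rw [rate_const_eq, add_mul]
  refine (abs_add_le _ _).trans (add_le_add ?_ ?_)
  · rw [abs_mul, abs_mul, abs_of_nonneg hβ, abs_of_nonneg h1]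
    gcongr
  · rwa [abs_of_nonneg h4]

lemma sum_logGrad_sq_le (hs : 0 ≤ s) (hx : ∀ i, x ≠ a i) :
    ∑ k, logGrad a s (fun _ => β) k x ^ 2 ≤ n * β ^ 2 * invSqSum a x := by
  rw [sum_logGrad_sq a _ fun i => (rho_pos_of_ne a hs hx i).ne']
  have h1 : 0 ≤ ∑ i, ∑ j, β * β * pairWeight a s i j * invSq a s i x * invSq a s j x :=
    Finset.sum_nonneg fun i _ => Finset.sum_nonneg fun j _ => mul_nonneg (mul_nonneg
      (mul_nonneg (mul_self_nonneg β) (pairWeight_nonneg a hs i j)) (invSq_nonneg a hs i x))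
        (invSq_nonneg a hs j x)
  have h2 := mul_le_mul_of_nonneg_left (sum_invSq_le a hs hx)
    (show 0 ≤ n * β ^ 2 by positivity)
  rw [← Finset.mul_sum]
  simp only [Finset.sum_const, Finset.card_univ, Fintype.card_fin, nsmul_eq_mul]
  linarith

lemma abs_logGrad_le (hs : 0 ≤ s) (hβ : 0 ≤ β) (hx : ∀ i, x ≠ a i) (k : Fin N) :
    |logGrad a s (fun _ => β) k x| ≤ n * β * √(invSqSum a x) := by
  have h1 : logGrad a s (fun _ => β) k x ^ 2 ≤ n * β ^ 2 * invSqSum a x :=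
    (Finset.single_le_sum (f := fun k => logGrad a s (fun _ => β) k x ^ 2)
      (fun j _ => sq_nonneg _) (Finset.mem_univ k)).trans (sum_logGrad_sq_le a hs hx)
  refine abs_le_of_sq_le_sq (h1.trans ?_) (by positivity)
  rw [mul_pow, Real.sq_sqrt (invSqSum_nonneg a x), mul_pow]
  have h2 : (n : ℝ) ≤ (n : ℝ) ^ 2 := by exact_mod_cast Nat.le_self_pow two_ne_zero n
  have := invSqSum_nonneg a x
  gcongr

lemma abs_biRate_le (hs : 0 ≤ s) (hα0 : 0 ≤ α) (hx : ∀ i, x ≠ a i) : |biRate a s α x| ≤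
    ((2 * n * α ^ 2 + 2 * α) * (2 * n * (α + 4) ^ 2 + 2 * (α + 4))) * invSqSum a x ^ 2 := by
  have h := fun i => invSq_nonneg a hs i x
  have hc : ∀ i j, 0 ≤ coef a s α i j * invSq a s i x * invSq a s j x := fun i j =>
    mul_nonneg (mul_nonneg (coef_nonneg a hs hα0 i j) (h i)) (h j)
  have hS := invSqSum_nonneg a x
  have h1 : ∀ i j, quadRate a s (expTwo α i j) x ≤
      (2 * n * (α + 4) ^ 2 + 2 * (α + 4)) * invSqSum a x := fun i j => by
    refine quadRate_le a hs hx (expTwo_nonneg hα0 i j) (fun k => ?_) (by linarith)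
    unfold expTwo expOne
    split_ifs <;> linarith
  have h0 : 0 ≤ biRate a s α x := Finset.sum_nonneg fun i _ => Finset.sum_nonneg fun j _ =>
    mul_nonneg (hc i j) (quadRate_nonneg a hs (expTwo_nonneg hα0 i j))
  rw [abs_of_nonneg h0]
  calc biRate a s α x ≤ ∑ i, ∑ j, coef a s α i j * invSq a s i x * invSq a s j x *
        ((2 * n * (α + 4) ^ 2 + 2 * (α + 4)) * invSqSum a x) :=
        Finset.sum_le_sum fun i _ => Finset.sum_le_sum fun j _ =>
          mul_le_mul_of_nonneg_left (h1 i j) (hc i j)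
    _ = quadRate a s (fun _ => α) x * ((2 * n * (α + 4) ^ 2 + 2 * (α + 4)) * invSqSum a x) := by
        rw [quadRate_const, Finset.sum_mul]
        simp only [Finset.sum_mul]
    _ ≤ ((2 * n * α ^ 2 + 2 * α) * invSqSum a x) *
          ((2 * n * (α + 4) ^ 2 + 2 * (α + 4)) * invSqSum a x) := by
        have := quadRate_le a hs hx (γ := fun _ => α) (fun _ => hα0) (fun _ => le_rfl) hα0
        gcongr
    _ = _ := by ring

/-- The weight (1 + |y|)² absorbs the growth that appears when powers of s are traded for powers of
√`invSqSum`. -/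
lemma exists_weighted_bound {f : EuclideanSpace ℝ (Fin N) → ℝ} (hf : Continuous f)
    (hc : HasCompactSupport f) : ∃ C, 0 ≤ C ∧ ∀ y, (1 + ‖y‖) ^ 2 * |f y| ≤ C := by
  have h1 : Continuous fun y => (1 + ‖y‖) ^ 2 * f y := by fun_prop
  obtain ⟨C, hC⟩ := (hc.mul_left (f := fun y => (1 + ‖y‖) ^ 2)).exists_bound_of_continuous h1
  refine ⟨C, (norm_nonneg _).trans (hC 0), fun y => ?_⟩
  have := hC y
  rwa [Pi.mul_apply, norm_mul, Real.norm_of_nonneg (by positivity), Real.norm_eq_abs] at this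

/-- A single pole suffices: 1/|x - a_i| decays no faster than a multiple of 1/(1 + |x|). -/
lemma exists_sqrt_invSqSum_bound (hn : n ≠ 0) : ∃ M, 0 ≤ M ∧ ∀ x : EuclideanSpace ℝ (Fin N),
    (∀ i, x ≠ a i) → 1 ≤ M * (√(invSqSum a x) * (1 + ‖x‖)) := by
  let i₀ : Fin n := ⟨0, Nat.pos_of_ne_zero hn⟩
  refine ⟨1 + ‖a i₀‖, by positivity, fun x hx => ?_⟩
  have h0 : 0 < ‖x - a i₀‖ := norm_pos_iff.2 (sub_ne_zero.2 (hx i₀))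
  have h1 : invSq a 0 i₀ x ≤ invSqSum a x :=
    Finset.single_le_sum (f := fun i => invSq a 0 i x) (fun i _ => invSq_nonneg a le_rfl i x)
      (Finset.mem_univ i₀)
  have h2 : ‖x - a i₀‖⁻¹ ≤ √(invSqSum a x) := by
    refine Real.le_sqrt_of_sq_le (le_trans (le_of_eq ?_) h1)
    rw [invSq, add_zero, inv_pow]
  have h3 : ‖x - a i₀‖ ≤ (1 + ‖a i₀‖) * (1 + ‖x‖) := by
    have := norm_sub_le x (a i₀)
    nlinarith [norm_nonneg x, norm_nonneg (a i₀), mul_nonneg (norm_nonneg x) (norm_nonneg (a i₀))]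
  calc (1 : ℝ) = ‖x - a i₀‖⁻¹ * ‖x - a i₀‖ := (inv_mul_cancel₀ h0.ne').symm
    _ ≤ √(invSqSum a x) * ((1 + ‖a i₀‖) * (1 + ‖x‖)) := by gcongr
    _ = _ := by ring

/-- Bounds for the approximations which are uniform in the regularization. -/
lemma exists_approx_bound (hn : n ≠ 0) (hβ : 0 ≤ β) : ∃ C, 0 ≤ C ∧ ∀ s, 0 < s → s ≤ 1 →
    ∀ x : EuclideanSpace ℝ (Fin N), (∀ i, x ≠ a i) →
      |approx a β s x| ≤ singPow a β x ∧
      (∀ k, |pd k (approx a β s) x| ≤ singPow a β x * (C * √(invSqSum a x))) ∧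
      |Δ (approx a β s) x| ≤ singPow a β x * (C * invSqSum a x) := by
  obtain ⟨M, hM, hMx⟩ := exists_sqrt_invSqSum_bound a hn
  choose D hD0 hD using fun k : Fin N => exists_weighted_bound (contDiff_pd k contDiff_cutoff).continuous
    (hasCompactSupport_pd k hasCompactSupport_cutoff)
  obtain ⟨D', hD'0, hD'⟩ := exists_weighted_bound (N := N)
    (contDiff_laplacian contDiff_cutoff).continuous
    (hasCompactSupport_laplacian hasCompactSupport_cutoff)
  set D1 := ∑ k, D k with hD1
  have hD10 : 0 ≤ D1 := Finset.sum_nonneg fun k _ => hD0 k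
  set R := |(N : ℝ) - 2 - n * β| * β + (2 * n * β ^ 2 + 2 * β) with hR
  have hR0 : 0 ≤ R := by positivity
  set C1 := D1 * M + n * β with hC1
  set C2 := D' * M ^ 2 + 2 * (N * (D1 * M * (n * β))) + R with hC2
  refine ⟨max C1 C2, by positivity, fun s hs hs1 x hx => ?_⟩
  set T := √(invSqSum a x) with hT
  have hT0 : 0 ≤ T := Real.sqrt_nonneg _
  have hT2 : T ^ 2 = invSqSum a x := Real.sq_sqrt (invSqSum_nonneg a x)
  have hP := prodPow_le_singPow a hs.le hβ hx
  have hP0 := prodPow_pos a (fun _ => β) hs x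
  have hζ := abs_cutoff_le (s • x)
  have hL := fun k => abs_logGrad_le a hs.le hβ hx k
  have hU := singPow_nonneg a β x
  have hsx : s * (1 + ‖x‖) ≤ 1 + ‖s • x‖ := by
    rw [norm_smul, Real.norm_of_nonneg hs.le]; nlinarith
  -- Each derivative of the dilated cutoff costs a factor s. It is converted into T = √`invSqSum`,
  -- of the same order as a derivative of the product, at the price of one weight.
  have hsT : s ≤ M * T * (1 + ‖s • x‖) := by
    have h1 := hMx x hx
    calc s = s * 1 := by ring
      _ ≤ s * (M * (T * (1 + ‖x‖))) := by gcongr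
      _ = M * T * (s * (1 + ‖x‖)) := by ring
      _ ≤ _ := by gcongr
  have hy : 1 ≤ 1 + ‖s • x‖ := by linarith [norm_nonneg (s • x)]
  have hpd : ∀ k, |s * pd k cutoff (s • x)| ≤ D1 * M * T := by
    intro k
    rw [abs_mul, abs_of_pos hs]
    have h1 : D k ≤ D1 := Finset.single_le_sum (f := D) (fun j _ => hD0 j) (Finset.mem_univ k)
    calc s * |pd k cutoff (s • x)| ≤ M * T * (1 + ‖s • x‖) * |pd k cutoff (s • x)| := by gcongr
      _ ≤ M * T * ((1 + ‖s • x‖) ^ 2 * |pd k cutoff (s • x)|) := by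
          rw [mul_assoc]
          gcongr
          nlinarith
      _ ≤ M * T * D1 := by
          gcongr
          exact (hD k _).trans h1
      _ = _ := by ring
  have hlap : |s ^ 2 * Δ cutoff (s • x)| ≤ D' * M ^ 2 * T ^ 2 := by
    rw [abs_mul, abs_of_pos (by positivity)]
    calc s ^ 2 * |Δ cutoff (s • x)| ≤ (M * T * (1 + ‖s • x‖)) ^ 2 * |Δ cutoff (s • x)| := by gcongr
      _ = M ^ 2 * T ^ 2 * ((1 + ‖s • x‖) ^ 2 * |Δ cutoff (s • x)|) := by ring
      _ ≤ M ^ 2 * T ^ 2 * D' := by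
          gcongr
          exact hD' _
      _ = _ := by ring
  refine ⟨?_, fun k => ?_, ?_⟩
  · rw [approx, abs_mul, abs_of_pos hP0]
    calc _ ≤ 1 * singPow a β x := by gcongr
      _ = _ := one_mul _
  · rw [pd_approx a hs, abs_mul, abs_of_pos hP0]
    have h1 : |s * pd k cutoff (s • x) - cutoff (s • x) * logGrad a s (fun _ => β) k x| ≤ C1 * T := by
      refine (abs_sub _ _).trans ?_
      rw [abs_mul (cutoff _)]
      calc _ ≤ D1 * M * T + 1 * (n * β * T) := by
            gcongr
            · exact hpd k
            · exact hL k
        _ = _ := by ring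
    calc _ ≤ singPow a β x * (C1 * T) := by gcongr
      _ ≤ _ := by gcongr; exact le_max_left _ _
  · rw [laplacian_approx a hs, abs_mul, abs_of_pos hP0]
    have h2 : |2 * ∑ k, s * pd k cutoff (s • x) * logGrad a s (fun _ => β) k x| ≤
        2 * (N * (D1 * M * (n * β))) * T ^ 2 := by
      rw [abs_mul, abs_two]
      calc _ ≤ 2 * ∑ k : Fin N, (D1 * M * T) * (n * β * T) := by
            gcongr
            refine (Finset.abs_sum_le_sum_abs _ _).trans (Finset.sum_le_sum fun k _ => ?_)
            rw [abs_mul]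
            exact mul_le_mul (hpd k) (hL k) (abs_nonneg _) (by positivity)
        _ = _ := by
            simp
            ring
    have h3 : |cutoff (s • x) * rate a s (fun _ => β) x| ≤ R * T ^ 2 := by
      rw [abs_mul, hT2]
      calc _ ≤ 1 * (R * invSqSum a x) := by
            gcongr
            exact abs_rate_le a hs.le hβ hx
        _ = _ := one_mul _
    have h1 : |s ^ 2 * Δ cutoff (s • x) -
        2 * ∑ k, s * pd k cutoff (s • x) * logGrad a s (fun _ => β) k x -
        cutoff (s • x) * rate a s (fun _ => β) x| ≤ C2 * invSqSum a x := by
      refine (abs_sub _ _).trans ((add_le_add_left (abs_sub _ _) _).trans ?_)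
      rw [← hT2]
      linarith
    have := invSqSum_nonneg a x
    calc _ ≤ singPow a β x * (C2 * invSqSum a x) := by gcongr
      _ ≤ _ := by gcongr; exact le_max_right _ _

end Approximation

/-! ### Convergence of the approximations and of their quadratic forms -/

section Convergence

variable {N n : ℕ} (a : Fin n → EuclideanSpace ℝ (Fin N)) {s α β : ℝ}

/-- Dominated convergence for |F_k - g|² ≤ (2h)², since the bound h passes to the limit g. -/
lemma tendsto_eLpNorm_sub_of_dominated {X : Type*} [MeasurableSpace X] {μ : Measure X}
    {F : ℕ → X → ℝ} {g h : X → ℝ} (hF : ∀ k, AEStronglyMeasurable (F k) μ)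
    (hh : MemLp h 2 μ) (hb : ∀ k, ∀ᵐ x ∂μ, |F k x| ≤ h x)
    (hlim : ∀ᵐ x ∂μ, Tendsto (fun k => F k x) atTop (𝓝 (g x))) :
    MemLp g 2 μ ∧ Tendsto (fun k => eLpNorm (fun x => F k x - g x) 2 μ) atTop (𝓝 0) := by
  have hg : AEStronglyMeasurable g μ := aestronglyMeasurable_of_tendsto_ae atTop hF hlim
  have hgb : ∀ᵐ x ∂μ, |g x| ≤ h x := by
    filter_upwards [ae_all_iff.2 hb, hlim] with x h1 h2
    exact le_of_tendsto h2.abs (Eventually.of_forall h1)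
  have hgL : MemLp g 2 μ := hh.mono' hg hgb
  refine ⟨hgL, ?_⟩
  have hint : Integrable (fun x => (2 * h x) ^ 2) μ := (hh.const_mul 2).integrable_sq
  have hlim2 : Tendsto (fun k => ∫ x, (F k x - g x) ^ 2 ∂μ) atTop (𝓝 (∫ x, (0 : ℝ) ∂μ)) := by
    refine tendsto_integral_of_dominated_convergence _ (fun k => ((hF k).sub hg).pow 2) hint
      (fun k => ?_) ?_
    · filter_upwards [hb k, hgb] with x h1 h2
      rw [Real.norm_of_nonneg (sq_nonneg _)]
      refine sq_le_sq' ?_ ?_ <;> linarith [abs_le.1 h1, abs_le.1 h2]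
    · filter_upwards [hlim] with x hx
      simpa using (hx.sub_const (g x)).pow 2
  rw [integral_zero] at hlim2
  have e : ∀ k, eLpNorm (fun x => F k x - g x) 2 μ =
      (ENNReal.ofReal (∫ x, (F k x - g x) ^ 2 ∂μ)) ^ (1 / 2 : ℝ) := by
    intro k
    have hFL : MemLp (F k) 2 μ := hh.mono' (hF k) (hb k)
    have hi : Integrable (fun x => (F k x - g x) ^ 2) μ := (hFL.sub hgL).integrable_sq
    rw [eLpNorm_eq_lintegral_rpow_enorm_toReal two_ne_zero ENNReal.ofNat_ne_top,
      ofReal_integral_eq_lintegral_ofReal hi (Eventually.of_forall fun x => sq_nonneg _)]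
    simp only [ENNReal.toReal_ofNat]
    congr 2
    funext x
    rw [← ofReal_norm, ENNReal.ofReal_rpow_of_nonneg (norm_nonneg _) zero_le_two]
    simp
  simp only [e]
  have h0 := (ENNReal.continuous_rpow_const (y := (1 / 2 : ℝ))).tendsto (ENNReal.ofReal 0)
  simp only [ENNReal.ofReal_zero] at h0
  rw [ENNReal.zero_rpow_of_pos (by norm_num)] at h0
  have h1 := (ENNReal.continuous_ofReal.tendsto 0).comp hlim2
  rw [ENNReal.ofReal_zero] at h1
  exact h0.comp h1

/-- The Laplacian of the singular power product away from the poles. -/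
noncomputable def singLaplacian (β : ℝ) (x : EuclideanSpace ℝ (Fin N)) : ℝ :=
  -(rate a 0 (fun _ => β) x * singPow a β x)

variable {x : EuclideanSpace ℝ (Fin N)}

lemma tendsto_prodPow (hx : ∀ i, x ≠ a i) (β : ℝ) :
    Tendsto (fun k => prodPow a (scale k) (fun _ => β) x) atTop (𝓝 (singPow a β x)) := by
  have h : ContinuousAt (fun s => prodPow a s (fun _ => β) x) 0 := by
    unfold prodPow
    refine tendsto_finsetProd _ fun i _ => ?_
    exact ContinuousAt.rpow_const (by fun_prop) (Or.inl (rho_pos_of_ne a le_rfl hx i).ne')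
  exact h.tendsto.comp tendsto_scale

lemma tendsto_comp_scale_smul {f : EuclideanSpace ℝ (Fin N) → ℝ} (hf : Continuous f)
    (x : EuclideanSpace ℝ (Fin N)) : Tendsto (fun k => f (scale k • x)) atTop (𝓝 (f 0)) := by
  have h : ContinuousAt (fun s : ℝ => f (s • x)) 0 := by fun_prop
  have h2 := h.tendsto.comp tendsto_scale
  rwa [zero_smul] at h2

lemma tendsto_approx (hx : ∀ i, x ≠ a i) (β : ℝ) :
    Tendsto (fun k => approx a β (scale k) x) atTop (𝓝 (singPow a β x)) := by
  have h := (tendsto_comp_scale_smul contDiff_cutoff.continuous x).mul (tendsto_prodPow a hx β)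
  rwa [cutoff_zero, one_mul] at h

lemma tendsto_pd_approx (hx : ∀ i, x ≠ a i) (β : ℝ) (j : Fin N) :
    Tendsto (fun k => pd j (approx a β (scale k)) x) atTop
      (𝓝 (-(logGrad a 0 (fun _ => β) j x * singPow a β x))) := by
  simp only [fun k => pd_approx a (β := β) (scale_pos k) j x]
  have h1 := tendsto_comp_scale_smul contDiff_cutoff.continuous x
  have h2 := tendsto_comp_scale_smul (contDiff_pd j contDiff_cutoff).continuous x
  have h3 := (continuousAt_logGrad a hx (fun _ => β) j).tendsto.comp tendsto_scale
  have h := (tendsto_prodPow a hx β).mul ((tendsto_scale.mul h2).sub (h1.mul h3))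
  rw [cutoff_zero] at h
  rw [show -(logGrad a 0 (fun _ => β) j x * singPow a β x) = singPow a β x *
    (0 * pd j cutoff 0 - 1 * logGrad a 0 (fun _ => β) j x) by ring]
  exact h

lemma tendsto_laplacian_approx (hx : ∀ i, x ≠ a i) (β : ℝ) :
    Tendsto (fun k => Δ (approx a β (scale k)) x) atTop (𝓝 (singLaplacian a β x)) := by
  simp only [fun k => laplacian_approx a (β := β) (scale_pos k) x]
  have h1 := tendsto_comp_scale_smul contDiff_cutoff.continuous x
  have h2 := fun j => tendsto_comp_scale_smul (contDiff_pd j contDiff_cutoff).continuous x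
  have h3 := fun j => (continuousAt_logGrad a hx (fun _ => β) j).tendsto.comp tendsto_scale
  have h4 := tendsto_comp_scale_smul (contDiff_laplacian contDiff_cutoff).continuous x
  have h5 := (continuousAt_rate a hx (fun _ => β)).tendsto.comp tendsto_scale
  have h6 := tendsto_finsetSum Finset.univ fun j (_ : j ∈ Finset.univ) =>
    (tendsto_scale.mul (h2 j)).mul (h3 j)
  have h := (tendsto_prodPow a hx β).mul
    ((((tendsto_scale.pow 2).mul h4).sub (h6.const_mul 2)).sub (h1.mul h5))
  rw [cutoff_zero] at h
  rw [show singLaplacian a β x = singPow a β x * (0 ^ 2 * Δ cutoff 0 -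
      2 * ∑ j, 0 * pd j cutoff 0 * logGrad a 0 (fun _ => β) j x - 1 * rate a 0 (fun _ => β) x) by
    simp only [singLaplacian, zero_mul, Finset.sum_const_zero]; ring]
  exact h

/-- The function dominating the integrands. -/
noncomputable def dominator (β : ℝ) (x : EuclideanSpace ℝ (Fin N)) : ℝ :=
  singPow a β x ^ 2 * invSqSum a x ^ 2

lemma scale_le_one (k : ℕ) : scale k ≤ 1 := by
  unfold scale
  rw [div_le_one (by positivity)]
  linarith [(Nat.cast_nonneg k : (0 : ℝ) ≤ k)]

/-- The uniform bound on the Laplacians has square C² times `dominator`, so integrability of the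
latter is all that dominated convergence in L² requires. -/
lemma singPow_memD22 (hN : 5 ≤ N) (hn : n ≠ 0) (hβ : 0 ≤ β) (hD : Integrable (dominator a β)) :
    MemLp (singLaplacian a β) 2 volume ∧ Tendsto (fun k =>
      eLpNorm (fun x => Δ (approx a β (scale k)) x - singLaplacian a β x) 2 volume) atTop (𝓝 0) := by
  obtain ⟨C, hC, hb⟩ := exists_approx_bound a hn hβ
  refine tendsto_eLpNorm_sub_of_dominated (h := fun x => singPow a β x * (C * invSqSum a x))
    (fun k => (contDiff_laplacian
      (isTestFunction_approx a (scale_pos k)).1).continuous.aestronglyMeasurable) ?_ (fun k => ?_) ?_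
  · have hm : Measurable fun x => singPow a β x * (C * invSqSum a x) :=
      (measurable_singPow a β).mul ((measurable_invSqSum a).const_mul C)
    rw [memLp_two_iff_integrable_sq hm.aestronglyMeasurable]
    refine (hD.const_mul (C ^ 2)).congr (Eventually.of_forall fun x => ?_)
    simp only [dominator]
    ring
  · filter_upwards [ae_ne_poles a (by omega)] with x hx
    exact (hb _ (scale_pos k) (scale_le_one k) x hx).2.2
  · filter_upwards [ae_ne_poles a (by omega)] with x hx
    exact tendsto_laplacian_approx a hx β

lemma ae_tendsto_approx (hN : 5 ≤ N) (β : ℝ) :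
    ∀ᵐ x, Tendsto (fun k => approx a β (scale k) x) atTop (𝓝 (singPow a β x)) := by
  filter_upwards [ae_ne_poles a (by omega)] with x hx
  exact tendsto_approx a hx β

lemma memD22_singPow (hN : 5 ≤ N) (hn : n ≠ 0) (hβ : 0 ≤ β) (hD : Integrable (dominator a β)) :
    MemD22 (singPow a β) (singLaplacian a β) :=
  have h := singPow_memD22 a hN hn hβ hD
  ⟨h.1, fun k => approx a β (scale k), fun k => isTestFunction_approx a (scale_pos k), h.2,
    ae_tendsto_approx a hN β⟩

/-- The remainder density of the singular power product. -/
noncomputable def singRemainder (α β : ℝ) (x : EuclideanSpace ℝ (Fin N)) : ℝ :=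
  (singLaplacian a β x + rate a 0 (fun _ => α) x * singPow a β x) ^ 2 + 2 * rate a 0 (fun _ => α) x *
    ∑ k, (-(logGrad a 0 (fun _ => β) k x * singPow a β x) +
      logGrad a 0 (fun _ => α) k x * singPow a β x) ^ 2

lemma tendsto_remainder_approx (hx : ∀ i, x ≠ a i) (α β : ℝ) :
    Tendsto (fun k => remainder a (scale k) α (approx a β (scale k)) x) atTop
      (𝓝 (singRemainder a α β x)) := by
  have h1 := (continuousAt_rate a hx (fun _ => α)).tendsto.comp tendsto_scale
  have h2 := tendsto_approx a hx β
  have h3 := tendsto_finsetSum Finset.univ fun j (_ : j ∈ Finset.univ) =>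
    ((tendsto_pd_approx a hx β j).add
      (((continuousAt_logGrad a hx (fun _ => α) j).tendsto.comp tendsto_scale).mul h2)).pow 2
  exact (((tendsto_laplacian_approx a hx β).add (h1.mul h2)).pow 2).add ((h1.const_mul 2).mul h3)

lemma exists_remainder_approx_bound (hn : n ≠ 0) (hα0 : 0 ≤ α) (hβ : 0 ≤ β) :
    ∃ C, 0 ≤ C ∧ ∀ s, 0 < s → s ≤ 1 → ∀ x : EuclideanSpace ℝ (Fin N), (∀ i, x ≠ a i) →
      |remainder a s α (approx a β s) x| ≤ C * dominator a β x := by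
  obtain ⟨C, hC, hb⟩ := exists_approx_bound a hn hβ
  set R := |(N : ℝ) - 2 - n * α| * α + (2 * n * α ^ 2 + 2 * α) with hR
  have hR0 : 0 ≤ R := by positivity
  refine ⟨(C + R) ^ 2 + 2 * R * (N * (C + n * α) ^ 2), by positivity, fun s hs hs1 x hx => ?_⟩
  obtain ⟨h1, h2, h3⟩ := hb s hs hs1 x hx
  have h4 : |rate a s (fun _ => α) x| ≤ R * invSqSum a x := abs_rate_le a hs.le hα0 hx
  have h5 := fun k => abs_logGrad_le a hs.le hα0 hx k
  have hS := invSqSum_nonneg a x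
  have hU := singPow_nonneg a β x
  have hT : √(invSqSum a x) ^ 2 = invSqSum a x := Real.sq_sqrt hS
  set T := √(invSqSum a x)
  have h6 : |Δ (approx a β s) x + rate a s (fun _ => α) x * approx a β s x| ≤
      (C + R) * (singPow a β x * invSqSum a x) := by
    refine (abs_add_le _ _).trans ?_
    rw [abs_mul]
    calc _ ≤ singPow a β x * (C * invSqSum a x) + R * invSqSum a x * singPow a β x := by gcongr
      _ = _ := by ring
  have h7 : ∀ k, |pd k (approx a β s) x + logGrad a s (fun _ => α) k x * approx a β s x| ≤
      (C + n * α) * (singPow a β x * T) := by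
    intro k
    refine (abs_add_le _ _).trans ?_
    rw [abs_mul]
    calc _ ≤ singPow a β x * (C * T) + n * α * T * singPow a β x := by
          gcongr
          · exact h2 k
          · exact h5 k
      _ = _ := by ring
  unfold remainder
  refine (abs_add_le _ _).trans ?_
  rw [abs_pow, abs_mul, abs_mul, abs_two, dominator]
  have h8 : |∑ k, (pd k (approx a β s) x + logGrad a s (fun _ => α) k x * approx a β s x) ^ 2| ≤
      N * ((C + n * α) * (singPow a β x * T)) ^ 2 := by
    refine (Finset.abs_sum_le_sum_abs _ _).trans ?_
    calc _ ≤ ∑ k : Fin N, ((C + n * α) * (singPow a β x * T)) ^ 2 :=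
          Finset.sum_le_sum fun k _ => by
            rw [abs_pow]
            exact pow_le_pow_left₀ (abs_nonneg _) (h7 k) 2
      _ = _ := by simp
  calc _ ≤ ((C + R) * (singPow a β x * invSqSum a x)) ^ 2 + 2 * (R * invSqSum a x) *
        (N * ((C + n * α) * (singPow a β x * T)) ^ 2) := by gcongr
    _ = (C + R) ^ 2 * (singPow a β x ^ 2 * invSqSum a x ^ 2) + 2 * R * (N * (C + n * α) ^ 2) *
        (singPow a β x ^ 2 * (invSqSum a x * T ^ 2)) := by ring
    _ = _ := by rw [hT]; ring

lemma exists_potential_bound (hN : 5 ≤ N) (hn : n ≠ 0) (hα : n * α = (N : ℝ) - 4) (hα0 : 0 ≤ α) :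
    ∃ C, 0 ≤ C ∧ ∀ s, 0 ≤ s → ∀ x : EuclideanSpace ℝ (Fin N), (∀ i, x ≠ a i) →
      |biRate a s α x| ≤ C * invSqSum a x ^ 2 ∧
      |rellichConst N n * potential a x| ≤ C * invSqSum a x ^ 2 :=
  ⟨_, by positivity, fun s hs x hx => ⟨abs_biRate_le a hs hα0 hx, by
    rw [← biRate_zero a (by omega) hn hα]
    exact abs_biRate_le a le_rfl hα0 hx⟩⟩

/-- The values of the quadratic form at the approximations. -/
lemma tendsto_quadForm_approx (hN : 5 ≤ N) (hn : n ≠ 0) (hα : n * α = (N : ℝ) - 4) (hα0 : 0 ≤ α)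
    (hβ : 0 ≤ β) (hD : Integrable (dominator a β)) :
    Tendsto (fun k => quadForm (rellichConst N n) (potential a) (approx a β (scale k))) atTop
      (𝓝 (∫ x, singRemainder a α β x)) := by
  obtain ⟨C, hC, hb⟩ := exists_approx_bound a hn hβ
  obtain ⟨C1, hC1, hb1⟩ := exists_remainder_approx_bound a hn hα0 hβ
  obtain ⟨C2, hC2, hb2⟩ := exists_potential_bound a hN hn hα hα0
  have ht := fun k => isTestFunction_approx a (β := β) (scale_pos k)
  have i1 := fun k => (ht k).integrable_mul_sq (continuous_biRate a (α := α) (scale_pos k))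
  have i2 := fun k => integrable_remainder a (α := α) (scale_pos k) (ht k)
  have i3 := fun k => ((isNonnegative_potential a hN hn _ (ht k)).1).const_mul (rellichConst N n)
  -- The exact identity is used with the same s as in the approximation. The mismatch between
  -- `biRate` and λ_n V_n tends to zero pointwise off the poles, so only the remainder survives.
  have e : ∀ k, quadForm (rellichConst N n) (potential a) (approx a β (scale k)) =
      ∫ x, ((biRate a (scale k) α x * approx a β (scale k) x ^ 2 -
        rellichConst N n * (potential a x * approx a β (scale k) x ^ 2)) +
        remainder a (scale k) α (approx a β (scale k)) x) := by
    intro k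
    have i4 : Integrable fun x => biRate a (scale k) α x * approx a β (scale k) x ^ 2 -
        rellichConst N n * (potential a x * approx a β (scale k) x ^ 2) := (i1 k).sub (i3 k)
    rw [integral_add i4 (i2 k), integral_sub (i1 k) (i3 k), integral_const_mul, quadForm,
      integral_laplacian_sq_eq a (scale_pos k) hα (ht k)]
    ring
  simp only [e]
  refine tendsto_integral_of_dominated_convergence
    (fun x => (C2 + C2 + C1) * dominator a β x)
    (fun k => (((i1 k).sub (i3 k)).add (i2 k)).aestronglyMeasurable) (hD.const_mul _)
    (fun k => ?_) ?_
  · filter_upwards [ae_ne_poles a (by omega)] with x hx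
    obtain ⟨h1, -, -⟩ := hb _ (scale_pos k) (scale_le_one k) x hx
    have h2 := hb1 _ (scale_pos k) (scale_le_one k) x hx
    obtain ⟨h3, h4⟩ := hb2 _ (scale_pos k).le x hx
    have h5 : approx a β (scale k) x ^ 2 ≤ singPow a β x ^ 2 := by
      rw [← sq_abs]
      exact pow_le_pow_left₀ (abs_nonneg _) h1 2
    have h6 : ∀ y, |y| ≤ C2 * invSqSum a x ^ 2 → |y * approx a β (scale k) x ^ 2| ≤
        C2 * dominator a β x := by
      intro y hy
      rw [abs_mul, abs_of_nonneg (sq_nonneg (approx a β (scale k) x)), dominator]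
      calc _ ≤ C2 * invSqSum a x ^ 2 * singPow a β x ^ 2 := by gcongr
        _ = _ := by ring
    rw [Real.norm_eq_abs]
    have h7 := h6 _ h3
    have h8 := h6 _ h4
    rw [mul_assoc] at h8
    refine (abs_add_le _ _).trans ((add_le_add_left (abs_sub _ _) _).trans ?_)
    linarith
  · filter_upwards [ae_ne_poles a (by omega)] with x hx
    have h1 := (continuousAt_biRate a (α := α) hx).tendsto.comp tendsto_scale
    rw [biRate_zero a (by omega) hn hα] at h1
    have h2 := (tendsto_approx a hx β).pow 2
    have h := ((h1.mul h2).sub ((h2.const_mul (potential a x)).const_mul (rellichConst N n))).add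
      (tendsto_remainder_approx a hx α β)
    rw [mul_assoc, sub_self, zero_add] at h
    exact h

/-- Both sides are limits of the quadratic form along the same approximations, so no integration by
parts with singular functions is needed. -/
lemma integral_singLaplacian_sq (hN : 5 ≤ N) (hn : n ≠ 0) (hα : n * α = (N : ℝ) - 4) (hα0 : 0 ≤ α)
    (hβ : 0 ≤ β) (hD : Integrable (dominator a β)) :
    (∫ x, singLaplacian a β x ^ 2) - rellichConst N n * ∫ x, potential a x * singPow a β x ^ 2 =
      ∫ x, singRemainder a α β x := by
  obtain ⟨C, hC, hb⟩ := exists_approx_bound a hn hβ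
  obtain ⟨C2, hC2, hb2⟩ := exists_potential_bound a hN hn hα hα0
  have ht := fun k => isTestFunction_approx a (β := β) (scale_pos k)
  obtain ⟨hg, hlim⟩ := singPow_memD22 a hN hn hβ hD
  refine tendsto_nhds_unique ?_ (tendsto_quadForm_approx a hN hn hα hα0 hβ hD)
  refine (tendsto_integral_sq (fun k => (ht k).memLp_laplacian) hg hlim).sub ?_
  simp only [← integral_const_mul]
  refine tendsto_integral_of_dominated_convergence (fun x => C2 * dominator a β x)
    (fun k => (((isNonnegative_potential a hN hn _ (ht k)).1).const_mul _).aestronglyMeasurable)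
    (hD.const_mul _) (fun k => ?_) ?_
  · filter_upwards [ae_ne_poles a (by omega)] with x hx
    obtain ⟨h1, -, -⟩ := hb _ (scale_pos k) (scale_le_one k) x hx
    obtain ⟨-, h4⟩ := hb2 0 le_rfl x hx
    have h5 : approx a β (scale k) x ^ 2 ≤ singPow a β x ^ 2 := by
      rw [← sq_abs]
      exact pow_le_pow_left₀ (abs_nonneg _) h1 2
    rw [Real.norm_eq_abs, ← mul_assoc, abs_mul,
      abs_of_nonneg (sq_nonneg (approx a β (scale k) x)), dominator]
    calc _ ≤ C2 * invSqSum a x ^ 2 * singPow a β x ^ 2 := by gcongr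
      _ = _ := by ring
  · filter_upwards [ae_ne_poles a (by omega)] with x hx
    exact (((tendsto_approx a hx β).pow 2).const_mul _).const_mul _

/-- The remainder is quadratically small in the deviation of the exponent. -/
lemma exists_singRemainder_bound (hα0 : 0 ≤ α) : ∃ C, 0 ≤ C ∧ ∀ β, 0 ≤ β → β ≤ α →
    ∀ x : EuclideanSpace ℝ (Fin N), (∀ i, x ≠ a i) →
      |singRemainder a α β x| ≤ C * (α - β) ^ 2 * dominator a β x := by
  set R := |(N : ℝ) - 2 - n * α| * α + (2 * n * α ^ 2 + 2 * α) with hR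
  have hR0 : 0 ≤ R := by positivity
  set L := (N : ℝ) + 2 + n * (2 * α) + 2 * α * (2 * n) with hL
  have hL0 : 0 ≤ L := by positivity
  refine ⟨L ^ 2 + 2 * R * n, by positivity, fun β hβ hβα x hx => ?_⟩
  have hS := invSqSum_nonneg a x
  have hU := singPow_nonneg a β x
  have h1 : |rate a 0 (fun _ => α) x| ≤ R * invSqSum a x := abs_rate_le a le_rfl hα0 hx
  -- At s = 0 the quadratic part is homogeneous of degree two in the exponents, so a factor α - β
  -- splits off the difference of the rates.
  have hq1 : ∀ β : ℝ, quadRate a 0 (fun _ => β) x = β ^ 2 * quadRate a 0 (fun _ => 1) x := by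
    intro β
    simp only [quadRate, mul_zero, zero_mul, add_zero]
    simp only [Finset.mul_sum]
    exact Finset.sum_congr rfl fun i _ => Finset.sum_congr rfl fun j _ => by ring
  have hq2 : |quadRate a 0 (fun _ => 1) x| ≤ 2 * n * invSqSum a x := by
    rw [abs_of_nonneg (quadRate_nonneg a le_rfl fun _ => zero_le_one)]
    refine le_trans (le_of_eq ?_) (sum_pairWeight_le a le_rfl hx)
    simp [quadRate]
  have h2 : |rate a 0 (fun _ => α) x - rate a 0 (fun _ => β) x| ≤
      L * (α - β) * invSqSum a x := by
    have hd : 0 ≤ α - β := by linarith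
    rw [rate_const_eq, rate_const_eq, hq1 α, hq1 β,
      show ∑ i, invSq a 0 i x = invSqSum a x from rfl]
    have e : ((N : ℝ) - 2 - n * α) * α * invSqSum a x + α ^ 2 * quadRate a 0 (fun _ => 1) x -
        (((N : ℝ) - 2 - n * β) * β * invSqSum a x + β ^ 2 * quadRate a 0 (fun _ => 1) x) =
        (α - β) * (((N : ℝ) - 2 - n * (α + β)) * invSqSum a x +
          (α + β) * quadRate a 0 (fun _ => 1) x) := by ring
    rw [e, abs_mul, abs_of_nonneg hd]
    have h3 : |(N : ℝ) - 2 - n * (α + β)| ≤ N + 2 + n * (2 * α) := by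
      have h4 : n * (α + β) ≤ n * (2 * α) := by gcongr; linarith
      have h5 : 0 ≤ n * (α + β) := by positivity
      have h6 : (0 : ℝ) ≤ N := by positivity
      rw [abs_le]
      constructor <;> linarith
    calc _ ≤ (α - β) * ((N + 2 + n * (2 * α)) * invSqSum a x +
          (2 * α) * (2 * n * invSqSum a x)) := by
          gcongr
          refine (abs_add_le _ _).trans ?_
          rw [abs_mul, abs_mul, abs_of_nonneg hS, abs_of_nonneg (by positivity : 0 ≤ α + β)]
          gcongr
          linarith
      _ = _ := by rw [hL]; ring
  have h3 : ∑ k, (-(logGrad a 0 (fun _ => β) k x * singPow a β x) +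
      logGrad a 0 (fun _ => α) k x * singPow a β x) ^ 2 =
      singPow a β x ^ 2 * ∑ k, logGrad a 0 (fun _ => α - β) k x ^ 2 := by
    rw [Finset.mul_sum]
    refine Finset.sum_congr rfl fun k _ => ?_
    have : logGrad a 0 (fun _ => α - β) k x =
        logGrad a 0 (fun _ => α) k x - logGrad a 0 (fun _ => β) k x := by
      simp only [logGrad, ← Finset.sum_sub_distrib]
      exact Finset.sum_congr rfl fun i _ => by ring
    rw [this]
    ring
  have h4 := sum_logGrad_sq_le a (β := α - β) le_rfl hx
  have h5 : 0 ≤ ∑ k, logGrad a 0 (fun _ => α - β) k x ^ 2 :=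
    Finset.sum_nonneg fun k _ => sq_nonneg _
  rw [singRemainder, h3, singLaplacian, show -(rate a 0 (fun _ => β) x * singPow a β x) +
    rate a 0 (fun _ => α) x * singPow a β x =
      (rate a 0 (fun _ => α) x - rate a 0 (fun _ => β) x) * singPow a β x by ring]
  refine (abs_add_le _ _).trans ?_
  rw [abs_pow, abs_mul, abs_mul, abs_mul, abs_two, abs_of_nonneg hU,
    abs_of_nonneg (mul_nonneg (sq_nonneg (singPow a β x)) h5), dominator]
  calc _ ≤ (L * (α - β) * invSqSum a x * singPow a β x) ^ 2 + 2 * (R * invSqSum a x) *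
        (singPow a β x ^ 2 * (n * (α - β) ^ 2 * invSqSum a x)) := by gcongr
    _ = _ := by ring

end Convergence

/-! ### Almost minimizers, criticality, sharpness, and the minimizer for n ≥ 3 -/

section Criticality

variable {N n : ℕ} (a : Fin n → EuclideanSpace ℝ (Fin N)) {s α β : ℝ}

lemma integral_singRemainder_self (hN : 5 ≤ N) (hα0 : 0 ≤ α) :
    ∫ x, singRemainder a α α x = 0 := by
  obtain ⟨C, hC, hb⟩ := exists_singRemainder_bound a hα0
  refine integral_eq_zero_of_ae ?_
  filter_upwards [ae_ne_poles a (by omega)] with x hx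
  have := hb α hα0 le_rfl x hx
  simpa using this

/-- The family of almost minimizers with exponents `α - δ`. -/
lemma exists_almost_minimizers (ha : Function.Injective a) (hN : 5 ≤ N) (hn : 2 ≤ n)
    (hα : n * α = (N : ℝ) - 4) (hα0 : 0 < α) :
    ∃ C δ₀, 0 ≤ C ∧ 0 < δ₀ ∧ ∀ δ, 0 < δ → δ ≤ δ₀ → 0 ≤ α - δ ∧
      Integrable (dominator a (α - δ)) ∧ ∫ x, singRemainder a α (α - δ) x ≤ C * δ := by
  obtain ⟨C, hC, hb⟩ := exists_singRemainder_bound a hα0.le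
  obtain ⟨C', hC', hb'⟩ := exists_integral_bound (α := α) a ha hN
  -- The bound α/4 gives β ≥ 3α/4, hence 3(N - 4) ≤ 4nβ, the decay at infinity; the bound 1 lets δ²
  -- be absorbed into δ.
  refine ⟨C * C' * 2, min 1 (α / 4), by positivity, by positivity, fun δ hδ hδ0 => ?_⟩
  have h1 : δ ≤ 1 := hδ0.trans (min_le_left _ _)
  have h2 : δ ≤ α / 4 := hδ0.trans (min_le_right _ _)
  have hn2 : (2 : ℝ) ≤ n := by exact_mod_cast hn
  -- Here n ≥ 2 enters: it gives N - 4 - 2(α - δ) ≥ 2δ, so the dominating mass is O(1/δ). For n = 2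
  -- this is an equality.
  have h3 : 2 * α ≤ (N : ℝ) - 4 := by rw [← hα]; gcongr
  have hβ0 : 0 ≤ α - δ := by linarith
  have hβ1 : α - δ ≤ α := by linarith
  have h4 : 3 * ((N : ℝ) - 4) ≤ 4 * (n * (α - δ)) := by
    rw [← hα]
    have : n * (3 * α) ≤ n * (4 * (α - δ)) :=
      mul_le_mul_of_nonneg_left (by linarith) (by positivity)
    linarith
  obtain ⟨hi, hI⟩ := hb' (α - δ) hβ0 hβ1 h4 (by linarith)
  refine ⟨hβ0, hi, ?_⟩
  have hD : ∫ x, dominator a (α - δ) x ≤ C' * (1 / (2 * δ) + 1) := by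
    refine hI.trans ?_
    gcongr
    linarith
  -- A remainder of order δ² against a mass of order 1/δ leaves order δ.
  have h5 : ∫ x, singRemainder a α (α - δ) x ≤ ∫ x, C * δ ^ 2 * dominator a (α - δ) x := by
    have hi' : Integrable fun x => C * δ ^ 2 * dominator a (α - δ) x := hi.const_mul _
    refine (Real.le_norm_self _).trans (norm_integral_le_of_norm_le hi' ?_)
    filter_upwards [ae_ne_poles a (by omega)] with x hx
    have := hb (α - δ) hβ0 hβ1 x hx
    rwa [sub_sub_cancel] at this
  rw [integral_const_mul] at h5
  calc _ ≤ C * δ ^ 2 * (C' * (1 / (2 * δ) + 1)) := h5.trans (by gcongr)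
    _ = C * C' * (δ / 2 + δ ^ 2) := by field_simp
    _ ≤ C * C' * (δ * 2) := by
        gcongr
        nlinarith
    _ = _ := by ring

/-- A positive continuous minorant of the singular power products. -/
noncomputable def minorant (α : ℝ) (x : EuclideanSpace ℝ (Fin N)) : ℝ :=
  ∏ i, (1 + ‖x - a i‖) ^ (-α)

lemma minorant_pos (α : ℝ) (x : EuclideanSpace ℝ (Fin N)) : 0 < minorant a α x :=
  Finset.prod_pos fun i _ => by positivity

lemma continuous_minorant (α : ℝ) : Continuous (minorant a α) := by
  refine continuous_finsetProd _ fun i _ => Continuous.rpow_const (by fun_prop) fun x => Or.inl ?_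
  positivity

variable {x : EuclideanSpace ℝ (Fin N)}

/-- Since 1 + d exceeds both 1 and d, (1 + d)^(-α) ≤ (1 + d)^(-β) ≤ d^(-β). One minorant serves all
β ≤ α and keeps the weighted masses from vanishing as δ → 0. -/
lemma minorant_le (hβ : 0 ≤ β) (hβα : β ≤ α) (hx : ∀ i, x ≠ a i) :
    minorant a α x ≤ singPow a β x := by
  rw [singPow_eq]
  refine Finset.prod_le_prod (fun i _ => by positivity) fun i _ => ?_
  have hd : 0 < ‖x - a i‖ := norm_pos_iff.2 (sub_ne_zero.2 (hx i))
  calc (1 + ‖x - a i‖) ^ (-α) ≤ (1 + ‖x - a i‖) ^ (-β) :=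
        Real.rpow_le_rpow_of_exponent_le (by linarith) (by linarith)
    _ ≤ _ := Real.rpow_le_rpow_of_nonpos hd (by linarith) (by linarith)

lemma nu_pos (hN : 5 ≤ N) (k i j : Fin n) : 0 < nu N k i j := by
  have : (5 : ℝ) ≤ N := by exact_mod_cast hN
  have hn : (0 : ℝ) ≤ n := by positivity
  unfold nu
  split_ifs
  · exact div_pos (by linarith) (by linarith)
  · exact div_pos (by linarith) (by linarith)

/-- A lower bound of the potential by the contribution of a pair of poles. -/
lemma le_potential (hN : 5 ≤ N) {p q : Fin n} (hpq : p < q) :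
    ‖a p - a q‖ ^ 2 * (invSq a 0 p x * invSq a 0 q x) *
      (nu N p p q * nu N q p q * ‖a p - a q‖ ^ 2 * (invSq a 0 p x * invSq a 0 q x)) ≤
      potential a x := by
  rw [← regPotential_zero, regPotential]
  have h := fun i => invSq_nonneg a (s := 0) le_rfl i x
  have h1 : ∀ i j k l : Fin n, 0 ≤ nu N k i j * nu N l i j * ‖a k - a l‖ ^ 2 *
      (invSq a 0 k x * invSq a 0 l x) := fun i j k l => mul_nonneg
      (mul_nonneg (mul_nonneg (nu_nonneg hN _ _ _) (nu_nonneg hN _ _ _)) (by positivity))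
      (mul_nonneg (h k) (h l))
  have h2 : ∀ i j : Fin n, 0 ≤ ‖a i - a j‖ ^ 2 * (invSq a 0 i x * invSq a 0 j x) := fun i j =>
    mul_nonneg (by positivity) (mul_nonneg (h i) (h j))
  have h3 : ∀ i j : Fin n, 0 ≤ ∑ k, ∑ l ∈ Finset.Ioi k, nu N k i j * nu N l i j *
      ‖a k - a l‖ ^ 2 * (invSq a 0 k x * invSq a 0 l x) := fun i j =>
    Finset.sum_nonneg fun k _ => Finset.sum_nonneg fun l _ => h1 i j k l
  refine le_trans ?_ (Finset.single_le_sum (fun i _ => Finset.sum_nonneg fun j _ =>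
    mul_nonneg (h2 i j) (h3 i j)) (Finset.mem_univ p))
  refine le_trans ?_ (Finset.single_le_sum (fun j _ =>
    mul_nonneg (h2 p j) (h3 p j)) (Finset.mem_Ioi.2 hpq))
  refine mul_le_mul_of_nonneg_left ?_ (h2 p q)
  refine le_trans ?_ (Finset.single_le_sum (fun k _ => Finset.sum_nonneg fun l _ =>
    h1 p q k l) (Finset.mem_univ p))
  exact Finset.single_le_sum (fun l _ => h1 p q p l) (Finset.mem_Ioi.2 hpq)

lemma potential_pos (ha : Function.Injective a) (hN : 5 ≤ N) (hn : 2 ≤ n) (hx : ∀ i, x ≠ a i) :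
    0 < potential a x := by
  let p : Fin n := ⟨0, by omega⟩
  let q : Fin n := ⟨1, by omega⟩
  have hpq : p < q := by simp [p, q]
  refine lt_of_lt_of_le ?_ (le_potential a hN hpq)
  have h := fun i => inv_pos.2 (rho_pos_of_ne a (s := 0) le_rfl hx i)
  have h1 : 0 < ‖a p - a q‖ := norm_pos_iff.2 (sub_ne_zero.2 fun e => hpq.ne (ha e))
  have := h p
  have := h q
  have := nu_pos hN p p q
  have := nu_pos hN q p q
  unfold invSq
  positivity

lemma integral_potential_mul_sq_pos (ha : Function.Injective a) (hN : 5 ≤ N) (hn : 2 ≤ n)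
    {u : EuclideanSpace ℝ (Fin N) → ℝ} (hi : Integrable fun x => potential a x * u x ^ 2)
    (hu : ¬ u =ᵐ[volume] 0) : 0 < ∫ x, potential a x * u x ^ 2 := by
  have h0 : 0 ≤ fun x => potential a x * u x ^ 2 := fun x =>
    mul_nonneg (potential_nonneg a hN x) (sq_nonneg _)
  refine lt_of_le_of_ne (integral_nonneg h0) fun h => hu ?_
  have h1 := (integral_eq_zero_iff_of_nonneg h0 hi).1 h.symm
  filter_upwards [h1, ae_ne_poles a (by omega)] with x hx hp
  have := (potential_pos a ha hN hn hp).ne'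
  simpa [this] using hx

lemma singPow_not_ae_zero (hN : 5 ≤ N) (hβ : 0 ≤ β) : ¬ singPow a β =ᵐ[volume] 0 := by
  intro h
  obtain ⟨x, hx, hp⟩ := (h.and (ae_ne_poles a (by omega))).exists
  have h1 := minorant_le a hβ le_rfl hp
  have h2 := minorant_pos a β x
  rw [hx] at h1
  exact absurd h1 (not_le.2 h2)

theorem not_isSubcritical (ha : Function.Injective a) (hN : 5 ≤ N) (hn : 2 ≤ n) :
    ¬ IsSubcritical (rellichConst N n) (potential a) := by
  rintro ⟨-, W, hWc, hW0, hWne, hW⟩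
  have hN5 : (5 : ℝ) ≤ N := by exact_mod_cast hN
  have hn0 : n ≠ 0 := by omega
  have hn' : (0 : ℝ) < n := by exact_mod_cast Nat.pos_of_ne_zero hn0
  obtain ⟨α, hα⟩ : ∃ α : ℝ, n * α = (N : ℝ) - 4 := ⟨((N : ℝ) - 4) / n, by field_simp⟩
  have hα0 : 0 < α := by
    by_contra! h
    nlinarith
  obtain ⟨C, δ₀, hC, hδ₀, hb⟩ := exists_almost_minimizers a ha hN hn hα hα0
  -- The inequality with W is available only for test functions; Fatou carries it to the singular
  -- products, where the quadratic form is at most Cδ.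
  have key : ∀ δ, 0 < δ → δ ≤ δ₀ →
      ∫⁻ x, ENNReal.ofReal (W x * minorant a α x ^ 2) ≤ ENNReal.ofReal (C * δ) := by
    intro δ hδ hδ0
    obtain ⟨hβ, hD, hr⟩ := hb δ hδ hδ0
    have ht := fun k => isTestFunction_approx a (β := α - δ) (scale_pos k)
    have hlim := tendsto_quadForm_approx a hN hn0 hα hα0.le hβ hD
    calc ∫⁻ x, ENNReal.ofReal (W x * minorant a α x ^ 2)
        ≤ ∫⁻ x, liminf (fun k => ENNReal.ofReal (W x * approx a (α - δ) (scale k) x ^ 2)) atTop := by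
          refine lintegral_mono_ae ?_
          filter_upwards [ae_ne_poles a (by omega)] with x hx
          have hl : Tendsto (fun k => ENNReal.ofReal (W x * approx a (α - δ) (scale k) x ^ 2)) atTop
              (𝓝 (ENNReal.ofReal (W x * singPow a (α - δ) x ^ 2))) :=
            (ENNReal.continuous_ofReal.tendsto _).comp
              (((tendsto_approx a hx (α - δ)).pow 2).const_mul (W x))
          rw [hl.liminf_eq]
          have h1 := minorant_le a hβ (by linarith : α - δ ≤ α) hx
          have h2 := minorant_pos a α x
          have h3 := hW0 x
          gcongr
      _ ≤ liminf (fun k => ∫⁻ x, ENNReal.ofReal (W x * approx a (α - δ) (scale k) x ^ 2)) atTop :=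
          lintegral_liminf_le' fun k =>
            ((ht k).integrable_mul_sq hWc).aestronglyMeasurable.aemeasurable.ennreal_ofReal
      _ ≤ liminf (fun k => ENNReal.ofReal
            (quadForm (rellichConst N n) (potential a) (approx a (α - δ) (scale k)))) atTop := by
          refine liminf_le_liminf (Eventually.of_forall fun k => ?_)
          rw [← ofReal_integral_eq_lintegral_ofReal ((ht k).integrable_mul_sq hWc)
            (Eventually.of_forall fun x => mul_nonneg (hW0 x) (sq_nonneg _))]
          exact ENNReal.ofReal_le_ofReal (hW _ (ht k))
      _ = ENNReal.ofReal (∫ x, singRemainder a α (α - δ) x) :=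
          ((ENNReal.continuous_ofReal.tendsto _).comp hlim).liminf_eq
      _ ≤ _ := ENNReal.ofReal_le_ofReal hr
  have hz : ∫⁻ x, ENNReal.ofReal (W x * minorant a α x ^ 2) = 0 := by
    refine le_antisymm (ge_of_tendsto (f := fun δ => ENNReal.ofReal (C * δ)) (x := 𝓝[>] (0 : ℝ)) ?_ ?_)
      zero_le
    · have h : Continuous fun δ : ℝ => ENNReal.ofReal (C * δ) :=
        ENNReal.continuous_ofReal.comp (continuous_const.mul continuous_id)
      have h2 := h.tendsto 0
      simp only [mul_zero, ENNReal.ofReal_zero] at h2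
      exact h2.mono_left nhdsWithin_le_nhds
    · filter_upwards [Ioc_mem_nhdsGT hδ₀] with δ hδ
      exact key δ hδ.1 hδ.2
  have hm : Continuous fun x => W x * minorant a α x ^ 2 :=
    hWc.mul ((continuous_minorant a α).pow 2)
  rw [lintegral_eq_zero_iff hm.measurable.ennreal_ofReal] at hz
  have hae : W =ᵐ[volume] 0 := by
    filter_upwards [hz] with x hx
    have h1 : W x * minorant a α x ^ 2 ≤ 0 := ENNReal.ofReal_eq_zero.1 hx
    have h2 := minorant_pos a α x
    have h3 : 0 < minorant a α x ^ 2 := by positivity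
    exact le_antisymm (by simpa using nonpos_of_mul_nonpos_left h1 h3) (hW0 x)
  exact hWne ((hWc.ae_eq_iff_eq volume continuous_zero).1 hae)

theorem isCritical_potential (ha : Function.Injective a) (hN : 5 ≤ N) (hn : 2 ≤ n) :
    IsCritical (rellichConst N n) (potential a) :=
  ⟨isNonnegative_potential a hN (by omega), not_isSubcritical a ha hN hn⟩

theorem isSharpConstant_potential (ha : Function.Injective a) (hN : 5 ≤ N) (hn : 2 ≤ n) :
    IsSharpConstant (rellichConst N n) (potential a) := by
  have hN5 : (5 : ℝ) ≤ N := by exact_mod_cast hN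
  have hn0 : n ≠ 0 := by omega
  have hn' : (0 : ℝ) < n := by exact_mod_cast Nat.pos_of_ne_zero hn0
  obtain ⟨α, hα⟩ : ∃ α : ℝ, n * α = (N : ℝ) - 4 := ⟨((N : ℝ) - 4) / n, by field_simp⟩
  have hα0 : 0 < α := by
    by_contra! h
    nlinarith
  have hden : ∀ u g, MemD22 u g → ¬ u =ᵐ[volume] 0 →
      Integrable (fun x => potential a x * (u x) ^ 2) ∧ 0 < ∫ x, potential a x * (u x) ^ 2 :=
    fun u g h hu => have hi := h.integrable a hN hn0
      ⟨hi, integral_potential_mul_sq_pos a ha hN hn hi hu⟩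
  refine ⟨hden, ?_, ?_⟩
  · rintro _ ⟨u, g, h, hu, rfl⟩
    rw [le_div_iff₀ (hden u g h hu).2]
    exact h.rellich a hN hn0
  · intro b hb
    obtain ⟨C, δ₀, hC, hδ₀, hm⟩ := exists_almost_minimizers a ha hN hn hα hα0
    have hV : ∀ δ, 0 < δ → δ ≤ δ₀ → Integrable fun x => potential a x * singPow a (α - δ) x ^ 2 :=
      fun δ hδ hδ0 => by
        obtain ⟨hβ, hD, -⟩ := hm δ hδ hδ0
        exact (memD22_singPow a hN hn0 hβ hD).integrable a hN hn0
    have hmin : ∀ δ, 0 < δ → δ ≤ δ₀ → ∀ᵐ x, potential a x * minorant a α x ^ 2 ≤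
        potential a x * singPow a (α - δ) x ^ 2 := by
      intro δ hδ hδ0
      filter_upwards [ae_ne_poles a (by omega)] with x hx
      have h1 := minorant_le a (hm δ hδ hδ0).1 (by linarith : α - δ ≤ α) hx
      have h2 := minorant_pos a α x
      have h3 := potential_nonneg a hN x
      gcongr
    have hi : Integrable fun x => potential a x * minorant a α x ^ 2 := by
      refine (hV δ₀ hδ₀ le_rfl).mono' ((measurable_potential a).mul
        ((continuous_minorant a α).measurable.pow_const 2)).aestronglyMeasurable ?_
      filter_upwards [hmin δ₀ hδ₀ le_rfl] with x hx
      rwa [Real.norm_of_nonneg (mul_nonneg (potential_nonneg a hN x) (sq_nonneg _))]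
    have hpos : 0 < ∫ x, potential a x * minorant a α x ^ 2 := by
      refine integral_potential_mul_sq_pos a ha hN hn hi fun h => ?_
      obtain ⟨x, hx⟩ := h.exists
      exact (minorant_pos a α x).ne' hx
    set c0 := ∫ x, potential a x * minorant a α x ^ 2
    by_contra! hlt
    -- A lower bound b > λ_n would keep the form at these functions above (b - λ_n) c0, while the
    -- remainder bounds it by Cδ.
    have key : ∀ δ, 0 < δ → δ ≤ δ₀ → (b - rellichConst N n) * c0 ≤ C * δ := by
      intro δ hδ hδ0
      obtain ⟨hβ, hD, hr⟩ := hm δ hδ hδ0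
      have hmem := memD22_singPow a hN hn0 hβ hD
      have hne := singPow_not_ae_zero a hN hβ
      have h1 := hb ⟨_, _, hmem, hne, rfl⟩
      rw [le_div_iff₀ (hden _ _ hmem hne).2] at h1
      have h2 := integral_singLaplacian_sq a hN hn0 hα hα0.le hβ hD
      have h3 : c0 ≤ ∫ x, potential a x * singPow a (α - δ) x ^ 2 :=
        integral_mono_ae hi (hV δ hδ hδ0) (hmin δ hδ hδ0)
      have h4 := mul_le_mul_of_nonneg_left h3 (sub_nonneg.2 hlt.le)
      linarith
    have hcp : 0 < (b - rellichConst N n) * c0 := mul_pos (sub_pos.2 hlt) hpos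
    have h1 := key (min δ₀ ((b - rellichConst N n) * c0 / (2 * (C + 1)))) (by positivity)
      (min_le_left _ _)
    have h2 : C * min δ₀ ((b - rellichConst N n) * c0 / (2 * (C + 1))) ≤
        C * ((b - rellichConst N n) * c0 / (2 * (C + 1))) := by
      gcongr
      exact min_le_right _ _
    have h3 : C * ((b - rellichConst N n) * c0 / (2 * (C + 1))) < (b - rellichConst N n) * c0 := by
      rw [mul_div_assoc', div_lt_iff₀ (by positivity)]
      nlinarith
    linarith

theorem mem_rayleighQuotients (ha : Function.Injective a) (hN : 5 ≤ N) (hn : 3 ≤ n) :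
    rellichConst N n ∈ rayleighQuotients (potential a) := by
  have hN5 : (5 : ℝ) ≤ N := by exact_mod_cast hN
  have hn0 : n ≠ 0 := by omega
  have hn3 : (3 : ℝ) ≤ n := by exact_mod_cast hn
  obtain ⟨α, hα⟩ : ∃ α : ℝ, n * α = (N : ℝ) - 4 := ⟨((N : ℝ) - 4) / n, by field_simp⟩
  have hα0 : 0 < α := by
    by_contra! h
    nlinarith
  obtain ⟨C, hC, hb⟩ := exists_integral_bound (α := α) a ha hN
  -- Three poles give 3α ≤ N - 4, hence 2α + 4 < N: the exponent α is itself admissible and no δ is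
  -- needed.
  have hD : Integrable (dominator a α) :=
    (hb α hα0.le le_rfl (by rw [hα]; linarith) (by nlinarith)).1
  have hmem := memD22_singPow a hN hn0 hα0.le hD
  have hne := singPow_not_ae_zero a hN hα0.le
  refine ⟨_, _, hmem, hne, ?_⟩
  rw [eq_div_iff ((isSharpConstant_potential a ha hN (by omega)).1 _ _ hmem hne).2.ne']
  have h := integral_singLaplacian_sq a hN hn0 hα hα0.le hα0.le hD
  rw [integral_singRemainder_self a hN hα0.le] at h
  linarith

end Criticality

/-! ### Limits of functions with vanishing gradients are constant -/

section Translations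

variable {N : ℕ}

/-- The squared length of the gradient. -/
noncomputable def gradSq (v : EuclideanSpace ℝ (Fin N) → ℝ) (x : EuclideanSpace ℝ (Fin N)) : ℝ :=
  ∑ k, pd k v x ^ 2

lemma continuous_gradSq {v : EuclideanSpace ℝ (Fin N) → ℝ} (hv : ContDiff ℝ ∞ v) :
    Continuous (gradSq v) := by
  have := fun k => (contDiff_pd k hv).continuous
  unfold gradSq
  fun_prop

lemma gradSq_nonneg (v : EuclideanSpace ℝ (Fin N) → ℝ) (x : EuclideanSpace ℝ (Fin N)) :
    0 ≤ gradSq v x := Finset.sum_nonneg fun _ _ => sq_nonneg _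

lemma fderiv_sq_le (v : EuclideanSpace ℝ (Fin N) → ℝ) (x h : EuclideanSpace ℝ (Fin N)) :
    (fderiv ℝ v x h) ^ 2 ≤ ‖h‖ ^ 2 * gradSq v x := by
  have e : fderiv ℝ v x h = ∑ k, h k * pd k v x := by
    conv_lhs => rw [← (EuclideanSpace.basisFun (Fin N) ℝ).sum_repr h]
    simp [pd]
  rw [e, EuclideanSpace.real_norm_sq_eq]
  exact Finset.sum_mul_sq_le_sq_mul_sq _ _ _

/-- The fundamental theorem of calculus on the segment, followed by Jensen's inequality. -/
lemma sq_sub_le {v : EuclideanSpace ℝ (Fin N) → ℝ} (hv : ContDiff ℝ ∞ v)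
    (x h : EuclideanSpace ℝ (Fin N)) :
    (v (x + h) - v x) ^ 2 ≤ ∫ t in (0 : ℝ)..1, ‖h‖ ^ 2 * gradSq v (x + t • h) := by
  have hd : ∀ t : ℝ, HasDerivAt (fun t : ℝ => v (x + t • h)) (fderiv ℝ v (x + t • h) h) t := by
    intro t
    have h1 : HasDerivAt (fun t : ℝ => x + t • h) h t := by
      simpa using ((hasDerivAt_id t).smul_const h).const_add x
    exact (hv.differentiable (by norm_num) _).hasFDerivAt.comp_hasDerivAt t h1
  have hc : Continuous fun t : ℝ => fderiv ℝ v (x + t • h) h :=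
    ((hv.continuous_fderiv (by norm_num)).comp (by fun_prop)).clm_apply continuous_const
  have hG := continuous_gradSq hv
  have hF : ∫ t in (0 : ℝ)..1, fderiv ℝ v (x + t • h) h = v (x + h) - v x := by
    rw [intervalIntegral.integral_eq_sub_of_hasDerivAt (fun t _ => hd t) (hc.intervalIntegrable _ _)]
    simp
  set c := v (x + h) - v x
  -- Jensen by hand: 2cf' - c² ≤ (f')² pointwise, and since ∫ f' = c the left side integrates to c².
  have h1 : ∫ t in (0 : ℝ)..1, (2 * c * fderiv ℝ v (x + t • h) h - c ^ 2) ≤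
      ∫ t in (0 : ℝ)..1, ‖h‖ ^ 2 * gradSq v (x + t • h) := by
    refine intervalIntegral.integral_mono_on zero_le_one
      (Continuous.intervalIntegrable (by fun_prop) _ _)
      (Continuous.intervalIntegrable (by fun_prop) _ _) fun t _ => ?_
    have := fderiv_sq_le v (x + t • h) h
    nlinarith [sq_nonneg (fderiv ℝ v (x + t • h) h - c)]
  rw [intervalIntegral.integral_sub (Continuous.intervalIntegrable (by fun_prop) _ _)
    (Continuous.intervalIntegrable (by fun_prop) _ _), intervalIntegral.integral_const_mul, hF] at h1
  simp only [intervalIntegral.integral_const, sub_zero, smul_eq_mul, one_mul] at h1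
  linarith

/-- Integrate the pointwise bound over the ball and exchange the integrals; shifting by th with 0 ≤
t ≤ 1 stays inside the ball of radius R + |h|. -/
lemma lintegral_sq_sub_le {v : EuclideanSpace ℝ (Fin N) → ℝ} (hv : ContDiff ℝ ∞ v)
    (h : EuclideanSpace ℝ (Fin N)) (R : ℝ) :
    ∫⁻ x in Metric.ball 0 R, ENNReal.ofReal ((v (x + h) - v x) ^ 2) ≤
      ENNReal.ofReal (‖h‖ ^ 2) * ∫⁻ x in Metric.ball 0 (R + ‖h‖), ENNReal.ofReal (gradSq v x) := by
  have hG := continuous_gradSq hv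
  have h1 : ∀ x, ENNReal.ofReal ((v (x + h) - v x) ^ 2) ≤
      ∫⁻ t in Set.Ioc (0 : ℝ) 1, ENNReal.ofReal (‖h‖ ^ 2 * gradSq v (x + t • h)) := by
    intro x
    have hc : Continuous fun t : ℝ => ‖h‖ ^ 2 * gradSq v (x + t • h) := by fun_prop
    refine (ENNReal.ofReal_le_ofReal (sq_sub_le hv x h)).trans (le_of_eq ?_)
    rw [intervalIntegral.integral_of_le zero_le_one]
    exact ofReal_integral_eq_lintegral_ofReal
      ((intervalIntegrable_iff_integrableOn_Ioc_of_le zero_le_one).1 (hc.intervalIntegrable 0 1))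
      (Eventually.of_forall fun t => mul_nonneg (sq_nonneg _) (gradSq_nonneg _ _))
  have hmeas : Measurable fun p : EuclideanSpace ℝ (Fin N) × ℝ =>
      ENNReal.ofReal (‖h‖ ^ 2 * gradSq v (p.1 + p.2 • h)) := by
    have hc : Continuous fun p : EuclideanSpace ℝ (Fin N) × ℝ =>
      ‖h‖ ^ 2 * gradSq v (p.1 + p.2 • h) := by fun_prop
    exact hc.measurable.ennreal_ofReal
  calc _ ≤ ∫⁻ x in Metric.ball 0 R, ∫⁻ t in Set.Ioc (0 : ℝ) 1,
        ENNReal.ofReal (‖h‖ ^ 2 * gradSq v (x + t • h)) := lintegral_mono fun x => h1 x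
    _ = ∫⁻ t in Set.Ioc (0 : ℝ) 1, ∫⁻ x in Metric.ball 0 R,
        ENNReal.ofReal (‖h‖ ^ 2 * gradSq v (x + t • h)) :=
        lintegral_lintegral_swap hmeas.aemeasurable
    _ ≤ ∫⁻ t in Set.Ioc (0 : ℝ) 1, ENNReal.ofReal (‖h‖ ^ 2) *
        ∫⁻ x in Metric.ball 0 (R + ‖h‖), ENNReal.ofReal (gradSq v x) := by
        refine setLIntegral_mono' measurableSet_Ioc fun t ht => ?_
        simp only [ENNReal.ofReal_mul (sq_nonneg ‖h‖)]
        rw [lintegral_const_mul _ (by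
          have hc : Continuous fun x => gradSq v (x + t • h) := by fun_prop
          exact hc.measurable.ennreal_ofReal)]
        refine mul_le_mul_right ?_ _
        rw [← lintegral_indicator measurableSet_ball, ← lintegral_indicator measurableSet_ball,
          ← lintegral_add_right_eq_self (fun x => (Metric.ball 0 (R + ‖h‖)).indicator
            (fun x => ENNReal.ofReal (gradSq v x)) x) (t • h)]
        refine lintegral_mono fun x => ?_
        by_cases hx : x ∈ Metric.ball 0 R
        · have hx' : x + t • h ∈ Metric.ball 0 (R + ‖h‖) := by
            rw [mem_ball_zero_iff] at hx ⊢
            have h2 : ‖t • h‖ ≤ ‖h‖ := by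
              rw [norm_smul, Real.norm_of_nonneg ht.1.le]
              nlinarith [norm_nonneg h, ht.2]
            linarith [norm_add_le x (t • h)]
          rw [Set.indicator_of_mem hx, Set.indicator_of_mem hx']
        · rw [Set.indicator_of_notMem hx]
          exact zero_le
    _ = _ := by simp

/-- A limit of functions whose gradients tend to zero locally in `L²` is invariant under
translations. -/
lemma ae_translate_eq {v : ℕ → EuclideanSpace ℝ (Fin N) → ℝ} {f : EuclideanSpace ℝ (Fin N) → ℝ}
    (hv : ∀ k, ContDiff ℝ ∞ (v k))
    (hvf : ∀ᵐ x, Tendsto (fun k => v k x) atTop (𝓝 (f x)))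
    (hg : ∀ R : ℝ, Tendsto (fun k => ∫⁻ x in Metric.ball 0 R, ENNReal.ofReal (gradSq (v k) x))
      atTop (𝓝 0)) (h : EuclideanSpace ℝ (Fin N)) : ∀ᵐ x, f (x + h) = f x := by
  have hvh : ∀ᵐ x, Tendsto (fun k => v k (x + h)) atTop (𝓝 (f (x + h))) :=
    (quasiMeasurePreserving_add_right volume h).ae hvf
  have hR : ∀ R : ℕ, ∀ᵐ x, x ∈ Metric.ball 0 (R : ℝ) → f (x + h) = f x := by
    intro R
    have hfm : AEStronglyMeasurable f volume :=
      aestronglyMeasurable_of_tendsto_ae atTop (fun k => (hv k).continuous.aestronglyMeasurable) hvf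
    have hfm2 : AEStronglyMeasurable (fun x => f (x + h)) volume :=
      aestronglyMeasurable_of_tendsto_ae atTop
        (fun k => ((hv k).continuous.comp (continuous_add_const h)).aestronglyMeasurable) hvh
    have h0 : ∫⁻ x in Metric.ball 0 (R : ℝ), ENNReal.ofReal ((f (x + h) - f x) ^ 2) = 0 := by
      refine le_antisymm ?_ zero_le
      calc _ = ∫⁻ x in Metric.ball 0 (R : ℝ),
            liminf (fun k => ENNReal.ofReal ((v k (x + h) - v k x) ^ 2)) atTop := by
            refine lintegral_congr_ae (ae_restrict_of_ae ?_)
            filter_upwards [hvf, hvh] with x h1 h2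
            exact (((ENNReal.continuous_ofReal.tendsto _).comp
              ((h2.sub h1).pow 2)).liminf_eq).symm
        _ ≤ liminf (fun k => ∫⁻ x in Metric.ball 0 (R : ℝ),
            ENNReal.ofReal ((v k (x + h) - v k x) ^ 2)) atTop := by
            refine lintegral_liminf_le fun k => ?_
            have hc := (hv k).continuous
            have hc2 : Continuous fun x => (v k (x + h) - v k x) ^ 2 := by fun_prop
            exact hc2.measurable.ennreal_ofReal
        _ ≤ liminf (fun k => ENNReal.ofReal (‖h‖ ^ 2) * ∫⁻ x in Metric.ball 0 (R + ‖h‖),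
            ENNReal.ofReal (gradSq (v k) x)) atTop :=
            liminf_le_liminf (Eventually.of_forall fun k => lintegral_sq_sub_le (hv k) h R)
        _ = 0 := by
            have := ENNReal.Tendsto.const_mul (hg (R + ‖h‖))
              (Or.inr (ENNReal.ofReal_ne_top (r := ‖h‖ ^ 2)))
            rw [mul_zero] at this
            exact this.liminf_eq
    have hm : AEMeasurable (fun x => ENNReal.ofReal ((f (x + h) - f x) ^ 2))
        (volume.restrict (Metric.ball 0 (R : ℝ))) :=
      ((hfm2.sub hfm).pow 2).aemeasurable.ennreal_ofReal.restrict
    rw [lintegral_eq_zero_iff' hm] at h0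
    rw [← ae_restrict_iff' measurableSet_ball]
    filter_upwards [h0] with x hx
    have h1 : (f (x + h) - f x) ^ 2 ≤ 0 := ENNReal.ofReal_eq_zero.1 hx
    have h2 : f (x + h) - f x = 0 := by nlinarith [sq_nonneg (f (x + h) - f x)]
    linarith
  filter_upwards [ae_all_iff.2 hR] with x hx
  obtain ⟨R, hR⟩ := exists_nat_gt ‖x‖
  exact hx R (by simpa using hR)

/-- A translation invariant measurable function is constant. -/
lemma exists_ae_eq_const {f : EuclideanSpace ℝ (Fin N) → ℝ} (hf : AEMeasurable f volume)
    (hinv : ∀ h, ∀ᵐ x, f (x + h) = f x) : ∃ c, ∀ᵐ x, f x = c := by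
  -- A Borel representative makes the set of pairs below measurable.
  obtain ⟨g, hg, hfg⟩ := hf
  have hginv : ∀ h, ∀ᵐ x, g (x + h) = g x := by
    intro h
    filter_upwards [hinv h, hfg, (quasiMeasurePreserving_add_right volume h).ae hfg] with x h1 h2 h3
    rw [← h2, ← h3, h1]
  have hm : MeasurableSet {p : EuclideanSpace ℝ (Fin N) × EuclideanSpace ℝ (Fin N) |
      g (p.2 + p.1) = g p.2} :=
    measurableSet_eq_fun (by fun_prop) (by fun_prop)
  -- The exceptional null set of x depends on h. Fubini exchanges the roles, and one good x already
  -- determines g almost everywhere.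
  have h1 : ∀ᵐ x : EuclideanSpace ℝ (Fin N), ∀ᵐ h : EuclideanSpace ℝ (Fin N), g (x + h) = g x :=
    (Measure.ae_ae_comm (p := fun h x => g (x + h) = g x) hm).1 (Eventually.of_forall hginv)
  obtain ⟨x, hx⟩ := h1.exists
  refine ⟨g x, ?_⟩
  have h2 := (quasiMeasurePreserving_add_left volume (-x)).ae hx
  filter_upwards [h2, hfg] with y h3 h4
  rw [h4, ← h3]
  congr 1
  abel

end Translations

/-! ### Rigidity of extremals and non-attainment for two poles -/

section NullCritical

variable {N n : ℕ} (a : Fin n → EuclideanSpace ℝ (Fin N)) {s α β : ℝ}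

/-- On a bounded set all regularized squared distances are at most B, uniformly for s ≤ 1, which
bounds both the rate and φ from below. -/
lemma exists_weight_lower_bound (hn : n ≠ 0) (hα : n * α = (N : ℝ) - 4) (hα0 : 0 < α) (R : ℝ) :
    ∃ c, 0 < c ∧ ∀ s, 0 < s → s ≤ 1 → ∀ x ∈ Metric.ball (0 : EuclideanSpace ℝ (Fin N)) R,
      c ≤ 2 * rate a s (fun _ => α) x * prodPow a s (fun _ => α) x ^ 2 := by
  set M := ∑ i, ‖a i‖ with hM
  set B := (|R| + M) ^ 2 + 1 with hB
  have hB0 : 0 < B := by positivity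
  refine ⟨2 * (2 * α * B⁻¹) * ((B ^ (-(α / 2))) ^ n) ^ 2, by positivity, fun s hs hs1 x hx => ?_⟩
  have hρ : ∀ i, ‖x - a i‖ ^ 2 + s ≤ B := by
    intro i
    have h1 : ‖a i‖ ≤ M := Finset.single_le_sum (f := fun i => ‖a i‖)
      (fun j _ => norm_nonneg _) (Finset.mem_univ i)
    have h2 : ‖x‖ < R := mem_ball_zero_iff.1 hx
    have h3 : ‖x - a i‖ ≤ |R| + M := (norm_sub_le _ _).trans (by linarith [le_abs_self R])
    have h4 : ‖x - a i‖ ^ 2 ≤ (|R| + M) ^ 2 := pow_le_pow_left₀ (norm_nonneg _) h3 2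
    linarith
  have hr : 2 * α * B⁻¹ ≤ rate a s (fun _ => α) x := by
    refine le_trans ?_ (rate_ge a hα hα0.le hs.le x)
    let i₀ : Fin n := ⟨0, Nat.pos_of_ne_zero hn⟩
    have h1 : B⁻¹ ≤ invSq a s i₀ x := inv_anti₀ (rho_pos a hs i₀ x) (hρ i₀)
    have h2 : invSq a s i₀ x ≤ ∑ i, invSq a s i x :=
      Finset.single_le_sum (f := fun i => invSq a s i x) (fun i _ => invSq_nonneg a hs.le i x)
        (Finset.mem_univ i₀)
    have h3 := h1.trans h2
    gcongr
  have hp : (B ^ (-(α / 2))) ^ n ≤ prodPow a s (fun _ => α) x := by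
    calc (B ^ (-(α / 2))) ^ n = ∏ _i : Fin n, B ^ (-(α / 2)) := by simp
      _ ≤ _ := Finset.prod_le_prod (fun i _ => by positivity) fun i _ =>
        Real.rpow_le_rpow_of_nonpos (rho_pos a hs i x) (hρ i) (by linarith)
  have hr0 : 0 ≤ rate a s (fun _ => α) x := le_trans (by positivity) hr
  gcongr

/-- With u = φv the first-order term of the remainder is exactly φ∇v; the square containing the
Laplacian is discarded. -/
lemma rate_mul_gradSq_le_remainder (hs : 0 < s) {u : EuclideanSpace ℝ (Fin N) → ℝ}
    (hu : ContDiff ℝ ∞ u) (x : EuclideanSpace ℝ (Fin N)) :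
    2 * rate a s (fun _ => α) x * prodPow a s (fun _ => α) x ^ 2 *
      gradSq (fun y => u y * (prodPow a s (fun _ => α) y)⁻¹) x ≤ remainder a s α u x := by
  set φ := prodPow a s (fun _ => α) with hφ
  have hφp : ∀ x, 0 < φ x := prodPow_pos a _ hs
  have hφc : ContDiff ℝ ∞ φ := contDiff_prodPow a _ hs
  set v := fun y => u y * (φ y)⁻¹ with hv
  have hvc : ContDiff ℝ ∞ v := hu.mul (hφc.inv fun x => (hφp x).ne')
  have huv : u = fun y => φ y * v y := by
    funext y; simp only [hv]; field_simp [(hφp y).ne']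
  have h1 : ∀ k, pd k u x + logGrad a s (fun _ => α) k x * u x = φ x * pd k v x := by
    intro k
    have hp : pd k u x = pd k φ x * v x + φ x * pd k v x := by
      conv_lhs => rw [huv]
      exact pd_mul k hφc hvc x
    rw [hp, congrFun huv x, hφ, pd_prodPow a _ hs]
    ring
  unfold remainder gradSq
  simp only [h1, mul_pow, ← Finset.mul_sum]
  nlinarith [sq_nonneg (Δ u x + rate a s (fun _ => α) x * u x)]

lemma singPow_pos {x : EuclideanSpace ℝ (Fin N)} (hx : ∀ i, x ≠ a i) (β : ℝ) :
    0 < singPow a β x := by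
  unfold singPow prodPow
  exact Finset.prod_pos fun i _ => Real.rpow_pos_of_pos (rho_pos_of_ne a le_rfl hx i) _

/-- A function attaining equality in the Rellich inequality is a multiple of the ground state. -/
theorem exists_eq_const_mul_singPow (hN : 5 ≤ N) (hn : n ≠ 0) (hα : n * α = (N : ℝ) - 4)
    (hα0 : 0 < α) {u g : EuclideanSpace ℝ (Fin N) → ℝ} (h : MemD22 u g)
    (heq : ∫ x, g x ^ 2 ≤ rellichConst N n * ∫ x, potential a x * u x ^ 2) :
    ∃ c, ∀ᵐ x, u x = c * singPow a α x := by
  obtain ⟨hg, w, hw, hwg, hwu⟩ := h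
  have hrem := tendsto_remainder a hN hn hα hα0.le hg hw hwg hwu heq
  set v := fun (k : ℕ) y => w k y * (prodPow a (scale k) (fun _ => α) y)⁻¹ with hv
  have hvc : ∀ k, ContDiff ℝ ∞ (v k) := fun k => (hw k).1.mul
    ((contDiff_prodPow a _ (scale_pos k)).inv fun x => (prodPow_pos a _ (scale_pos k) x).ne')
  have hvf : ∀ᵐ x, Tendsto (fun k => v k x) atTop (𝓝 (u x * (singPow a α x)⁻¹)) := by
    filter_upwards [hwu, ae_ne_poles a (by omega)] with x h1 hx
    exact h1.mul ((tendsto_prodPow a hx α).inv₀ (singPow_pos a hx α).ne')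
  have hgr : ∀ R : ℝ, Tendsto (fun k => ∫⁻ x in Metric.ball 0 R, ENNReal.ofReal (gradSq (v k) x))
      atTop (𝓝 0) := by
    intro R
    obtain ⟨c, hc, hb⟩ := exists_weight_lower_bound a hn hα hα0 R
    have hle : ∀ k, ∫⁻ x in Metric.ball 0 R, ENNReal.ofReal (gradSq (v k) x) ≤
        ENNReal.ofReal (c⁻¹ * ∫ x, remainder a (scale k) α (w k) x) := by
      intro k
      rw [← integral_const_mul, ofReal_integral_eq_lintegral_ofReal
        ((integrable_remainder a (scale_pos k) (hw k)).const_mul _)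
        (Eventually.of_forall fun x => mul_nonneg (by positivity)
          (remainder_nonneg a hα hα0.le (scale_pos k).le (w k) x))]
      refine le_trans (setLIntegral_mono' measurableSet_ball fun x hx => ?_)
        (setLIntegral_le_lintegral _ _)
      refine ENNReal.ofReal_le_ofReal ?_
      rw [inv_mul_eq_div, le_div_iff₀ hc]
      have h1 := rate_mul_gradSq_le_remainder a (α := α) (scale_pos k) (hw k).1 x
      refine le_trans ?_ h1
      rw [mul_comm]
      exact mul_le_mul_of_nonneg_right (hb _ (scale_pos k) (scale_le_one k) x hx)
        (gradSq_nonneg _ _)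
    have hlim := (ENNReal.continuous_ofReal.tendsto _).comp (hrem.const_mul c⁻¹)
    rw [mul_zero, ENNReal.ofReal_zero] at hlim
    exact tendsto_of_tendsto_of_tendsto_of_le_of_le tendsto_const_nhds hlim
      (fun _ => zero_le) hle
  have hfm : AEMeasurable (fun x => u x * (singPow a α x)⁻¹) volume :=
    (aestronglyMeasurable_of_tendsto_ae atTop
      (fun k => (hvc k).continuous.aestronglyMeasurable) hvf).aemeasurable
  obtain ⟨c, hc⟩ := exists_ae_eq_const hfm (ae_translate_eq hvc hvf hgr)
  refine ⟨c, ?_⟩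
  filter_upwards [hc, ae_ne_poles a (by omega)] with x h1 hx
  have := (singPow_pos a hx α).ne'
  rw [← h1]
  field_simp

/-- For two poles the ground state is not in the energy space. -/
lemma not_integrable_potential_mul_singPow_sq {a : Fin 2 → EuclideanSpace ℝ (Fin N)}
    (ha : Function.Injective a) (hN : 5 ≤ N) (hα : 2 * α = (N : ℝ) - 4) :
    ¬ Integrable fun x => potential a x * singPow a α x ^ 2 := by
  intro hi
  have : Nonempty (Fin N) := ⟨⟨0, by omega⟩⟩
  have hN5 : (5 : ℝ) ≤ N := by exact_mod_cast hN
  have hα0 : 0 ≤ α := by linarith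
  set A := ‖a 0 - a 1‖ with hA
  have hA0 : 0 < A := norm_pos_iff.2 (sub_ne_zero.2 fun e => by simpa using ha e)
  -- On the unit ball about a_0 one has |x - a_1| ≤ 1 + A, which gives V φ² ≥ κ |x - a_0|^(-N).
  set κ := A ^ 2 * (nu N (0 : Fin 2) 0 1 * nu N (1 : Fin 2) 0 1 * A ^ 2) * (1 + A) ^ (-(N : ℝ)) with hκ
  have hnu : ∀ k : Fin 2, 0 < nu N k 0 1 := fun k => nu_pos hN k 0 1
  have hκ0 : 0 < κ := by
    have := hnu 0
    have := hnu 1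
    positivity
  have hinv : ∀ (i : Fin 2) (x : EuclideanSpace ℝ (Fin N)),
      invSq a 0 i x = ‖x - a i‖ ^ (-2 : ℝ) := by
    intro i x
    rw [invSq, add_zero, Real.rpow_neg (norm_nonneg _)]
    norm_cast
  have hle : ∀ᵐ x, (Set.Iio (1 : ℝ)).indicator (fun t => t ^ (-(N : ℝ))) ‖x - a 0‖ ≤
      κ⁻¹ * (potential a x * singPow a α x ^ 2) := by
    filter_upwards [ae_ne_poles a (by omega)] with x hx
    have hV0 : 0 ≤ potential a x * singPow a α x ^ 2 :=
      mul_nonneg (potential_nonneg a hN x) (sq_nonneg _)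
    by_cases h1 : ‖x - a 0‖ < 1
    · rw [Set.indicator_of_mem (show ‖x - a 0‖ ∈ Set.Iio (1 : ℝ) from h1)]
      have hd : ∀ i, 0 < ‖x - a i‖ := fun i => norm_pos_iff.2 (sub_ne_zero.2 (hx i))
      have h2 : ‖x - a 1‖ ≤ 1 + A := by
        have := norm_add_le (x - a 0) (a 0 - a 1)
        rw [sub_add_sub_cancel] at this
        linarith
      have h3 := le_potential a (x := x) hN (show (0 : Fin 2) < 1 by simp)
      rw [inv_mul_eq_div, le_div_iff₀ hκ0]
      -- The exponents add up to 4 + 2α = N, the borderline of integrability.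
      have h4 : ∀ i, ‖x - a i‖ ^ (-2 : ℝ) * ‖x - a i‖ ^ (-2 : ℝ) * (‖x - a i‖ ^ (-α)) ^ 2 =
          ‖x - a i‖ ^ (-(N : ℝ)) := by
        intro i
        rw [← Real.rpow_natCast (‖x - a i‖ ^ (-α)), ← Real.rpow_mul (norm_nonneg _),
          ← Real.rpow_add (hd i), ← Real.rpow_add (hd i)]
        congr 1
        push_cast
        linarith
      have h5 : (1 + A) ^ (-(N : ℝ)) ≤ ‖x - a 1‖ ^ (-(N : ℝ)) :=
        Real.rpow_le_rpow_of_nonpos (hd 1) h2 (by linarith)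
      have := hnu 0
      have := hnu 1
      calc ‖x - a 0‖ ^ (-(N : ℝ)) * κ ≤ ‖x - a 0‖ ^ (-(N : ℝ)) *
            (A ^ 2 * (nu N (0 : Fin 2) 0 1 * nu N (1 : Fin 2) 0 1 * A ^ 2) * ‖x - a 1‖ ^ (-(N : ℝ))) := by
            rw [hκ]
            gcongr
        _ = A ^ 2 * (invSq a 0 0 x * invSq a 0 1 x) *
              (nu N (0 : Fin 2) 0 1 * nu N (1 : Fin 2) 0 1 * A ^ 2 * (invSq a 0 0 x * invSq a 0 1 x)) *
                singPow a α x ^ 2 := by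
            rw [← h4 0, ← h4 1, hinv, hinv, singPow_eq, Fin.prod_univ_two]
            ring
        _ ≤ _ := by gcongr
    · rw [Set.indicator_of_notMem (show ‖x - a 0‖ ∉ Set.Iio (1 : ℝ) from h1)]
      positivity
  have hI : Integrable fun x : EuclideanSpace ℝ (Fin N) =>
      (Set.Iio (1 : ℝ)).indicator (fun t => t ^ (-(N : ℝ))) ‖x - a 0‖ := by
    have hm : Measurable ((Set.Iio (1 : ℝ)).indicator fun t : ℝ => t ^ (-(N : ℝ))) :=
      (measurable_id.pow_const _).indicator measurableSet_Iio
    refine (hi.const_mul κ⁻¹).mono' (hm.comp (by fun_prop)).aestronglyMeasurable ?_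
    filter_upwards [hle] with x hx
    rwa [Real.norm_of_nonneg (Set.indicator_apply_nonneg fun _ => by positivity)]
  have hI2 : Integrable fun x : EuclideanSpace ℝ (Fin N) =>
      (Set.Iio (1 : ℝ)).indicator (fun t => t ^ (-(N : ℝ))) ‖x‖ := by
    simpa using hI.comp_add_right (a 0)
  rw [integrable_fun_norm_addHaar volume, finrank_euclideanSpace_fin] at hI2
  have hI3 := hI2.mono_set (Set.Ioo_subset_Ioi_self (a := (1 : ℝ)) (b := 0))
  -- In polar coordinates the Jacobian leaves 1/y, which is not integrable at zero.
  have hcongr : ∀ y ∈ Set.Ioo (0 : ℝ) 1, y ^ (N - 1) •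
      (Set.Iio (1 : ℝ)).indicator (fun t => t ^ (-(N : ℝ))) y = y ^ (-1 : ℝ) := by
    intro y hy
    have hN1 : ((N - 1 : ℕ) : ℝ) = N - 1 := by
      rw [Nat.cast_sub (by omega)]; simp
    rw [Set.indicator_of_mem (show y ∈ Set.Iio (1 : ℝ) from hy.2), smul_eq_mul,
      ← Real.rpow_natCast, ← Real.rpow_add hy.1, hN1]
    congr 1
    ring
  rw [integrableOn_congr_fun hcongr measurableSet_Ioo,
    intervalIntegral.integrableOn_Ioo_rpow_iff one_pos] at hI3
  exact lt_irrefl _ hI3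

theorem notMem_rayleighQuotients {a : Fin 2 → EuclideanSpace ℝ (Fin N)}
    (ha : Function.Injective a) (hN : 5 ≤ N) :
    rellichConst N 2 ∉ rayleighQuotients (potential a) := by
  rintro ⟨u, g, h, hu, hq⟩
  have hN5 : (5 : ℝ) ≤ N := by exact_mod_cast hN
  obtain ⟨hi, hpos⟩ := (isSharpConstant_potential a ha hN le_rfl).1 u g h hu
  rw [eq_div_iff hpos.ne'] at hq
  have hα : ((2 : ℕ) : ℝ) * (((N : ℝ) - 4) / 2) = (N : ℝ) - 4 := by push_cast; ring
  obtain ⟨c, hc⟩ := exists_eq_const_mul_singPow a hN two_ne_zero hα (by linarith) h hq.ge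
  by_cases hc0 : c = 0
  · refine hu ?_
    filter_upwards [hc] with x hx
    simp [hx, hc0]
  · refine not_integrable_potential_mul_singPow_sq ha hN (by linarith) (α := ((N : ℝ) - 4) / 2) ?_
    refine (hi.const_mul (c ^ 2)⁻¹).congr ?_
    filter_upwards [hc] with x hx
    rw [hx]
    field_simp

end NullCritical

end MultipolarRellich

/-- The operator `H_n = Δ² - (N² (N - 4)² / n⁴) V_n` with `n ≥ 2` distinct poles in `ℝ^N`, `N ≥ 5`,
is critical; it is positive-critical for `n ≥ 3` and null-critical for `n = 2`. -/
theorem proposition1p6 (N n : ℕ) (hN : 5 ≤ N) (hn : 2 ≤ n)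
    (a : Fin n → EuclideanSpace ℝ (Fin N)) (ha : Function.Injective a) :
    MultipolarRellich.IsCritical (MultipolarRellich.rellichConst N n)
        (MultipolarRellich.potential a) ∧
      (3 ≤ n → MultipolarRellich.IsPositiveCritical (MultipolarRellich.rellichConst N n)
        (MultipolarRellich.potential a)) ∧
      (n = 2 → MultipolarRellich.IsNullCritical (MultipolarRellich.rellichConst N n)
        (MultipolarRellich.potential a)) := by
  have hcrit := MultipolarRellich.isCritical_potential a ha hN hn
  have hsharp := MultipolarRellich.isSharpConstant_potential a ha hN hn
  refine ⟨hcrit, fun h3 => ⟨hcrit, hsharp, MultipolarRellich.mem_rayleighQuotients a ha hN h3⟩,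
    fun h2 => ⟨hcrit, hsharp, ?_⟩⟩
  subst h2
  exact MultipolarRellich.notMem_rayleighQuotients ha hN
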